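/- \textbf{Setting.} Let $d\in\{1,2,3\}$ and let $\Omega\subset\mathbb R^d$ be either a bounded domain with smooth boundary, with the homogeneous Neumann condition $\partial\phi/\partial n|_{\partial\Omega}=0$, or a box $\prod_{i}(0,L_i)$ with periodic boundary conditions (all Sobolev spaces are then the periodic ones). Write $\|\cdot\|$ for the $L^2(\Omega)$ norm and $\|\cdot\|_1$ for the $H^1(\Omega)$ norm. Let $\varepsilon>0$, $\lambda\ge 0$, $g\in C^2(\mathbb R)$, and let $C_0$ be a constant such that $E_1(\phi):=\int_\Omega g(\phi)\,dx+C_0>0$ for all $\phi\in H^2(\Omega)$ satisfying the boundary condition. If $d\ge2$, assume moreover $|g''(s)|\le K(|s|^p+1)$ for all $s\in\mathbb R$, for some $K$ and some $p>0$, with $p<4$ if $d=3$. Let $V\in C^2(\mathbb R)$ with $V(1)=1$, $V'(1)=-1$. Let $$G(s,z)=\frac{2+4s-s^{3/2}}{1+s}-\frac{z^{3/2}}{1+z},$$ let $\gamma_{**}\approx 4.8645$ be the positive root of $G(z,z)=0$, and let $4\le\gamma_*<\gamma_{**}$. Let $\phi^0\in H^2(\Omega)$ satisfy the boundary condition. \textbf{Scheme.}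 For $T\geq 0$ let $0=t_0<t_1<\dots<t_N=T$, $\Delta t_n=t_n-t_{n-1}$, $\gamma_n=\Delta t_n/\Delta t_{n-1}$, with $0<\gamma_{n}\le\gamma_*$ for $2\le n\le N$, and let $\gamma_{N+1}$ be any number in $(0,\gamma_*]$. The VBDF2 scheme for the $L^2$ gradient flow with initial value $\phi^0$, $r^0=\sqrt{E_1(\phi^0)}$, computes $\phi^n$ (in $H^1(\Omega)$ with $\Delta\phi^n\in L^2(\Omega)$, satisfying the boundary condition) and $r^n\in\mathbb R$, $1\le n\le N$, such that, with $\xi^{n+1}=r^{n+1}/\sqrt{E_1(\phi^n)}$, for $1\le n<N$, $$\frac1{\Delta t_{n+1}}\Big[\tfrac{1+2\gamma_{n+1}}{1+\gamma_{n+1}}\phi^{n+1}-(1+\gamma_{n+1})\phi^n+\tfrac{\gamma_{n+1}^2}{1+\gamma_{n+1}}\phi^{n-1}\Big]=-\mu^{n+1},$$ $$\mu^{n+1}=-\varepsilon^2\Delta\phi^{n+1}+\lambda\phi^{n+1}+\frac{r^{n+1}}{\sqrt{E_1(\phi^n)}}V(\xi^{n+1})g'(\phi^{*,n+1}),\qquad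 \phi^{*,n+1}=\phi^n+\gamma_{n+1}(\phi^n-\phi^{n-1}),$$ $$\frac{r^{n+1}-r^n}{\Delta t_{n+1}}=\frac{V(\xi^{n+1})}{2\sqrt{E_1(\phi^n)}}\int_\Omega g'(\phi^{*,n+1})\frac{\phi^{n+1}-\phi^n}{\Delta t_{n+1}}\,dx,$$ while the first step ($n=0$) is the first order scheme obtained by replacing the difference quotient in the first equation by $(\phi^1-\phi^0)/\Delta t_1$, $\phi^{*,1}$ by $\phi^0$ and $V$ by $1$. \textbf{Theorem.} With $\Omega$ and its boundary condition, $\varepsilon,\lambda,g,C_0,V,\gamma_*$ and $\phi^0$ fixed: (a) There is a constant $M$ such that every solution of the scheme satisfies $\|\phi^n\|_1+|r^n|\le M$ for $0\le n\le N$. If $\lambda>0$, $M$ can be chosen independently of $T$ and of the time mesh; if $\lambda=0$, $M$ may depend on $T$, but not on the time mesh. (b) For every $M$ there is a constant $C=C(M,\gamma_*)>0$, independent of $T$, $N$ and the time mesh, such that every solution of the scheme with $\|\phi^n\|_1+|r^n|\le M$ for $0\le n\le N$ satisfies, for all $0\le n<N$, $$\frac{\gamma_{n+2}^{3/2}}{1+\gamma_{n+2}}\frac{\|\nabla(\phi^{n+1}-\phi^n)\|^2}{2\Delta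 t_{n+1}}+\frac{\varepsilon^2}{2}\|\Delta\phi^{n+1}\|^2+\frac\lambda2\|\nabla\phi^{n+1}\|^2\le C(M,\gamma_*)(1+T)+\max\Big\{\frac{\gamma_*^{3/2}}{1+\gamma_*},1\Big\}\frac{\varepsilon^2}{2}\|\Delta\phi^0\|^2 .$$ -/

import Mathlib

open MeasureTheory
open scoped ContDiff

noncomputable section

namespace VBDF2

/-- Euclidean space `ℝ^d`. -/
abbrev E (d : ℕ) : Type := EuclideanSpace ℝ (Fin d)

/-- The `i`-th coordinate vector of `ℝ^d`. -/
def basisVec {d : ℕ} (i : Fin d) : E d := EuclideanSpace.single i (1 : ℝ)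

/-- A bounded domain (nonempty, open, connected) with `C^∞` boundary: near each boundary point
the domain is the negativity set of a smooth function with nonvanishing gradient. -/
structure IsSmoothBoundedDomain {d : ℕ} (Ω : Set (E d)) : Prop where
  isOpen : IsOpen Ω
  isConnected : IsConnected Ω
  isBounded : Bornology.IsBounded Ω
  smooth_boundary : ∀ x ∈ frontier Ω, ∃ U : Set (E d), IsOpen U ∧ x ∈ U ∧
    ∃ f : E d → ℝ, ContDiffOn ℝ ∞ f U ∧ fderiv ℝ f x ≠ 0 ∧ Ω ∩ U = {y ∈ U | f y < 0}

/-- A spatial domain together with its boundary condition: either a bounded smooth domain with the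
homogeneous Neumann condition, or the box `∏ (0, L i)` with the periodic condition. -/
inductive Domain (d : ℕ) : Type
  | neumann (Ω : Set (E d)) (hΩ : IsSmoothBoundedDomain Ω) : Domain d
  | periodic (L : Fin d → ℝ) (hL : ∀ i, 0 < L i) : Domain d

namespace Domain

variable {d : ℕ} (P : Domain d)

/-- The underlying set `Ω`. -/
def carrier : Domain d → Set (E d)
  | neumann Ω _ => Ω
  | periodic L _ => {x | ∀ i, x i ∈ Set.Ioo 0 (L i)}

/-- Test functions for weak derivatives: smooth and compactly supported in `Ω`, or, for the
periodic condition, smooth and periodic (that is, smooth functions on the torus). -/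
def IsTest : Domain d → (E d → ℝ) → Prop
  | neumann Ω _, ψ => ContDiff ℝ ∞ ψ ∧ HasCompactSupport ψ ∧ tsupport ψ ⊆ Ω
  | periodic L _, ψ => ContDiff ℝ ∞ ψ ∧ ∀ i x, ψ (x + L i • basisVec i) = ψ x

/-- Lebesgue measure on `Ω`. -/
def vol : Measure (E d) := volume.restrict P.carrier

/-- `v ∈ L²` is the weak `i`-th partial derivative of `u`. -/
def HasWeakPartial (i : Fin d) (u v : E d → ℝ) : Prop :=
  MemLp v 2 P.vol ∧ ∀ ψ, P.IsTest ψ →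
    ∫ x, u x * fderiv ℝ ψ x (basisVec i) ∂P.vol = - ∫ x, v x * ψ x ∂P.vol

open Classical in
/-- The weak partial derivative in `L²` (determined almost everywhere; `0` if there is none). -/
def weakPartial (i : Fin d) (u : E d → ℝ) : E d → ℝ :=
  if h : ∃ v, P.HasWeakPartial i u v then h.choose else 0

/-- `u ∈ H¹` (periodic `H¹` for the periodic condition). -/
def MemH1 (u : E d → ℝ) : Prop :=
  MemLp u 2 P.vol ∧ ∀ i, ∃ v, P.HasWeakPartial i u v

/-- `u ∈ H²` (periodic `H²` for the periodic condition). -/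
def MemH2 (u : E d → ℝ) : Prop :=
  P.MemH1 u ∧ ∀ i, P.MemH1 (P.weakPartial i u)

/-- `w ∈ L²` is the Laplacian of `u ∈ H¹`, and `u` satisfies the boundary condition:
`(∇u, ∇ψ) = -(w, ψ)` for all `ψ ∈ H¹`. For the Neumann condition this Green identity is the
variational form of `∂u/∂n = 0`; for the periodic condition `H¹` is the periodic space. -/
def HasLaplacian (u w : E d → ℝ) : Prop :=
  P.MemH1 u ∧ MemLp w 2 P.vol ∧ ∀ ψ, P.MemH1 ψ →
    ∑ i, ∫ x, P.weakPartial i u x * P.weakPartial i ψ x ∂P.vol = - ∫ x, w x * ψ x ∂P.vol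

open Classical in
/-- The Laplacian in `L²` (determined almost everywhere; `0` if there is none). -/
def laplacian (u : E d → ℝ) : E d → ℝ :=
  if h : ∃ w, P.HasLaplacian u w then h.choose else 0

/-- `u ∈ H²` and `u` satisfies the boundary condition. -/
def MemH2BC (u : E d → ℝ) : Prop :=
  P.MemH2 u ∧ ∃ w, P.HasLaplacian u w

/-- `‖u‖²`, the squared `L²` norm. -/
def normSq (u : E d → ℝ) : ℝ := ∫ x, u x ^ 2 ∂P.vol

/-- `‖∇u‖²`. -/
def gradNormSq (u : E d → ℝ) : ℝ := ∑ i, P.normSq (P.weakPartial i u)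

/-- The `H¹` norm. -/
def normH1 (u : E d → ℝ) : ℝ := Real.sqrt (P.normSq u + P.gradNormSq u)

/-- `E₁(φ) = ∫_Ω g(φ) dx + C₀`. -/
def E1 (g : ℝ → ℝ) (C₀ : ℝ) (φ : E d → ℝ) : ℝ := ∫ x, g (φ x) ∂P.vol + C₀

end Domain

/-- The adjacent time-step ratio `γ_n = Δt_n / Δt_{n-1}`, used for `n ≥ 2`. -/
def ratio (τ : ℕ → ℝ) (n : ℕ) : ℝ := τ n / τ (n - 1)

/-- `G(s,z)` for `σ = 1`. -/
def G (s z : ℝ) : ℝ :=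
  (2 + 4 * s - s ^ (3 / 2 : ℝ)) / (1 + s) - z ^ (3 / 2 : ℝ) / (1 + z)

/-- Time steps `τ n = Δt_n`, `1 ≤ n ≤ N`, of a mesh of `[0,T]` whose adjacent ratios are at most
`γs`. One further positive step `τ (N+1)` (not counted in `T`) gives a meaning to `γ_{N+1}`. -/
structure IsMesh (γs T : ℝ) (N : ℕ) (τ : ℕ → ℝ) : Prop where
  pos : ∀ n, 1 ≤ n → n ≤ N + 1 → 0 < τ n
  ratio_le : ∀ n, 2 ≤ n → n ≤ N + 1 → ratio τ n ≤ γs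
  sum_eq : ∑ n ∈ Finset.Icc 1 N, τ n = T

/-- The variable-step BDF2 difference quotient at `t_{n+1}`, for `n ≥ 1`. -/
def F2 {d : ℕ} (τ : ℕ → ℝ) (φ : ℕ → E d → ℝ) (n : ℕ) (x : E d) : ℝ :=
  1 / τ (n + 1) *
    ((1 + 2 * ratio τ (n + 1)) / (1 + ratio τ (n + 1)) * φ (n + 1) x
      - (1 + ratio τ (n + 1)) * φ n x
      + ratio τ (n + 1) ^ 2 / (1 + ratio τ (n + 1)) * φ (n - 1) x)

/-- The extrapolation `φ^{*,n+1} = φ^n + γ_{n+1} (φ^n - φ^{n-1})`, for `n ≥ 1`. -/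
def extrap {d : ℕ} (τ : ℕ → ℝ) (φ : ℕ → E d → ℝ) (n : ℕ) (x : E d) : ℝ :=
  φ n x + ratio τ (n + 1) * (φ n x - φ (n - 1) x)

/-- `ξ^{n+1} = r^{n+1} / √(E₁(φ^n))`. -/
def xi {d : ℕ} (P : Domain d) (g : ℝ → ℝ) (C₀ : ℝ) (φ : ℕ → E d → ℝ) (r : ℕ → ℝ) (n : ℕ) : ℝ :=
  r (n + 1) / Real.sqrt (P.E1 g C₀ (φ n))

/-- The chemical potential
`μ^{n+1} = -ε² Δφ^{n+1} + λ φ^{n+1} + r^{n+1} / √(E₁(φ^n)) V(ξ^{n+1}) g'(φs)`,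
where `φs` is the explicit approximation used inside `g'`. -/
def mu {d : ℕ} (P : Domain d) (ε lam : ℝ) (g V : ℝ → ℝ) (C₀ : ℝ) (φ : ℕ → E d → ℝ) (r : ℕ → ℝ)
    (n : ℕ) (φs : E d → ℝ) (x : E d) : ℝ :=
  - ε ^ 2 * P.laplacian (φ (n + 1)) x + lam * φ (n + 1) x
    + r (n + 1) / Real.sqrt (P.E1 g C₀ (φ n)) * V (xi P g C₀ φ r n) * deriv g (φs x)

/-- The equation for the auxiliary variable,
`(r^{n+1} - r^n)/Δt_{n+1} = V(ξ^{n+1}) / (2 √(E₁(φ^n))) ∫ g'(φs) (φ^{n+1} - φ^n)/Δt_{n+1}`. -/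
def AuxEq {d : ℕ} (P : Domain d) (g V : ℝ → ℝ) (C₀ : ℝ) (τ : ℕ → ℝ) (φ : ℕ → E d → ℝ) (r : ℕ → ℝ)
    (n : ℕ) (φs : E d → ℝ) : Prop :=
  (r (n + 1) - r n) / τ (n + 1) =
    V (xi P g C₀ φ r n) / (2 * Real.sqrt (P.E1 g C₀ (φ n))) *
      ∫ x, deriv g (φs x) * ((φ (n + 1) x - φ n x) / τ (n + 1)) ∂P.vol

/-- `(φ^n, r^n)`, `0 ≤ n ≤ N`, solves the VBDF2 scheme for the `L²` gradient flow (`G_H = -I`,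
`σ = 1`) with initial value `φ0`. The first step is the first order scheme with `V ≡ 1`.
Each iterate has a Laplacian in `L²` and satisfies the boundary condition. -/
structure IsSolution {d : ℕ} (P : Domain d) (ε lam : ℝ) (g V : ℝ → ℝ) (C₀ : ℝ) (φ0 : E d → ℝ)
    (N : ℕ) (τ : ℕ → ℝ) (φ : ℕ → E d → ℝ) (r : ℕ → ℝ) : Prop where
  init_phi : φ 0 = φ0
  init_r : r 0 = Real.sqrt (P.E1 g C₀ φ0)
  regular : ∀ n, 1 ≤ n → n ≤ N → ∃ w, P.HasLaplacian (φ n) w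
  first_phi : 1 ≤ N → ∀ᵐ x ∂P.vol,
    (φ 1 x - φ 0 x) / τ 1 = - mu P ε lam g (fun _ => 1) C₀ φ r 0 (φ 0) x
  first_r : 1 ≤ N → AuxEq P g (fun _ => 1) C₀ τ φ r 0 (φ 0)
  step_phi : ∀ n, 1 ≤ n → n < N → ∀ᵐ x ∂P.vol,
    F2 τ φ n x = - mu P ε lam g V C₀ φ r n (extrap τ φ n) x
  step_r : ∀ n, 1 ≤ n → n < N → AuxEq P g V C₀ τ φ r n (extrap τ φ n)

end VBDF2

end

noncomputable section

namespace VBDF2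

/-- Smooth functions compactly supported in `U`. -/
def IsBump {d : ℕ} (U : Set (E d)) (η : E d → ℝ) : Prop :=
  ContDiff ℝ ∞ η ∧ HasCompactSupport η ∧ tsupport η ⊆ U

/-- `w` is the weak derivative of `u` in the direction `y` on the open set `U`. -/
def HasWeakDir {d : ℕ} (U : Set (E d)) (y : E d) (u w : E d → ℝ) : Prop :=
  ∀ η, IsBump U η → ∫ x, u x * fderiv ℝ η x y = - ∫ x, w x * η x

variable {d : ℕ}

lemma IsBump.mono {U U' : Set (E d)} (h : U ⊆ U') {η : E d → ℝ} (hη : IsBump U η) : IsBump U' η :=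
  ⟨hη.1, hη.2.1, hη.2.2.trans h⟩

lemma IsBump.exists_bound {U : Set (E d)} {η : E d → ℝ} (hη : IsBump U η) :
    ∃ C, ∀ x, ‖η x‖ ≤ C :=
  hη.2.1.exists_bound_of_continuous hη.1.continuous

lemma IsBump.continuous_fderiv_apply {U : Set (E d)} {η : E d → ℝ} (hη : IsBump U η) (y : E d) :
    Continuous fun x => fderiv ℝ η x y :=
  (hη.1.continuous_fderiv (by simp)).clm_apply continuous_const

lemma IsBump.hasCompactSupport_fderiv_apply {U : Set (E d)} {η : E d → ℝ} (hη : IsBump U η)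
    (y : E d) : HasCompactSupport fun x => fderiv ℝ η x y :=
  (hη.2.1.fderiv (𝕜 := ℝ)).comp_left (g := fun L : E d →L[ℝ] ℝ => L y) (by simp)

lemma IsBump.exists_bound_fderiv {U : Set (E d)} {η : E d → ℝ} (hη : IsBump U η) (y : E d) :
    ∃ C, ∀ x, ‖fderiv ℝ η x y‖ ≤ C :=
  (hη.hasCompactSupport_fderiv_apply y).exists_bound_of_continuous (hη.continuous_fderiv_apply y)

lemma IsBump.translate {U S : Set (E d)} {η : E d → ℝ} (hη : IsBump S η) {z : E d}
    (h : ∀ x ∈ S, x + z ∈ U) : IsBump U (fun x => η (x - z)) := by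
  refine ⟨hη.1.comp (contDiff_id.sub contDiff_const), ?_, ?_⟩
  · exact hη.2.1.comp_homeomorph (Homeomorph.subRight z)
  · have : tsupport (fun x => η (x - z)) = (Homeomorph.subRight z) ⁻¹' tsupport η := by
      have := tsupport_comp_eq_preimage η (Homeomorph.subRight z)
      exact this
    rw [this]
    intro x hx
    have := h _ (hη.2.2 hx)
    simpa using this

lemma fderiv_translate (η : E d → ℝ) (z x : E d) :
    fderiv ℝ (fun x => η (x - z)) x = fderiv ℝ η (x - z) := by
  simpa [sub_eq_add_neg] using fderiv_comp_add_right (𝕜 := ℝ) (f := η) (x := x) (-z)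

lemma integrable_shear {w : E d → ℝ} (hw : Integrable w) (y : E d) :
    Integrable (fun p : ℝ × E d => w (p.2 + p.1 • y))
      ((volume.restrict (Set.Ioc (0 : ℝ) 1)).prod volume) := by
  have hmp : MeasurePreserving (fun p : ℝ × E d => (p.1, p.2 + p.1 • y))
      ((volume.restrict (Set.Ioc (0 : ℝ) 1)).prod volume)
      ((volume.restrict (Set.Ioc (0 : ℝ) 1)).prod volume) := by
    refine MeasurePreserving.skew_product (g := fun (t : ℝ) (x : E d) => x + t • y)
      (MeasurePreserving.id _) (by fun_prop) ?_
    filter_upwards with t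
    exact (measurePreserving_add_right volume (t • y)).map_eq
  have h2 : Integrable (fun p : ℝ × E d => w p.2)
      ((volume.restrict (Set.Ioc (0 : ℝ) 1)).prod volume) := hw.comp_snd _
  exact hmp.integrable_comp_of_integrable h2

lemma integrable_segment {w : E d → ℝ} (hw : Integrable w) (y : E d) :
    Integrable (fun x => ∫ t in (0 : ℝ)..1, w (x + t • y)) := by
  simp_rw [intervalIntegral.integral_of_le zero_le_one]
  exact (integrable_shear hw y).integral_prod_right

/-- A weakly differentiable function satisfies the fundamental theorem of calculus along almost
every segment that stays in the domain. -/
theorem HasWeakDir.sub_eq_integral {U S : Set (E d)} {y : E d} {u w : E d → ℝ}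
    (h : HasWeakDir U y u w) (hu : Integrable u) (hw : Integrable w) (hS : IsOpen S)
    (hSU : ∀ x ∈ S, ∀ t ∈ Set.Icc (0 : ℝ) 1, x + t • y ∈ U) :
    ∀ᵐ x, x ∈ S → u (x + y) - u x = ∫ t in (0 : ℝ)..1, w (x + t • y) := by
  have huy : Integrable (fun x => u (x + y)) := hu.comp_add_right y
  have hD : Integrable (fun x => u (x + y) - u x - ∫ t in (0 : ℝ)..1, w (x + t • y)) :=
    (huy.sub hu).sub (integrable_segment hw y)
  have key := hS.ae_eq_zero_of_integral_contDiff_smul_eq_zero (μ := volume)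
    (hD.locallyIntegrable.locallyIntegrableOn S) (fun η h1 h2 h3 => by
      have hη : IsBump S η := ⟨h1, h2, h3⟩
      obtain ⟨C, hC⟩ := hη.exists_bound
      obtain ⟨C', hC'⟩ := hη.exists_bound_fderiv y
      have hηm : AEStronglyMeasurable η volume := h1.continuous.aestronglyMeasurable
      have e1 : ∫ x, η x * u (x + y) = ∫ x, η (x - y) * u x := by
        rw [← integral_sub_right_eq_self (fun x => η x * u (x + y)) y]
        simp
      have i1 : Integrable (fun x => η x * u (x + y)) := huy.bdd_mul hηm (.of_forall hC)
      have i2 : Integrable (fun x => η x * u x) := hu.bdd_mul hηm (.of_forall hC)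
      have i3 : Integrable (fun x => η (x - y) * u x) :=
        hu.bdd_mul (h1.continuous.comp (continuous_id.sub continuous_const)).aestronglyMeasurable
          (.of_forall fun x => hC _)
      have i4 : Integrable (fun x => η x * ∫ t in (0 : ℝ)..1, w (x + t • y)) :=
        (integrable_segment hw y).bdd_mul hηm (.of_forall hC)
      have ftc : ∀ x, η (x - y) - η x = - ∫ t in (0 : ℝ)..1, fderiv ℝ η (x - t • y) y := by
        intro x
        have hd : ∀ t ∈ Set.uIcc (0 : ℝ) 1,
            HasDerivAt (fun t : ℝ => η (x - t • y)) (- fderiv ℝ η (x - t • y) y) t := by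
          intro t _
          have h5 : HasDerivAt (fun t : ℝ => x - t • y) (-y) t := by
            simpa using ((hasDerivAt_id t).smul_const y).const_sub x
          have h6 : HasFDerivAt η (fderiv ℝ η (x - t • y)) (x - t • y) :=
            (h1.differentiable (by simp) _).hasFDerivAt
          exact (h6.comp_hasDerivAt t h5).congr_deriv (by simp)
        have := intervalIntegral.integral_eq_sub_of_hasDerivAt hd
          (by
            apply Continuous.intervalIntegrable
            exact ((hη.continuous_fderiv_apply y).comp (by fun_prop)).neg)
        simp only [intervalIntegral.integral_neg, one_smul, zero_smul, sub_zero] at this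
        exact this.symm
      have slice : ∀ t ∈ Set.Icc (0 : ℝ) 1,
          ∫ x, u x * fderiv ℝ η (x - t • y) y = - ∫ x, w (x + t • y) * η x := by
        intro t ht
        have := h _ (hη.translate (z := t • y) fun x hx => hSU x hx t ht)
        simp_rw [fderiv_translate] at this
        rw [this, ← integral_add_right_eq_self _ (t • y)]
        simp
      have i5 : Integrable (fun p : ℝ × E d => u p.2 * fderiv ℝ η (p.2 - p.1 • y) y)
          ((volume.restrict (Set.Ioc (0 : ℝ) 1)).prod volume) := by
        have h2 : Integrable (fun p : ℝ × E d => u p.2)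
            ((volume.restrict (Set.Ioc (0 : ℝ) 1)).prod volume) := hu.comp_snd _
        refine h2.mul_bdd (c := C') ?_ (.of_forall fun p => hC' _)
        exact ((hη.continuous_fderiv_apply y).comp (by fun_prop)).aestronglyMeasurable
      have i6 : Integrable (fun p : ℝ × E d => w (p.2 + p.1 • y) * η p.2)
          ((volume.restrict (Set.Ioc (0 : ℝ) 1)).prod volume) := by
        refine (integrable_shear hw y).mul_bdd (c := C) ?_ (.of_forall fun p => hC _)
        exact (h1.continuous.comp continuous_snd).aestronglyMeasurable
      have f1 : ∫ x, u x * ∫ t in (0 : ℝ)..1, fderiv ℝ η (x - t • y) y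
          = ∫ t in (0 : ℝ)..1, ∫ x, u x * fderiv ℝ η (x - t • y) y := by
        simp_rw [intervalIntegral.integral_of_le zero_le_one, ← integral_const_mul]
        exact (integral_integral_swap i5).symm
      have f2 : ∫ x, (∫ t in (0 : ℝ)..1, w (x + t • y)) * η x
          = ∫ t in (0 : ℝ)..1, ∫ x, w (x + t • y) * η x := by
        simp_rw [intervalIntegral.integral_of_le zero_le_one, ← integral_mul_const]
        exact (integral_integral_swap i6).symm
      have f3 : ∫ t in (0 : ℝ)..1, ∫ x, u x * fderiv ℝ η (x - t • y) y
          = - ∫ t in (0 : ℝ)..1, ∫ x, w (x + t • y) * η x := by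
        rw [← intervalIntegral.integral_neg]
        apply intervalIntegral.integral_congr
        intro t ht
        rw [Set.uIcc_of_le zero_le_one] at ht
        exact slice t ht
      have f4 : (∫ x, η (x - y) * u x) - ∫ x, η x * u x
          = ∫ x, η x * ∫ t in (0 : ℝ)..1, w (x + t • y) := by
        rw [← integral_sub i3 i2]
        have : ∀ x, η (x - y) * u x - η x * u x
            = - (u x * ∫ t in (0 : ℝ)..1, fderiv ℝ η (x - t • y) y) := by
          intro x
          rw [← sub_mul, ftc x]; ring
        simp_rw [this]
        rw [integral_neg, f1, f3, neg_neg, ← f2]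
        simp_rw [mul_comm]
      simp only [smul_eq_mul, mul_sub]
      have i12 : Integrable (fun x => η x * u (x + y) - η x * u x) := i1.sub i2
      rw [integral_sub i12 i4, integral_sub i1 i2, e1, f4, sub_self])
  filter_upwards [key] with x hx hxS
  exact sub_eq_zero.1 (hx hxS)

end VBDF2

namespace VBDF2

variable {d : ℕ}

open Filter Topology

/-- Translations are continuous in `L¹`. -/
lemma tendsto_integral_translate_sub {w : E d → ℝ} (hw : Integrable w) :
    Tendsto (fun z : E d => ∫ x, ‖w (x + z) - w x‖) (𝓝 0) (𝓝 0) := by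
  let Gm : C(E d × E d, E d) := ⟨fun p => p.2 + p.1, by fun_prop⟩
  let f : Lp ℝ 1 (volume : Measure (E d)) := (memLp_one_iff_integrable.2 hw).toLp w
  have hmp : ∀ z : E d, MeasurePreserving (Gm.curry z) (volume : Measure (E d)) volume :=
    fun z => measurePreserving_add_right volume z
  have hc := Continuous.compMeasurePreservingLp (p := 1) (f := fun _ : E d => f)
    (g := fun z => Gm.curry z) continuous_const Gm.curry.continuous hmp (by simp)
  have h0 := ((hc.tendsto 0).sub_const
    (Lp.compMeasurePreserving (Gm.curry 0) (hmp 0) f)).norm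
  simp only [sub_self, norm_zero] at h0
  refine h0.congr fun z => ?_
  rw [L1.norm_eq_integral_norm]
  apply integral_congr_ae
  have a1 := Lp.coeFn_compMeasurePreserving f (hmp z)
  have a2 := Lp.coeFn_compMeasurePreserving f (hmp 0)
  have a3 : f =ᵐ[volume] w := MemLp.coeFn_toLp _
  have a4 := (hmp z).quasiMeasurePreserving.ae_eq_comp a3
  have a5 := (hmp 0).quasiMeasurePreserving.ae_eq_comp a3
  filter_upwards [a1, a2, a4, a5, Lp.coeFn_sub (Lp.compMeasurePreserving (Gm.curry z) (hmp z) f)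
    (Lp.compMeasurePreserving (Gm.curry 0) (hmp 0) f)] with x b1 b2 b4 b5 b6
  rw [b6, Pi.sub_apply, b1, b2, b4, b5]
  simp [Gm]

/-- The mean of a weak derivative over short segments converges to it in `L¹`. -/
lemma tendsto_integral_segment_sub {w : E d → ℝ} (hw : Integrable w) (y : E d) :
    Tendsto (fun s : ℝ => ∫ x, ‖(∫ t in (0 : ℝ)..1, w (x + t • s • y)) - w x‖) (𝓝 0) (𝓝 0) := by
  rw [Metric.tendsto_nhds]
  intro ε hε
  have h1 := Metric.tendsto_nhds_nhds.1 (tendsto_integral_translate_sub hw) (ε / 2) (by positivity)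
  obtain ⟨δ, hδ, h1⟩ := h1
  have h2 : Tendsto (fun s : ℝ => s • y) (𝓝 0) (𝓝 0) := by
    have : Continuous fun s : ℝ => s • y := by fun_prop
    simpa using this.tendsto 0
  filter_upwards [Metric.tendsto_nhds.1 h2 δ hδ] with s hs
  have i1 := integrable_shear hw (s • y)
  have i2 : Integrable (fun p : ℝ × E d => w p.2)
      ((volume.restrict (Set.Ioc (0 : ℝ) 1)).prod volume) := hw.comp_snd _
  have i3 := (i1.sub i2).norm
  have h3 : ∀ᵐ x : E d, ‖(∫ t in (0 : ℝ)..1, w (x + t • s • y)) - w x‖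
      ≤ ∫ t in Set.Ioc (0 : ℝ) 1, ‖w (x + t • s • y) - w x‖ := by
    filter_upwards [i1.prod_left_ae] with x hx
    have : (∫ t in (0 : ℝ)..1, w (x + t • s • y)) - w x
        = ∫ t in Set.Ioc (0 : ℝ) 1, (w (x + t • s • y) - w x) := by
      rw [integral_sub hx (integrable_const _), intervalIntegral.integral_of_le zero_le_one]
      simp
    rw [this]
    exact norm_integral_le_integral_norm _
  have h4 : ∫ x, ‖(∫ t in (0 : ℝ)..1, w (x + t • s • y)) - w x‖
      ≤ ∫ x, ∫ t in Set.Ioc (0 : ℝ) 1, ‖w (x + t • s • y) - w x‖ :=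
    integral_mono_ae ((integrable_segment hw (s • y)).sub hw).norm i3.integral_prod_right h3
  have h5 : ∫ x, ∫ t in Set.Ioc (0 : ℝ) 1, ‖w (x + t • s • y) - w x‖
      = ∫ t in Set.Ioc (0 : ℝ) 1, ∫ x, ‖w (x + t • s • y) - w x‖ :=
    (integral_integral_swap (f := fun (t : ℝ) (x : E d) => ‖w (x + t • s • y) - w x‖) i3).symm
  have h6 : ∫ t in Set.Ioc (0 : ℝ) 1, ∫ x, ‖w (x + t • s • y) - w x‖
      ≤ ∫ t in Set.Ioc (0 : ℝ) 1, ε / 2 := by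
    refine setIntegral_mono_on i3.integral_prod_left (by simp) measurableSet_Ioc fun t ht => ?_
    have h7 : dist (t • s • y) 0 < δ := by
      rw [dist_zero_right] at hs ⊢
      rw [norm_smul, Real.norm_of_nonneg ht.1.le]
      nlinarith [norm_nonneg (s • y), ht.1, ht.2]
    have := h1 h7
    rw [Real.dist_0_eq_abs] at this
    exact (le_abs_self _).trans this.le
  have h8 : 0 ≤ ∫ x, ‖(∫ t in (0 : ℝ)..1, w (x + t • s • y)) - w x‖ :=
    integral_nonneg fun _ => norm_nonneg _
  rw [Real.dist_0_eq_abs, abs_of_nonneg h8]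
  have h9 : ∫ t in Set.Ioc (0 : ℝ) 1, ε / 2 = ε / 2 := by simp
  linarith

/-- The mean of the derivative of `f` between `a` and `b`. -/
def meanDeriv (f : ℝ → ℝ) (a b : ℝ) : ℝ := ∫ s in (0 : ℝ)..1, deriv f (a + s * (b - a))

lemma continuous_meanDeriv {f : ℝ → ℝ} (hf : ContDiff ℝ 1 f) :
    Continuous fun p : ℝ × ℝ => meanDeriv f p.1 p.2 := by
  have h := hf.continuous_deriv le_rfl
  apply intervalIntegral.continuous_parametric_intervalIntegral_of_continuous'
  exact h.comp (by fun_prop)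

lemma meanDeriv_self (f : ℝ → ℝ) (a : ℝ) : meanDeriv f a a = deriv f a := by
  simp [meanDeriv]

lemma meanDeriv_mul {f : ℝ → ℝ} (hf : ContDiff ℝ 1 f) (a b : ℝ) :
    meanDeriv f a b * (b - a) = f b - f a := by
  have h := hf.continuous_deriv le_rfl
  have hd : ∀ s ∈ Set.uIcc (0 : ℝ) 1, HasDerivAt (fun s : ℝ => f (a + s * (b - a)))
      (deriv f (a + s * (b - a)) * (b - a)) s := by
    intro s _
    have h1 : HasDerivAt (fun s : ℝ => a + s * (b - a)) (b - a) s := by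
      simpa using ((hasDerivAt_id s).mul_const (b - a)).const_add a
    exact ((hf.differentiable one_ne_zero _).hasDerivAt).comp s h1
  have := intervalIntegral.integral_eq_sub_of_hasDerivAt hd
    (Continuous.intervalIntegrable (by fun_prop) _ _)
  rw [intervalIntegral.integral_mul_const] at this
  rw [meanDeriv, this]
  simp

lemma abs_meanDeriv_le {f : ℝ → ℝ} {s : Set ℝ} (hs : Convex ℝ s) {K : ℝ}
    (hK : ∀ t ∈ s, |deriv f t| ≤ K) {a b : ℝ} (ha : a ∈ s) (hb : b ∈ s) :
    |meanDeriv f a b| ≤ K := by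
  have := intervalIntegral.norm_integral_le_of_norm_le_const (a := 0) (b := 1)
    (f := fun s => deriv f (a + s * (b - a))) (C := K) (fun t ht => by
      rw [Set.uIoc_of_le zero_le_one] at ht
      refine hK _ ?_
      have := hs ha hb (a := 1 - t) (b := t) (by linarith [ht.2]) ht.1.le (by ring)
      simp only [smul_eq_mul] at this
      convert! this using 1; ring)
  simpa [meanDeriv] using this

/-- Test functions have difference quotients that converge after integration. -/
lemma tendsto_integral_diffQuot {U : Set (E d)} {η : E d → ℝ} (hη : IsBump U η) (y : E d)
    {F : E d → ℝ} (hF : LocallyIntegrable F) {t : ℕ → ℝ} (ht : ∀ n, t n ∈ Set.Ioc (0 : ℝ) 1)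
    (ht0 : Tendsto t atTop (𝓝 0)) :
    Tendsto (fun n => ∫ x, F x * ((η (x - t n • y) - η x) / t n)) atTop
      (𝓝 (- ∫ x, F x * fderiv ℝ η x y)) := by
  obtain ⟨C', hC'⟩ := hη.exists_bound_fderiv y
  have hdiff : Differentiable ℝ η := hη.1.differentiable (by simp)
  rw [← integral_neg]
  have hcomp : IsCompact (Metric.cthickening ‖y‖ (tsupport η)) := hη.2.1.cthickening
  have hFi : IntegrableOn F (Metric.cthickening ‖y‖ (tsupport η)) :=
    hF.integrableOn_isCompact hcomp
  refine tendsto_integral_of_dominated_convergence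
    (fun x => (Metric.cthickening ‖y‖ (tsupport η)).indicator (fun x => ‖F x‖ * C') x) ?_ ?_ ?_ ?_
  · intro n
    refine hF.aestronglyMeasurable.mul (Continuous.aestronglyMeasurable ?_)
    have := hη.1.continuous
    fun_prop
  · rw [integrable_indicator_iff hcomp.measurableSet]
    exact hFi.norm.mul_const _
  · intro n
    refine .of_forall fun x => ?_
    have ht1 := ht n
    have hder : ∀ s ∈ Set.Icc (0 : ℝ) 1, ‖η (x - s • y) - η x‖ ≤ C' * s := by
      intro s hs
      have h1 : ∀ r ∈ Set.Icc (0 : ℝ) s, HasDerivWithinAt (fun r : ℝ => η (x - r • y))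
          (- fderiv ℝ η (x - r • y) y) (Set.Icc (0 : ℝ) s) r := by
        intro r _
        have h5 : HasDerivAt (fun t : ℝ => x - t • y) (-y) r := by
          simpa using ((hasDerivAt_id r).smul_const y).const_sub x
        exact (((hdiff _).hasFDerivAt.comp_hasDerivAt r h5).congr_deriv
          (by simp)).hasDerivWithinAt
      have := norm_image_sub_le_of_norm_deriv_le_segment' h1
        (fun r _ => by rw [norm_neg]; exact hC' _) s (Set.right_mem_Icc.2 hs.1)
      simpa using this
    by_cases hx : x ∈ Metric.cthickening ‖y‖ (tsupport η)
    · rw [Set.indicator_of_mem hx, norm_mul]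
      gcongr
      rw [norm_div, Real.norm_of_nonneg ht1.1.le, div_le_iff₀ ht1.1]
      exact hder _ ⟨ht1.1.le, ht1.2⟩
    · rw [Set.indicator_of_notMem hx]
      have h0 : ∀ s ∈ Set.Icc (0 : ℝ) 1, η (x - s • y) = 0 := by
        intro s hs
        by_contra hne
        apply hx
        refine Metric.mem_cthickening_of_dist_le x (x - s • y) _ _
          (subset_tsupport _ hne) ?_
        rw [dist_eq_norm]
        simp only [sub_sub_cancel, norm_smul]
        rw [Real.norm_of_nonneg hs.1]
        nlinarith [norm_nonneg y, hs.2]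
      have h1 := h0 0 (by simp)
      have h2 := h0 (t n) ⟨ht1.1.le, ht1.2⟩
      simp only [zero_smul, sub_zero] at h1
      simp [h1, h2]
  · refine .of_forall fun x => ?_
    rw [← mul_neg]
    refine Tendsto.const_mul _ ?_
    have h5 : HasDerivAt (fun t : ℝ => x - t • y) (-y) 0 := by
      simpa using ((hasDerivAt_id (0 : ℝ)).smul_const y).const_sub x
    have h6 : HasDerivAt (fun t : ℝ => η (x - t • y)) (- fderiv ℝ η x y) 0 := by
      have h7 : HasFDerivAt η (fderiv ℝ η x) (x - (0 : ℝ) • y) := by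
        simpa using (hdiff x).hasFDerivAt
      exact (h7.comp_hasDerivAt (0 : ℝ) h5).congr_deriv (by simp)
    have h8 := h6.tendsto_slope_zero
    have h9 : Tendsto t atTop (𝓝[≠] 0) := by
      refine tendsto_nhdsWithin_iff.2 ⟨ht0, .of_forall fun n => (ht n).1.ne'⟩
    refine (h8.comp h9).congr fun n => ?_
    simp [div_eq_inv_mul]

lemma HasWeakDir.smul_dir {U : Set (E d)} {y : E d} {u w : E d → ℝ} (h : HasWeakDir U y u w)
    (t : ℝ) : HasWeakDir U (t • y) u (fun x => t * w x) := by
  intro η hη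
  have := h η hη
  simp only [map_smul, smul_eq_mul]
  have e1 : ∀ x, u x * (t * fderiv ℝ η x y) = t * (u x * fderiv ℝ η x y) := fun x => by ring
  have e2 : ∀ x, t * w x * η x = t * (w x * η x) := fun x => by ring
  simp_rw [e1, e2, integral_const_mul, this]
  ring

lemma abs_comp_sub_le {f : ℝ → ℝ} (hf : ContDiff ℝ 1 f) {s : Set ℝ} (hs : Convex ℝ s) {K : ℝ}
    (hK : ∀ t ∈ s, |deriv f t| ≤ K) {a b : ℝ} (ha : a ∈ s) (hb : b ∈ s) :
    |f b - f a| ≤ K * |b - a| := by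
  rw [← meanDeriv_mul hf, abs_mul]
  gcongr
  exact abs_meanDeriv_le hs hK ha hb

/-- Chain rule for weak derivatives. -/
theorem HasWeakDir.comp {U : Set (E d)} (hU : IsOpen U) {y : E d} {u w : E d → ℝ}
    (h : HasWeakDir U y u w) (hu : Integrable u) (hw : Integrable w) {f : ℝ → ℝ}
    (hf : ContDiff ℝ 1 f) {s : Set ℝ} (hs : Convex ℝ s) (hus : ∀ x, u x ∈ s) {K : ℝ}
    (hK : ∀ t ∈ s, |deriv f t| ≤ K) :
    HasWeakDir U y (fun x => f (u x)) (fun x => deriv f (u x) * w x) := by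
  intro η hη
  obtain ⟨C, hC⟩ := hη.exists_bound
  have hC0 : 0 ≤ C := (norm_nonneg _).trans (hC 0)
  have hK0 : 0 ≤ K := (abs_nonneg _).trans (hK _ (hus 0))
  have hFm : AEStronglyMeasurable (fun x => f (u x)) volume :=
    hf.continuous.comp_aestronglyMeasurable hu.1
  have hF : LocallyIntegrable (fun x => f (u x)) := by
    have h1 : LocallyIntegrable (fun x => |f (u 0)| + K * (|u x| + |u 0|)) :=
      (locallyIntegrable_const _).add
        (((hu.abs.locallyIntegrable).add (locallyIntegrable_const _)).smul K)
    refine h1.mono hFm (.of_forall fun x => ?_)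
    have h2 := abs_comp_sub_le hf hs hK (hus 0) (hus x)
    have h3 : |u x - u 0| ≤ |u x| + |u 0| := abs_sub _ _
    have h4 : |f (u x)| ≤ |f (u 0)| + |f (u x) - f (u 0)| := by
      have := abs_add_le (f (u 0)) (f (u x) - f (u 0)); simpa using this
    rw [Real.norm_eq_abs, Real.norm_eq_abs]
    refine le_trans ?_ (le_abs_self _)
    nlinarith [mul_le_mul_of_nonneg_left h3 hK0]
  obtain ⟨δ, hδ, hδU⟩ := hη.2.1.isCompact.exists_thickening_subset_open hU hη.2.2
  set S := Metric.thickening (δ / 2) (tsupport η) with hSdef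
  have hSo : IsOpen S := Metric.isOpen_thickening
  have hηS : tsupport η ⊆ S := Metric.self_subset_thickening (by positivity) _
  set c := min 1 (δ / 2 / (‖y‖ + 1)) with hc
  have hc0 : 0 < c := lt_min one_pos (by positivity)
  have hcy : c * ‖y‖ < δ / 2 := by
    have h1 : c * (‖y‖ + 1) ≤ δ / 2 := by
      have := min_le_right 1 (δ / 2 / (‖y‖ + 1))
      rw [← hc, le_div_iff₀ (by positivity)] at this
      exact this
    nlinarith
  have hSU : ∀ t ∈ Set.Icc (0 : ℝ) c, ∀ x ∈ S, x + t • y ∈ U := by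
    intro t ht x hx
    apply hδU
    obtain ⟨z, hz, hxz⟩ := Metric.mem_thickening_iff.1 hx
    refine Metric.mem_thickening_iff.2 ⟨z, hz, ?_⟩
    calc dist (x + t • y) z ≤ dist (x + t • y) x + dist x z := dist_triangle _ _ _
      _ < δ / 2 + δ / 2 := by
        refine add_lt_add_of_le_of_lt ?_ hxz
        rw [dist_eq_norm, add_sub_cancel_left, norm_smul, Real.norm_of_nonneg ht.1]
        exact (mul_le_mul_of_nonneg_right ht.2 (norm_nonneg _)).trans hcy.le
      _ = δ := by ring
  set t₀ : ℕ → ℝ := fun n => c * (1 / ((n : ℝ) + 1)) with ht₀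
  have ht₀c : ∀ n, t₀ n ∈ Set.Ioc (0 : ℝ) c := by
    intro n
    have h1 : (0 : ℝ) < 1 / ((n : ℝ) + 1) := by positivity
    have h2 : 1 / ((n : ℝ) + 1) ≤ 1 := by
      rw [div_le_one (by positivity)]; linarith [n.cast_nonneg (α := ℝ)]
    exact ⟨by positivity, by simp only [ht₀]; nlinarith⟩
  have ht₀0 : Tendsto t₀ atTop (𝓝 0) := by
    have := (tendsto_one_div_add_atTop_nhds_zero_nat (𝕜 := ℝ)).const_mul c
    rwa [mul_zero] at this
  have hsm : Tendsto (fun s : ℝ => s • y) (𝓝 0) (𝓝 0) := by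
    have : Continuous fun s : ℝ => s • y := by fun_prop
    simpa using this.tendsto 0
  have hmeas : TendstoInMeasure volume (fun n x => u (x + t₀ n • y)) atTop u := by
    refine tendstoInMeasure_of_tendsto_eLpNorm (p := 1) one_ne_zero
      (fun n => (hu.comp_add_right _).1) hu.1 ?_
    have h1 := (tendsto_integral_translate_sub hu).comp (hsm.comp ht₀0)
    have h2 := ENNReal.tendsto_ofReal h1
    rw [ENNReal.ofReal_zero] at h2
    refine h2.congr fun n => ?_
    simp only [Function.comp]
    rw [eLpNorm_one_eq_lintegral_enorm, ← ofReal_integral_norm_eq_lintegral_enorm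
      ((hu.comp_add_right _).sub hu)]
    rfl
  obtain ⟨ns, hns, hae⟩ := hmeas.exists_seq_tendsto_ae
  set t : ℕ → ℝ := fun n => t₀ (ns n) with ht
  have htc : ∀ n, t n ∈ Set.Ioc (0 : ℝ) c := fun n => ht₀c _
  have ht1 : ∀ n, t n ∈ Set.Ioc (0 : ℝ) 1 := fun n =>
    ⟨(htc n).1, (htc n).2.trans (min_le_left _ _)⟩
  have ht0 : Tendsto t atTop (𝓝 0) := ht₀0.comp hns.tendsto_atTop
  set q : ℕ → E d → ℝ := fun n x => ∫ r in (0 : ℝ)..1, w (x + r • t n • y) with hq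
  set m : ℕ → E d → ℝ := fun n x => meanDeriv f (u x) (u (x + t n • y)) with hm
  have hmb : ∀ n x, ‖m n x‖ ≤ K := fun n x => abs_meanDeriv_le hs hK (hus _) (hus _)
  have hmm : ∀ n, AEStronglyMeasurable (m n) volume := fun n =>
    (continuous_meanDeriv hf).comp_aestronglyMeasurable
      (hu.1.prodMk (hu.comp_add_right (t n • y)).1)
  have hqi : ∀ n, Integrable (q n) := fun n => integrable_segment hw _
  have hftc : ∀ n, ∀ᵐ x, x ∈ S → u (x + t n • y) - u x = t n * q n x := by
    intro n
    have := (h.smul_dir (t n)).sub_eq_integral hu (hw.const_mul _) hSo (fun x hx r hr => by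
      rw [smul_smul]
      exact hSU _ ⟨mul_nonneg hr.1 (htc n).1.le, by nlinarith [hr.2, (htc n).1, (htc n).2]⟩ x hx)
    filter_upwards [this] with x hx hxS
    rw [hx hxS, intervalIntegral.integral_const_mul]
  have hηm : AEStronglyMeasurable η volume := hη.1.continuous.aestronglyMeasurable
  have iη : ∀ {v : E d → ℝ}, Integrable v → Integrable (fun x => v x * η x) :=
    fun hv => hv.mul_bdd hηm (.of_forall hC)
  have imw : ∀ n, ∀ {v : E d → ℝ}, Integrable v → Integrable (fun x => m n x * v x * η x) :=
    fun n _ hv => iη (hv.bdd_mul (hmm n) (.of_forall (hmb n)))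
  -- the difference quotients, written in two ways
  have ident : ∀ n, ∫ x, f (u x) * ((η (x - t n • y) - η x) / t n)
      = ∫ x, m n x * q n x * η x := by
    intro n
    have htn := (htc n).1
    have j1 : Integrable (fun x => f (u x) * η x) := by
      have := hF.integrable_smul_right_of_hasCompactSupport hη.1.continuous hη.2.1
      simpa [mul_comm] using this
    have hη' := (hη.mono (Set.subset_univ U)).translate (U := Set.univ) (z := t n • y)
      (fun _ _ => trivial)
    have j2 : Integrable (fun x => f (u x) * η (x - t n • y)) := by
      have := hF.integrable_smul_right_of_hasCompactSupport hη'.1.continuous hη'.2.1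
      simpa [mul_comm] using this
    have j3 : Integrable (fun x => f (u (x + t n • y)) * η x) := by
      have := j2.comp_add_right (t n • y)
      simpa using this
    have e1 : ∫ x, f (u x) * η (x - t n • y) = ∫ x, f (u (x + t n • y)) * η x := by
      rw [← integral_add_right_eq_self _ (t n • y)]; simp
    have e2 : ∀ x, f (u x) * ((η (x - t n • y) - η x) / t n)
        = (t n)⁻¹ * (f (u x) * η (x - t n • y) - f (u x) * η x) := fun x => by
      field_simp
    simp_rw [e2]
    rw [integral_const_mul, integral_sub j2 j1, e1, ← integral_sub j3 j1, ← integral_const_mul]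
    apply integral_congr_ae
    filter_upwards [hftc n] with x hx
    by_cases hxS : x ∈ S
    · have h1 := meanDeriv_mul hf (u x) (u (x + t n • y))
      rw [hx hxS] at h1
      have h2 : (t n)⁻¹ * (f (u (x + t n • y)) * η x - f (u x) * η x)
          = (t n)⁻¹ * (f (u (x + t n • y)) - f (u x)) * η x := by ring
      rw [h2, ← h1]
      simp only [hm]
      field_simp
    · have : η x = 0 := by
        by_contra hne
        exact hxS (hηS (subset_tsupport _ hne))
      simp [this]
  have lim1 := tendsto_integral_diffQuot hη y hF ht1 ht0
  simp_rw [ident] at lim1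
  have lim2 : Tendsto (fun n => ∫ x, m n x * w x * η x) atTop
      (𝓝 (∫ x, deriv f (u x) * w x * η x)) := by
    refine tendsto_integral_of_dominated_convergence (fun x => K * ‖w x‖ * C)
      (fun n => (imw n hw).1) ((hw.norm.const_mul K).mul_const C) ?_ ?_
    · intro n
      refine .of_forall fun x => ?_
      rw [norm_mul, norm_mul]
      gcongr
      · exact hmb n x
      · exact hC x
    · filter_upwards [hae] with x hx
      refine Tendsto.mul_const _ (Tendsto.mul_const _ ?_)
      have h1 : Tendsto (fun n => ((u x, u (x + t n • y)) : ℝ × ℝ)) atTop (𝓝 (u x, u x)) :=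
        tendsto_const_nhds.prodMk_nhds hx
      have h2 := ((continuous_meanDeriv hf).tendsto (u x, u x)).comp h1
      simp only [meanDeriv_self] at h2
      exact h2
  have lim3 : Tendsto (fun n => ∫ x, m n x * (q n x - w x) * η x) atTop (𝓝 0) := by
    have h1 := ((tendsto_integral_segment_sub hw y).comp ht0).const_mul (K * C)
    rw [mul_zero] at h1
    refine squeeze_zero_norm (fun n => ?_) h1
    refine (norm_integral_le_integral_norm _).trans ?_
    simp only [Function.comp]
    rw [← integral_const_mul]
    refine integral_mono_ae (imw n ((hqi n).sub hw)).norm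
      ((((hqi n).sub hw).norm).const_mul _) (.of_forall fun x => ?_)
    simp only [norm_mul]
    calc ‖m n x‖ * ‖q n x - w x‖ * ‖η x‖ ≤ K * ‖q n x - w x‖ * C := by
          gcongr
          · exact hmb n x
          · exact hC x
      _ = K * C * ‖q n x - w x‖ := by ring
  have lim4 := lim3.add lim2
  rw [zero_add] at lim4
  have e5 : ∀ n, (∫ x, m n x * (q n x - w x) * η x) + ∫ x, m n x * w x * η x
      = ∫ x, m n x * q n x * η x := by
    intro n
    have i7 : Integrable (fun x => m n x * (q n x - w x) * η x) := imw n ((hqi n).sub hw)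
    rw [← integral_add i7 (imw n hw)]
    congr 1; ext x; ring
  simp_rw [e5] at lim4
  have := tendsto_nhds_unique lim1 lim4
  rw [← this, neg_neg]

end VBDF2

namespace VBDF2

variable {d : ℕ}

open Filter Topology
open scoped ENNReal

lemma HasWeakDir.congr_ae {U : Set (E d)} {y : E d} {u u' w w' : E d → ℝ}
    (h : HasWeakDir U y u w) (hu : u =ᵐ[volume] u') (hw : w =ᵐ[volume] w') :
    HasWeakDir U y u' w' := by
  intro η hη
  have e1 : ∫ x, u' x * fderiv ℝ η x y = ∫ x, u x * fderiv ℝ η x y :=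
    integral_congr_ae (by filter_upwards [hu] with x hx; rw [hx])
  have e2 : ∫ x, w' x * η x = ∫ x, w x * η x :=
    integral_congr_ae (by filter_upwards [hw] with x hx; rw [hx])
  rw [e1, e2, h η hη]

lemma HasWeakDir.sum_dir {U : Set (E d)} {u : E d → ℝ} {w : Fin d → E d → ℝ}
    (hu : Integrable u) (hw : ∀ i, Integrable (w i))
    (h : ∀ i, HasWeakDir U (basisVec i) u (w i)) (y : E d) :
    HasWeakDir U y u (fun x => ∑ i, y i * w i x) := by
  intro η hη
  obtain ⟨C, hC⟩ := hη.exists_bound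
  have hy : y = ∑ i, y i • basisVec i := by
    ext j
    simp [basisVec, Pi.single_apply]
  have e1 : ∀ x, u x * fderiv ℝ η x y = ∑ i, y i * (u x * fderiv ℝ η x (basisVec i)) := by
    intro x
    conv_lhs => rw [hy]
    rw [map_sum, Finset.mul_sum]
    refine Finset.sum_congr rfl fun i _ => ?_
    rw [map_smul, smul_eq_mul]; ring
  have e2 : ∀ x, (∑ i, y i * w i x) * η x = ∑ i, y i * (w i x * η x) := by
    intro x
    rw [Finset.sum_mul]
    exact Finset.sum_congr rfl fun i _ => by ring
  simp_rw [e1, e2]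
  rw [integral_finsetSum, integral_finsetSum, ← Finset.sum_neg_distrib]
  · refine Finset.sum_congr rfl fun i _ => ?_
    rw [integral_const_mul, integral_const_mul, h i η hη]; ring
  · intro i _
    exact ((hw i).mul_bdd hη.1.continuous.aestronglyMeasurable (.of_forall hC)).const_mul _
  · intro i _
    obtain ⟨C', hC'⟩ := hη.exists_bound_fderiv (basisVec i)
    exact (hu.mul_bdd (hη.continuous_fderiv_apply _).aestronglyMeasurable
      (.of_forall hC')).const_mul _

/-- A weakly differentiable function is bounded by an integral over segments. -/
lemma HasWeakDir.enorm_le_lintegral_segment {U S : Set (E d)} {v : E d} {u w : E d → ℝ}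
    (h : HasWeakDir U v u w) (hu : Integrable u) (hw : Integrable w) (hum : Measurable u)
    (hwm : Measurable w) (hS : IsOpen S)
    (hSU : ∀ x ∈ S, ∀ t ∈ Set.Icc (0 : ℝ) 1, x + t • v ∈ U) :
    ∀ᵐ x ∂(volume.restrict S), ‖u x‖ₑ ≤ ∫⁻ t : ℝ, (‖u (x + t • v)‖ₑ + ‖w (x + t • v)‖ₑ) := by
  set W : E d → ℝ≥0∞ := fun x => ∫⁻ t in Set.Ioc (0 : ℝ) 1, ‖w (x + t • v)‖ₑ with hW
  have hWm : Measurable W := by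
    have : Measurable fun p : E d × ℝ => ‖w (p.1 + p.2 • v)‖ₑ := by fun_prop
    exact this.lintegral_prod_right'
  have h1 : ∀ᵐ s : ℝ ∂(volume.restrict (Set.Ioc (0 : ℝ) 1)), ∀ᵐ x ∂(volume.restrict S),
      ‖u x‖ₑ ≤ ‖u (x + s • v)‖ₑ + W x := by
    filter_upwards [ae_restrict_mem measurableSet_Ioc] with s hs
    rw [ae_restrict_iff' hS.measurableSet]
    filter_upwards [(h.smul_dir s).sub_eq_integral hu (hw.const_mul _) hS (fun x hx r hr => by
      rw [smul_smul]
      exact hSU x hx _ ⟨mul_nonneg hr.1 hs.1.le, by nlinarith [hr.1, hr.2, hs.1, hs.2]⟩)]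
      with x hx hxS
    have e1 : u x = u (x + s • v) - ∫ t in (0 : ℝ)..s, w (x + t • v) := by
      have e2 : ∫ t in (0 : ℝ)..1, s * w (x + t • s • v) = ∫ t in (0 : ℝ)..s, w (x + t • v) := by
        rw [intervalIntegral.integral_const_mul]
        have := intervalIntegral.smul_integral_comp_mul_right (a := 0) (b := 1)
          (fun t : ℝ => w (x + t • v)) s
        simp only [zero_mul, one_mul, smul_eq_mul] at this
        rw [← this]
        simp_rw [smul_smul]
      rw [← e2, ← hx hxS]; ring
    calc ‖u x‖ₑ ≤ ‖u (x + s • v)‖ₑ + ‖∫ t in (0 : ℝ)..s, w (x + t • v)‖ₑ := by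
          rw [e1]; exact enorm_sub_le
      _ ≤ ‖u (x + s • v)‖ₑ + W x := by
          gcongr
          rw [intervalIntegral.integral_of_le hs.1.le]
          refine (enorm_integral_le_lintegral_enorm _).trans ?_
          exact lintegral_mono_set (Set.Ioc_subset_Ioc_right hs.2)
  have h2 : MeasurableSet {p : ℝ × E d | ‖u p.2‖ₑ ≤ ‖u (p.2 + p.1 • v)‖ₑ + W p.2} := by
    refine measurableSet_le (by fun_prop) ?_
    exact Measurable.add (by fun_prop) (hWm.comp measurable_snd)
  have h3 := (Measure.ae_ae_comm (p := fun s x => ‖u x‖ₑ ≤ ‖u (x + s • v)‖ₑ + W x) h2).1 h1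
  filter_upwards [h3] with x hx
  calc ‖u x‖ₑ = ∫⁻ s in Set.Ioc (0 : ℝ) 1, ‖u x‖ₑ := by simp
    _ ≤ ∫⁻ s in Set.Ioc (0 : ℝ) 1, (‖u (x + s • v)‖ₑ + W x) := lintegral_mono_ae hx
    _ = ∫⁻ s in Set.Ioc (0 : ℝ) 1, (‖u (x + s • v)‖ₑ + ‖w (x + s • v)‖ₑ) := by
        rw [lintegral_add_right _ measurable_const, lintegral_add_left (by fun_prop)]
        simp [hW]
    _ ≤ ∫⁻ s : ℝ, (‖u (x + s • v)‖ₑ + ‖w (x + s • v)‖ₑ) := setLIntegral_le_lintegral _ _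

/-- The total mass that enters the line integrals. -/
def mass (u : E d → ℝ) (w : Fin d → E d → ℝ) (x : E d) : ℝ≥0∞ := ‖u x‖ₑ + ∑ i, ‖w i x‖ₑ

lemma lintegral_update_equivFunL (b : Module.Basis (Fin d) ℝ (E d)) (F : E d → ℝ≥0∞)
    (z : Fin d → ℝ) (i : Fin d) :
    ∫⁻ t : ℝ, F (b.equivFunL.symm (Function.update z i t))
      = ∫⁻ t : ℝ, F (b.equivFunL.symm z + t • b i) := by
  have h1 : ∀ t, b.equivFunL.symm (Function.update z i t)
      = b.equivFunL.symm z + (t - z i) • b i := by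
    intro t
    have : Function.update z i t = z + (t - z i) • (Pi.single i (1 : ℝ) : Fin d → ℝ) := by
      ext j
      by_cases hj : j = i
      · subst hj; simp
      · simp [hj]
    rw [this, map_add, map_smul]
    congr 2
    change b.equivFun.symm (Pi.single i 1) = b i
    simp
  simp_rw [h1]
  exact lintegral_sub_right_eq_self (fun t => F (b.equivFunL.symm z + t • b i)) (z i)

lemma exists_volume_eq_smul_map (b : Module.Basis (Fin d) ℝ (E d)) :
    ∃ c : ℝ≥0∞, c ≠ 0 ∧ c ≠ ⊤ ∧
      (volume : Measure (E d)) = c • (volume : Measure (Fin d → ℝ)).map b.equivFunL.symm := by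
  have : ((volume : Measure (Fin d → ℝ)).map b.equivFunL.symm).IsAddHaarMeasure :=
    b.equivFunL.symm.isAddHaarMeasure_map volume
  set ν := (volume : Measure (Fin d → ℝ)).map b.equivFunL.symm
  refine ⟨Measure.addHaarScalarFactor volume ν, ?_, ENNReal.coe_ne_top, ?_⟩
  · exact_mod_cast (Measure.addHaarScalarFactor_pos_of_isAddHaarMeasure volume ν).ne'
  · exact Measure.isAddLeftInvariant_eq_smul volume ν

lemma lintegral_eq_smul_comp {b : Module.Basis (Fin d) ℝ (E d)} {c : ℝ≥0∞}
    (hc : (volume : Measure (E d)) = c • (volume : Measure (Fin d → ℝ)).map b.equivFunL.symm)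
    {F : E d → ℝ≥0∞} (hF : Measurable F) :
    ∫⁻ x, F x = c * ∫⁻ z, F (b.equivFunL.symm z) := by
  rw [hc, lintegral_smul_measure, lintegral_map hF b.equivFunL.symm.continuous.measurable,
    smul_eq_mul]

lemma ae_comp_equivFunL {b : Module.Basis (Fin d) ℝ (E d)} {c : ℝ≥0∞} (hc0 : c ≠ 0)
    (hc : (volume : Measure (E d)) = c • (volume : Measure (Fin d → ℝ)).map b.equivFunL.symm)
    {p : E d → Prop} (h : ∀ᵐ x, p x) : ∀ᵐ z, p (b.equivFunL.symm z) := by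
  rw [hc, Measure.ae_ennreal_smul_measure_iff hc0] at h
  exact ae_of_ae_map b.equivFunL.symm.continuous.aemeasurable h

lemma lintegral_mass {u : E d → ℝ} {w : Fin d → E d → ℝ} (hwm : ∀ i, Measurable (w i)) :
    ∫⁻ x, mass u w x = (∫⁻ x, ‖u x‖ₑ) + ∑ i, ∫⁻ x, ‖w i x‖ₑ := by
  unfold mass
  rw [lintegral_add_right _ (by fun_prop), lintegral_finsetSum _ (by fun_prop)]

lemma lintegral_mass_basis_le (b : Module.Basis (Fin d) ℝ (E d)) :
    ∃ C : ℝ≥0∞, C ≠ ⊤ ∧ ∀ (u : E d → ℝ) (w : Fin d → E d → ℝ), (∀ i, Measurable (w i)) →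
      ∫⁻ x, mass u (fun j x => ∑ i, b j i * w i x) x ≤ C * ∫⁻ x, mass u w x := by
  refine ⟨1 + ∑ j, ∑ i, ‖b j i‖ₑ, by simp [ENNReal.sum_eq_top], fun u w hw => ?_⟩
  rw [← lintegral_const_mul' _ _ (by simp [ENNReal.sum_eq_top])]
  refine lintegral_mono fun x => ?_
  simp only [mass]
  have h1 : ∀ j, ‖∑ i, b j i * w i x‖ₑ ≤ ∑ i, ‖b j i‖ₑ * (‖u x‖ₑ + ∑ i, ‖w i x‖ₑ) := by
    intro j
    refine (enorm_sum_le _ _).trans ?_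
    refine Finset.sum_le_sum fun i _ => ?_
    rw [enorm_mul]
    gcongr
    refine le_trans ?_ le_add_self
    exact Finset.single_le_sum (f := fun i => ‖w i x‖ₑ) (fun _ _ => zero_le) (Finset.mem_univ i)
  calc ‖u x‖ₑ + ∑ j, ‖∑ i, b j i * w i x‖ₑ
      ≤ (‖u x‖ₑ + ∑ i, ‖w i x‖ₑ) + ∑ j, ∑ i, ‖b j i‖ₑ * (‖u x‖ₑ + ∑ i, ‖w i x‖ₑ) := by
        gcongr with j
        · exact le_self_add
        · exact h1 j
    _ = (1 + ∑ j, ∑ i, ‖b j i‖ₑ) * (‖u x‖ₑ + ∑ i, ‖w i x‖ₑ) := by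
        rw [add_mul, one_mul, Finset.sum_mul]
        congr 1
        exact Finset.sum_congr rfl fun j _ => by rw [Finset.sum_mul]

/-- A set in which, near every point of the closure, one can move along the vectors of a basis. -/
def HasInteriorCones (Ω : Set (E d)) : Prop :=
  ∀ x₀ ∈ closure Ω, ∃ ρ > 0, ∃ b : Module.Basis (Fin d) ℝ (E d),
    ∀ x ∈ Ω ∩ Metric.ball x₀ ρ, ∀ i, ∀ t ∈ Set.Icc (0 : ℝ) 1, x + t • b i ∈ Ω

/-- The local Gagliardo inequality. -/
lemma exists_lintegral_rpow_le_of_basis {q : ℝ} (hq : Real.HolderConjugate (d : ℝ) q)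
    (b : Module.Basis (Fin d) ℝ (E d)) {U S : Set (E d)} (hS : IsOpen S)
    (hSU : ∀ x ∈ S, ∀ i, ∀ t ∈ Set.Icc (0 : ℝ) 1, x + t • b i ∈ U) :
    ∃ C : ℝ≥0∞, C ≠ ⊤ ∧ ∀ (u : E d → ℝ) (w : Fin d → E d → ℝ), Measurable u →
      (∀ i, Measurable (w i)) → Integrable u → (∀ i, Integrable (w i)) →
      (∀ i, HasWeakDir U (basisVec i) u (w i)) →
      ∫⁻ x in S, ‖u x‖ₑ ^ q ≤ C * (∫⁻ x, mass u w x) ^ q := by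
  obtain ⟨c, hc0, hct, hc⟩ := exists_volume_eq_smul_map b
  obtain ⟨C, hCt, hC⟩ := lintegral_mass_basis_le b
  have hq0 : 0 ≤ q := hq.symm.nonneg
  have hd1 : (1 : ℝ) < d := hq.lt
  have hd : d ≠ 0 := by rintro rfl; norm_num at hd1
  refine ⟨c * (c⁻¹ * C) ^ q, ENNReal.mul_ne_top hct (ENNReal.rpow_ne_top_of_nonneg hq0
    (ENNReal.mul_ne_top (ENNReal.inv_ne_top.2 hc0) hCt)), fun u w hum hwm hu hw h => ?_⟩
  set wb : Fin d → E d → ℝ := fun j x => ∑ i, b j i * w i x with hwb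
  have hwbm : ∀ j, Measurable (wb j) := fun j => by simp only [hwb]; fun_prop
  have hwbi : ∀ j, Integrable (wb j) := fun j =>
    integrable_finsetSum _ fun i _ => (hw i).const_mul _
  set F : E d → ℝ≥0∞ := mass u wb with hF
  have hFm : Measurable F := by
    rw [hF]; unfold mass; fun_prop
  have hae : ∀ᵐ x, x ∈ S → ∀ i, ‖u x‖ₑ ≤ ∫⁻ t : ℝ, F (x + t • b i) := by
    have h1 : ∀ i, ∀ᵐ x, x ∈ S → ‖u x‖ₑ ≤ ∫⁻ t : ℝ, F (x + t • b i) := by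
      intro i
      have := (HasWeakDir.sum_dir hu hw h (b i)).enorm_le_lintegral_segment hu (hwbi i) hum
        (hwbm i) hS (fun x hx t ht => hSU x hx i t ht)
      rw [ae_restrict_iff' hS.measurableSet] at this
      filter_upwards [this] with x hx hxS
      refine (hx hxS).trans (lintegral_mono fun t => ?_)
      simp only [hF, mass]
      gcongr
      exact Finset.single_le_sum (f := fun j => ‖wb j (x + t • b i)‖ₑ) (fun _ _ => zero_le)
        (Finset.mem_univ i)
    filter_upwards [ae_all_iff.2 h1] with x hx hxS i
    exact hx i hxS
  have hind : Measurable (S.indicator fun x => ‖u x‖ₑ ^ q) :=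
    Measurable.indicator (by fun_prop) hS.measurableSet
  have hqd : q = d * (1 / ((d : ℝ) - 1)) := by
    rw [hq.conjugate_eq]; ring
  have hpow : ∀ a : ℝ≥0∞, a ^ q = ∏ _i : Fin d, a ^ (1 / ((d : ℝ) - 1)) := by
    intro a
    rw [Finset.prod_const, Finset.card_univ, Fintype.card_fin, hqd, mul_comm,
      ENNReal.rpow_mul, ENNReal.rpow_natCast]
  calc ∫⁻ x in S, ‖u x‖ₑ ^ q = ∫⁻ x, S.indicator (fun x => ‖u x‖ₑ ^ q) x :=
        (lintegral_indicator hS.measurableSet _).symm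
    _ = c * ∫⁻ z, S.indicator (fun x => ‖u x‖ₑ ^ q) (b.equivFunL.symm z) :=
        lintegral_eq_smul_comp hc hind
    _ ≤ c * ∫⁻ z, ∏ i, (∫⁻ t : ℝ, F (b.equivFunL.symm (Function.update z i t)))
          ^ (1 / ((d : ℝ) - 1)) := by
        refine mul_le_mul' le_rfl (lintegral_mono_ae ?_)
        filter_upwards [ae_comp_equivFunL hc0 hc hae] with z hz
        by_cases hzS : b.equivFunL.symm z ∈ S
        · rw [Set.indicator_of_mem hzS, hpow]
          refine Finset.prod_le_prod' fun i _ => ?_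
          rw [lintegral_update_equivFunL]
          refine ENNReal.rpow_le_rpow (hz hzS i) ?_
          have : (0 : ℝ) < d - 1 := by linarith
          positivity
        · rw [Set.indicator_of_notMem hzS]; exact zero_le
    _ ≤ c * (∫⁻ z, F (b.equivFunL.symm z)) ^ q := by
        gcongr
        have hq' : Real.HolderConjugate (Fintype.card (Fin d) : ℝ) q := by simpa using hq
        have := lintegral_prod_lintegral_pow_le (fun _ : Fin d => (volume : Measure ℝ)) hq'
          (hFm.comp b.equivFunL.symm.continuous.measurable)
        rw [Fintype.card_fin] at this
        exact this
    _ = c * (c⁻¹ * ∫⁻ x, F x) ^ q := by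
        rw [lintegral_eq_smul_comp hc hFm, ← mul_assoc, ENNReal.inv_mul_cancel hc0 hct, one_mul]
    _ ≤ c * (c⁻¹ * (C * ∫⁻ x, mass u w x)) ^ q := by
        gcongr
        exact hC u w hwm
    _ = c * (c⁻¹ * C) ^ q * (∫⁻ x, mass u w x) ^ q := by
        rw [← mul_assoc c⁻¹, ENNReal.mul_rpow_of_nonneg _ _ hq0, mul_assoc]

/-- The local embedding into bounded functions in dimension one. -/
lemma exists_enorm_le_of_basis (b : Module.Basis (Fin 1) ℝ (E 1)) {U S : Set (E 1)}
    (hS : IsOpen S) (hSU : ∀ x ∈ S, ∀ i, ∀ t ∈ Set.Icc (0 : ℝ) 1, x + t • b i ∈ U) :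
    ∃ C : ℝ≥0∞, C ≠ ⊤ ∧ ∀ (u : E 1 → ℝ) (w : Fin 1 → E 1 → ℝ), Measurable u →
      (∀ i, Measurable (w i)) → Integrable u → (∀ i, Integrable (w i)) →
      (∀ i, HasWeakDir U (basisVec i) u (w i)) →
      ∀ᵐ x, x ∈ S → ‖u x‖ₑ ≤ C * ∫⁻ x, mass u w x := by
  obtain ⟨c, hc0, hct, hc⟩ := exists_volume_eq_smul_map b
  obtain ⟨C, hCt, hC⟩ := lintegral_mass_basis_le b
  refine ⟨c⁻¹ * C, ENNReal.mul_ne_top (ENNReal.inv_ne_top.2 hc0) hCt,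
    fun u w hum hwm hu hw h => ?_⟩
  set wb : Fin 1 → E 1 → ℝ := fun j x => ∑ i, b j i * w i x with hwb
  have hwbm : ∀ j, Measurable (wb j) := fun j => by simp only [hwb]; fun_prop
  have hwbi : ∀ j, Integrable (wb j) := fun j =>
    integrable_finsetSum _ fun i _ => (hw i).const_mul _
  have hFm : Measurable (mass u wb) := by unfold mass; fun_prop
  have := (HasWeakDir.sum_dir hu hw h (b 0)).enorm_le_lintegral_segment hu (hwbi 0) hum
    (hwbm 0) hS (fun x hx t ht => hSU x hx 0 t ht)
  rw [ae_restrict_iff' hS.measurableSet] at this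
  filter_upwards [this] with x hx hxS
  have e1 : ∫⁻ t : ℝ, mass u wb (x + t • b 0) = c⁻¹ * ∫⁻ x, mass u wb x := by
    rw [lintegral_eq_smul_comp hc hFm, ← mul_assoc, ENNReal.inv_mul_cancel hc0 hct, one_mul]
    have h1 := lintegral_update_equivFunL b (mass u wb) (b.equivFunL x) 0
    rw [ContinuousLinearEquiv.symm_apply_apply] at h1
    rw [← h1]
    have h2 := (volume_preserving_funUnique (Fin 1) ℝ).lintegral_comp_emb
      (MeasurableEquiv.measurableEmbedding _)
      (fun t => mass u wb (b.equivFunL.symm (Function.update (b.equivFunL x) 0 t)))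
    rw [← h2]
    refine lintegral_congr fun z => ?_
    congr 2
    ext i
    fin_cases i
    simp
  calc ‖u x‖ₑ ≤ _ := hx hxS
    _ = ∫⁻ t : ℝ, mass u wb (x + t • b 0) := by simp [mass, hwb]
    _ ≤ c⁻¹ * (C * ∫⁻ x, mass u w x) := by
        rw [e1]; gcongr; exact hC u w hwm
    _ = _ := by rw [mul_assoc]

/-- The Gagliardo inequality on a bounded open set with interior cones. -/
theorem exists_lintegral_rpow_le {q : ℝ} (hq : Real.HolderConjugate (d : ℝ) q) {Ω : Set (E d)}
    (hΩ : IsOpen Ω) (hb : Bornology.IsBounded Ω) (hcone : HasInteriorCones Ω) :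
    ∃ C : ℝ≥0∞, C ≠ ⊤ ∧ ∀ (u : E d → ℝ) (w : Fin d → E d → ℝ), Measurable u →
      (∀ i, Measurable (w i)) → Integrable u → (∀ i, Integrable (w i)) →
      (∀ i, HasWeakDir Ω (basisVec i) u (w i)) →
      ∫⁻ x in Ω, ‖u x‖ₑ ^ q ≤ C * (∫⁻ x, mass u w x) ^ q := by
  have key := hb.isCompact_closure.induction_on
    (p := fun A => ∃ C : ℝ≥0∞, C ≠ ⊤ ∧ ∀ (u : E d → ℝ) (w : Fin d → E d → ℝ), Measurable u →
      (∀ i, Measurable (w i)) → Integrable u → (∀ i, Integrable (w i)) →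
      (∀ i, HasWeakDir Ω (basisVec i) u (w i)) →
      ∫⁻ x in Ω ∩ A, ‖u x‖ₑ ^ q ≤ C * (∫⁻ x, mass u w x) ^ q)
    ⟨0, by simp, by simp⟩
    (fun s t hst ⟨C, hC, h⟩ => ⟨C, hC, fun u w a1 a2 a3 a4 a5 =>
      (lintegral_mono_set (Set.inter_subset_inter_right _ hst)).trans (h u w a1 a2 a3 a4 a5)⟩)
    (fun s t ⟨C, hC, h⟩ ⟨C', hC', h'⟩ => ⟨C + C', by simp [hC, hC'],
      fun u w a1 a2 a3 a4 a5 => by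
        rw [Set.inter_union_distrib_left, add_mul]
        exact (lintegral_union_le _ _ _).trans
          (add_le_add (h u w a1 a2 a3 a4 a5) (h' u w a1 a2 a3 a4 a5))⟩)
    (fun x hx => by
      obtain ⟨ρ, hρ, b, hbs⟩ := hcone x hx
      exact ⟨Metric.ball x ρ, mem_nhdsWithin_of_mem_nhds (Metric.ball_mem_nhds x hρ),
        exists_lintegral_rpow_le_of_basis hq b (hΩ.inter Metric.isOpen_ball) hbs⟩)
  rwa [Set.inter_eq_left.2 subset_closure] at key

/-- The embedding into bounded functions in dimension one. -/
theorem exists_enorm_le {Ω : Set (E 1)}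
    (hΩ : IsOpen Ω) (hb : Bornology.IsBounded Ω) (hcone : HasInteriorCones Ω) :
    ∃ C : ℝ≥0∞, C ≠ ⊤ ∧ ∀ (u : E 1 → ℝ) (w : Fin 1 → E 1 → ℝ), Measurable u →
      (∀ i, Measurable (w i)) → Integrable u → (∀ i, Integrable (w i)) →
      (∀ i, HasWeakDir Ω (basisVec i) u (w i)) →
      ∀ᵐ x, x ∈ Ω → ‖u x‖ₑ ≤ C * ∫⁻ x, mass u w x := by
  have key := hb.isCompact_closure.induction_on
    (p := fun A => ∃ C : ℝ≥0∞, C ≠ ⊤ ∧ ∀ (u : E 1 → ℝ) (w : Fin 1 → E 1 → ℝ), Measurable u →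
      (∀ i, Measurable (w i)) → Integrable u → (∀ i, Integrable (w i)) →
      (∀ i, HasWeakDir Ω (basisVec i) u (w i)) →
      ∀ᵐ x, x ∈ Ω ∩ A → ‖u x‖ₑ ≤ C * ∫⁻ x, mass u w x)
    ⟨0, by simp, by simp⟩
    (fun s t hst ⟨C, hC, h⟩ => ⟨C, hC, fun u w a1 a2 a3 a4 a5 => by
      filter_upwards [h u w a1 a2 a3 a4 a5] with x hx hxs
      exact hx (Set.inter_subset_inter_right _ hst hxs)⟩)
    (fun s t ⟨C, hC, h⟩ ⟨C', hC', h'⟩ => ⟨C + C', by simp [hC, hC'],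
      fun u w a1 a2 a3 a4 a5 => by
        filter_upwards [h u w a1 a2 a3 a4 a5, h' u w a1 a2 a3 a4 a5] with x hx hx' hxs
        rw [add_mul]
        rcases hxs with ⟨hxΩ, hxs | hxs⟩
        · exact (hx ⟨hxΩ, hxs⟩).trans le_self_add
        · exact (hx' ⟨hxΩ, hxs⟩).trans le_add_self⟩)
    (fun x hx => by
      obtain ⟨ρ, hρ, b, hbs⟩ := hcone x hx
      exact ⟨Metric.ball x ρ, mem_nhdsWithin_of_mem_nhds (Metric.ball_mem_nhds x hρ),
        exists_enorm_le_of_basis b (hΩ.inter Metric.isOpen_ball) hbs⟩)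
  rwa [Set.inter_eq_left.2 subset_closure] at key

end VBDF2

namespace VBDF2

variable {d : ℕ}

open Filter Topology

/-- The standard basis rescaled by nonzero factors. -/
def scaledBasis (c : Fin d → ℝ) (hc : ∀ i, c i ≠ 0) : Module.Basis (Fin d) ℝ (E d) :=
  (EuclideanSpace.basisFun (Fin d) ℝ).toBasis.isUnitSMul (fun i => (hc i).isUnit)

lemma scaledBasis_apply (c : Fin d → ℝ) (hc : ∀ i, c i ≠ 0) (i : Fin d) :
    scaledBasis c hc i = c i • basisVec i := by
  simp [scaledBasis, Module.Basis.isUnitSMul_apply, basisVec]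

/-- It suffices to move along the basis vectors as long as one stays close to the base point. -/
lemma exists_cone_of_local {Ω : Set (E d)} {x₀ : E d} (v : Module.Basis (Fin d) ℝ (E d)) {r : ℝ}
    (hr : 0 < r) (H : ∀ x ∈ Ω, dist x x₀ < r → ∀ i, ∀ t : ℝ, 0 ≤ t → dist (x + t • v i) x₀ < r →
      x + t • v i ∈ Ω) :
    ∃ ρ > 0, ∃ b : Module.Basis (Fin d) ℝ (E d),
      ∀ x ∈ Ω ∩ Metric.ball x₀ ρ, ∀ i, ∀ t ∈ Set.Icc (0 : ℝ) 1, x + t • b i ∈ Ω := by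
  have h1 : ∀ᶠ s in 𝓝[>] (0 : ℝ), ∀ i, s * ‖v i‖ < r / 2 := by
    rw [eventually_all]
    intro i
    have h2 : Tendsto (fun s : ℝ => s * ‖v i‖) (𝓝[>] 0) (𝓝 0) := by
      have : Continuous fun s : ℝ => s * ‖v i‖ := by fun_prop
      simpa using (this.tendsto 0).mono_left nhdsWithin_le_nhds
    exact h2.eventually_lt_const (by positivity)
  obtain ⟨s, hs, hs0⟩ := (h1.and self_mem_nhdsWithin).exists
  have hs0 : (0 : ℝ) < s := hs0
  refine ⟨r / 2, by positivity, v.isUnitSMul (w := fun _ => s) (fun _ => hs0.ne'.isUnit), ?_⟩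
  rintro x ⟨hx, hxb⟩ i t ht
  rw [Metric.mem_ball] at hxb
  rw [Module.Basis.isUnitSMul_apply, smul_smul]
  refine H x hx (by linarith) i _ (mul_nonneg ht.1 hs0.le) ?_
  calc dist (x + (t * s) • v i) x₀ ≤ dist (x + (t * s) • v i) x + dist x x₀ := dist_triangle _ _ _
    _ < r / 2 + r / 2 := by
        refine add_lt_add_of_le_of_lt ?_ hxb
        rw [dist_eq_norm, add_sub_cancel_left, norm_smul,
          Real.norm_of_nonneg (mul_nonneg ht.1 hs0.le)]
        nlinarith [hs i, ht.1, ht.2, norm_nonneg (v i), mul_nonneg hs0.le (norm_nonneg (v i))]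
    _ = r := by ring

lemma exists_basis_neg {ℓ : E d →L[ℝ] ℝ} (hℓ : ℓ ≠ 0) :
    ∃ b : Module.Basis (Fin d) ℝ (E d), ∀ i, ℓ (b i) < 0 := by
  obtain ⟨v, hv⟩ : ∃ v, ℓ v < 0 := by
    by_contra! hcon
    apply hℓ
    ext x
    have h1 := hcon x
    have h2 := hcon (-x)
    rw [map_neg] at h2
    simp only [zero_apply]
    linarith
  have hspan : ⊤ ≤ Submodule.span ℝ {x : E d | ℓ x < 0} := by
    intro x _
    obtain ⟨k, hk⟩ := exists_nat_gt (ℓ x / (- ℓ v))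
    rw [div_lt_iff₀ (by linarith)] at hk
    have h1 : x + (k : ℝ) • v ∈ Submodule.span ℝ {x : E d | ℓ x < 0} := by
      refine Submodule.subset_span ?_
      simp only [Set.mem_ofPred_eq, map_add, map_smul, smul_eq_mul]
      linarith
    have h2 : (k : ℝ) • v ∈ Submodule.span ℝ {x : E d | ℓ x < 0} :=
      Submodule.smul_mem _ _ (Submodule.subset_span hv)
    simpa using Submodule.sub_mem _ h1 h2
  let b := Module.Basis.ofSpan hspan
  let e := b.indexEquiv (EuclideanSpace.basisFun (Fin d) ℝ).toBasis
  refine ⟨b.reindex e, fun i => ?_⟩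
  rw [Module.Basis.reindex_apply]
  exact Module.Basis.ofSpan_subset hspan (Set.mem_range_self _)

theorem IsSmoothBoundedDomain.hasInteriorCones {Ω : Set (E d)} (h : IsSmoothBoundedDomain Ω) :
    HasInteriorCones Ω := by
  intro x₀ hx₀
  by_cases hin : x₀ ∈ Ω
  · obtain ⟨r, hr, hrΩ⟩ := Metric.isOpen_iff.1 h.isOpen x₀ hin
    exact exists_cone_of_local (EuclideanSpace.basisFun (Fin d) ℝ).toBasis hr
      fun x _ _ i t _ hd => hrΩ hd
  · have hfr : x₀ ∈ frontier Ω := by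
      rw [frontier, h.isOpen.interior_eq]
      exact ⟨hx₀, hin⟩
    obtain ⟨U, hU, hxU, f, hf, hf0, hΩU⟩ := h.smooth_boundary x₀ hfr
    have hstrict : HasStrictFDerivAt f (fderiv ℝ f x₀) x₀ :=
      (hf.contDiffAt (hU.mem_nhds hxU)).hasStrictFDerivAt (by simp)
    obtain ⟨v, hv⟩ := exists_basis_neg hf0
    have h1 : ∀ᶠ c in 𝓝[>] (0 : ℝ), ∀ i, c * ‖v i‖ < - fderiv ℝ f x₀ (v i) := by
      rw [eventually_all]
      intro i
      have h2 : Tendsto (fun s : ℝ => s * ‖v i‖) (𝓝[>] 0) (𝓝 0) := by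
        have : Continuous fun s : ℝ => s * ‖v i‖ := by fun_prop
        simpa using (this.tendsto 0).mono_left nhdsWithin_le_nhds
      exact h2.eventually_lt_const (by linarith [hv i])
    obtain ⟨c, hc, hc0⟩ := (h1.and self_mem_nhdsWithin).exists
    have h3 := hstrict.isLittleO.def (show (0 : ℝ) < c from hc0)
    have h4 : ∀ᶠ p : E d × E d in 𝓝 (x₀, x₀), p.1 ∈ U ∧ p.2 ∈ U :=
      (continuous_fst.tendsto (x₀, x₀)).eventually (hU.mem_nhds hxU) |>.and
        ((continuous_snd.tendsto (x₀, x₀)).eventually (hU.mem_nhds hxU))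
    obtain ⟨r, hr, hball⟩ := Metric.eventually_nhds_iff.1 (h3.and h4)
    refine exists_cone_of_local v hr fun x hx hxr i t ht htr => ?_
    have h5 := @hball (x + t • v i, x) (by
      rw [Prod.dist_eq]; exact max_lt htr hxr)
    obtain ⟨h6, h7, h8⟩ := h5
    have hfx : f x < 0 := by
      have : x ∈ Ω ∩ U := ⟨hx, h8⟩
      rw [hΩU] at this
      exact this.2
    have h9 : f (x + t • v i) < 0 := by
      simp only [add_sub_cancel_left, map_smul, smul_eq_mul, norm_smul] at h6
      rw [Real.norm_of_nonneg ht, Real.norm_eq_abs] at h6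
      have h10 := (abs_le.1 h6).2
      nlinarith [hc i, mul_nonneg ht (sub_nonneg.2 (hc i).le)]
    have : x + t • v i ∈ {y ∈ U | f y < 0} := ⟨h7, h9⟩
    rw [← hΩU] at this
    exact this.1

/-- The open box with side lengths `L`. -/
def box (L : Fin d → ℝ) : Set (E d) := {x | ∀ i, x i ∈ Set.Ioo 0 (L i)}

lemma isOpen_box (L : Fin d → ℝ) : IsOpen (box L) := by
  have : box L = ⋂ i, (fun x : E d => x i) ⁻¹' Set.Ioo 0 (L i) := by
    ext x; simp [box]
  rw [this]
  exact isOpen_iInter_of_finite fun i => isOpen_Ioo.preimage (by fun_prop)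

lemma isBounded_box (L : Fin d → ℝ) : Bornology.IsBounded (box L) := by
  have h : IsCompact ((WithLp.toLp 2) '' (Set.pi Set.univ fun i => Set.Icc 0 (L i)) : Set (E d)) :=
    (isCompact_univ_pi fun i => isCompact_Icc).image (PiLp.continuous_toLp 2 _)
  refine h.isBounded.subset fun x hx => ?_
  exact ⟨WithLp.ofLp x, fun i _ => Set.Ioo_subset_Icc_self (hx i), rfl⟩

lemma abs_apply_sub_le (x y : E d) (i : Fin d) : |x i - y i| ≤ dist x y := by
  rw [dist_eq_norm]
  have := PiLp.norm_apply_le (x - y) i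
  simpa using this

lemma basisVec_apply (i j : Fin d) : basisVec i j = if j = i then (1 : ℝ) else 0 := by
  simp [basisVec]

theorem hasInteriorCones_box (L : Fin d → ℝ) (hL : ∀ i, 0 < L i) :
    HasInteriorCones (box L) := by
  intro x₀ _
  have h1 : ∀ᶠ r in 𝓝[>] (0 : ℝ), ∀ i, r < L i / 2 := by
    rw [eventually_all]
    intro i
    exact (tendsto_id.mono_left nhdsWithin_le_nhds).eventually_lt_const (half_pos (hL i))
  obtain ⟨r, hr, hr0⟩ := (h1.and self_mem_nhdsWithin).exists
  have hr0 : (0 : ℝ) < r := hr0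
  set σ : Fin d → ℝ := fun i => if x₀ i ≤ L i / 2 then 1 else -1 with hσ
  have hσ0 : ∀ i, σ i ≠ 0 := fun i => by simp only [hσ]; split_ifs <;> norm_num
  refine exists_cone_of_local (scaledBasis σ hσ0) hr0 fun x hx hxr i t ht htr j => ?_
  have h2 := abs_lt.1 ((abs_apply_sub_le _ _ j).trans_lt htr)
  have h3 := hx j
  have h4 := hr j
  rw [scaledBasis_apply] at *
  simp only [PiLp.add_apply, PiLp.smul_apply, smul_eq_mul, basisVec_apply] at *
  by_cases hj : j = i
  · subst hj
    simp only [if_true, mul_one] at *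
    simp only [hσ] at *
    split_ifs at * with hle
    · exact ⟨by linarith [h3.1], by linarith⟩
    · exact ⟨by linarith, by linarith [h3.2]⟩
  · simpa [hj] using h3

end VBDF2

namespace VBDF2

variable {d : ℕ}

open Filter Topology

/-- The lattice spanned by a basis. -/
abbrev lattice (b : Module.Basis (Fin d) ℝ (E d)) : Submodule ℤ (E d) :=
  Submodule.span ℤ (Set.range b)

/-- The periodization of a function over a lattice. -/
def periodize (b : Module.Basis (Fin d) ℝ (E d)) (η : E d → ℝ) (x : E d) : ℝ :=
  ∑ᶠ v : lattice b, η (v + x)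

variable {b : Module.Basis (Fin d) ℝ (E d)}

lemma exists_finset_forall_eq_zero (b : Module.Basis (Fin d) ℝ (E d)) {ζ : E d → ℝ}
    (hζ : HasCompactSupport ζ) {B : Set (E d)} (hB : Bornology.IsBounded B) :
    ∃ F : Finset (lattice b), ∀ x ∈ B, ∀ v : lattice b, v ∉ F → ζ (v + x) = 0 := by
  obtain ⟨r₁, h₁⟩ := hζ.isCompact.isBounded.subset_closedBall 0
  obtain ⟨r₂, h₂⟩ := hB.subset_closedBall 0
  have hfin : {v : lattice b | (v : E d) ∈ Metric.closedBall (0 : E d) (r₁ + r₂)}.Finite := by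
    have h := ZSpan.setFinite_inter b (s := Metric.closedBall (0 : E d) (r₁ + r₂))
      Metric.isBounded_closedBall
    refine (h.preimage (f := ((↑) : lattice b → E d)) Subtype.val_injective.injOn).subset ?_
    intro v hv
    exact ⟨hv, v.2⟩
  refine ⟨hfin.toFinset, fun x hx v hv => ?_⟩
  by_contra hne
  apply hv
  rw [Set.Finite.mem_toFinset]
  change (v : E d) ∈ Metric.closedBall (0 : E d) (r₁ + r₂)
  have h3 := h₁ (subset_tsupport _ hne)
  have h4 := h₂ hx
  rw [mem_closedBall_zero_iff] at *
  calc ‖(v : E d)‖ = ‖((v : E d) + x) - x‖ := by simp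
    _ ≤ ‖(v : E d) + x‖ + ‖x‖ := norm_sub_le _ _
    _ ≤ r₁ + r₂ := add_le_add h3 h4

lemma periodize_eq_sum {ζ : E d → ℝ} {F : Finset (lattice b)} {x : E d}
    (hF : ∀ v : lattice b, v ∉ F → ζ (v + x) = 0) :
    periodize b ζ x = ∑ v ∈ F, ζ (v + x) := by
  refine finsum_eq_sum_of_support_subset _ fun v hv => ?_
  by_contra hvF
  exact hv (hF v hvF)

lemma contDiff_periodize {η : E d → ℝ} (h1 : ContDiff ℝ ∞ η) (h2 : HasCompactSupport η) :
    ContDiff ℝ ∞ (periodize b η) := by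
  rw [contDiff_iff_contDiffAt]
  intro x
  obtain ⟨F, hF⟩ := exists_finset_forall_eq_zero b h2 (Metric.isBounded_ball (x := x) (r := 1))
  have h3 : ContDiff ℝ ∞ fun y => ∑ v ∈ F, η (v + y) :=
    ContDiff.sum fun v _ => h1.comp (contDiff_const.add contDiff_id)
  refine h3.contDiffAt.congr_of_eventuallyEq ?_
  filter_upwards [Metric.ball_mem_nhds x one_pos] with y hy
  exact periodize_eq_sum (hF y hy)

lemma fderiv_periodize {η : E d → ℝ} (h1 : ContDiff ℝ ∞ η) (h2 : HasCompactSupport η)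
    (x y : E d) : fderiv ℝ (periodize b η) x y = periodize b (fun x => fderiv ℝ η x y) x := by
  obtain ⟨F, hF⟩ := exists_finset_forall_eq_zero b h2 (Metric.isBounded_ball (x := x) (r := 1))
  have h3 : periodize b η =ᶠ[𝓝 x] fun y => ∑ v ∈ F, η (v + y) := by
    filter_upwards [Metric.ball_mem_nhds x one_pos] with y hy
    exact periodize_eq_sum (hF y hy)
  have hd : Differentiable ℝ η := h1.differentiable (by simp)
  have h4 : ∀ v : lattice b, fderiv ℝ (fun y => η (v + y)) x = fderiv ℝ η (v + x) := fun v => by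
    simpa using fderiv_comp_add_left (𝕜 := ℝ) (f := η) (x := x) (v : E d)
  rw [h3.fderiv_eq, fderiv_fun_sum (A := fun (v : lattice b) y => η (v + y))
    fun v _ => (hd.comp (f := fun y => (v : E d) + y) (by fun_prop)) x]
  rw [periodize_eq_sum (F := F)]
  · rw [sum_apply]
    exact Finset.sum_congr rfl fun v _ => by rw [h4]
  · intro v hv
    rw [← h4 v]
    have : (fun y => η (v + y)) =ᶠ[𝓝 x] fun _ => 0 := by
      filter_upwards [Metric.ball_mem_nhds x one_pos] with y hy
      exact hF y hy v hv
    rw [this.fderiv_eq]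
    simp

lemma periodize_add (ζ : E d → ℝ) (v : lattice b) (x : E d) :
    periodize b ζ (v + x) = periodize b ζ x := by
  unfold periodize
  rw [← finsum_comp_equiv (Equiv.addRight v) (f := fun w : lattice b => ζ (w + x))]
  refine finsum_congr fun w => ?_
  simp [add_assoc]

lemma integrableOn_of_periodic {H : E d → ℝ} (hper : ∀ (v : lattice b) x, H (v + x) = H x)
    (hi : IntegrableOn H (ZSpan.fundamentalDomain b)) {B : Set (E d)}
    (hB : Bornology.IsBounded B) : IntegrableOn H B := by
  have hD := ZSpan.fundamentalDomain_isBounded b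
  obtain ⟨r₁, h₁⟩ := hB.subset_closedBall 0
  obtain ⟨r₂, h₂⟩ := hD.subset_closedBall 0
  have hfin : {v : lattice b | (v : E d) ∈ Metric.closedBall (0 : E d) (r₁ + r₂)}.Finite := by
    have h := ZSpan.setFinite_inter b (s := Metric.closedBall (0 : E d) (r₁ + r₂))
      Metric.isBounded_closedBall
    refine (h.preimage (f := ((↑) : lattice b → E d)) Subtype.val_injective.injOn).subset ?_
    intro v hv
    exact ⟨hv, v.2⟩
  have hsub : B ⊆ ⋃ v ∈ {v : lattice b | (v : E d) ∈ Metric.closedBall (0 : E d) (r₁ + r₂)},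
      (fun x => (v : E d) + x) '' ZSpan.fundamentalDomain b := by
    intro x hx
    have h3 : x - ZSpan.fract b x = ZSpan.floor b x := by
      rw [ZSpan.fract_apply]; simp
    refine Set.mem_biUnion (x := ZSpan.floor b x) ?_ ⟨ZSpan.fract b x,
      ZSpan.fract_mem_fundamentalDomain b x, by simp [← h3]⟩
    change (ZSpan.floor b x : E d) ∈ Metric.closedBall (0 : E d) (r₁ + r₂)
    have h4 := h₁ hx
    have h5 := h₂ (ZSpan.fract_mem_fundamentalDomain b x)
    rw [mem_closedBall_zero_iff] at *
    rw [← h3]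
    exact (norm_sub_le _ _).trans (add_le_add h4 h5)
  refine IntegrableOn.mono_set ?_ hsub
  rw [integrableOn_finite_biUnion hfin]
  intro v _
  rw [(measurePreserving_add_left volume (v : E d)).integrableOn_image
    (measurableEmbedding_addLeft (v : E d))]
  refine hi.congr_fun (fun x _ => ?_) (ZSpan.fundamentalDomain_measurableSet b)
  simp [hper]

lemma locallyIntegrable_of_periodic {H : E d → ℝ} (hper : ∀ (v : lattice b) x, H (v + x) = H x)
    (hi : IntegrableOn H (ZSpan.fundamentalDomain b)) : LocallyIntegrable H := fun x =>
  ⟨Metric.ball x 1, Metric.ball_mem_nhds x one_pos,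
    integrableOn_of_periodic hper hi Metric.isBounded_ball⟩

/-- Unfolding an integral against a periodization. -/
theorem integral_mul_periodize {H : E d → ℝ} (hper : ∀ (v : lattice b) x, H (v + x) = H x)
    (hi : IntegrableOn H (ZSpan.fundamentalDomain b)) {ζ : E d → ℝ} (hc : Continuous ζ)
    (hζ : HasCompactSupport ζ) :
    ∫ x, H x * ζ x = ∫ x in ZSpan.fundamentalDomain b, H x * periodize b ζ x := by
  have hD := ZSpan.isAddFundamentalDomain b (volume : Measure (E d))
  obtain ⟨F, hF⟩ := exists_finset_forall_eq_zero b hζ (ZSpan.fundamentalDomain_isBounded b)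
  have hInt : Integrable (fun x => H x * ζ x) := by
    have := (locallyIntegrable_of_periodic hper hi).integrable_smul_right_of_hasCompactSupport
      hc hζ
    simpa [mul_comm] using this
  have hDm := ZSpan.fundamentalDomain_measurableSet b
  obtain ⟨C, hC⟩ := hζ.exists_bound_of_continuous hc
  have : VAddInvariantMeasure (lattice b) (E d) volume :=
    inferInstanceAs (VAddInvariantMeasure (lattice b).toAddSubgroup (E d) volume)
  have : MeasurableConstVAdd (lattice b) (E d) :=
    inferInstanceAs (MeasurableConstVAdd (lattice b).toAddSubgroup (E d))
  rw [hD.integral_eq_tsum'' _ hInt, tsum_eq_sum (s := F)]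
  · rw [setIntegral_congr_fun hDm (g := fun x => ∑ v ∈ F, H x * ζ (v + x)) (fun x hx => by
      simp only
      rw [periodize_eq_sum (hF x hx), Finset.mul_sum])]
    rw [integral_finsetSum]
    · refine Finset.sum_congr rfl fun v _ => ?_
      refine setIntegral_congr_fun hDm fun x _ => ?_
      simp only [Submodule.vadd_def, vadd_eq_add, hper]
    · intro v _
      exact Integrable.mul_bdd (c := C) hi (by
        exact (hc.comp (by fun_prop : Continuous fun x : E d => (v : E d) + x)).aestronglyMeasurable)
        (.of_forall fun x => hC _)
  · intro v hv
    rw [setIntegral_congr_fun hDm (g := fun _ => (0 : ℝ)) (fun x hx => by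
      simp only [Submodule.vadd_def, vadd_eq_add]
      rw [hF x hx v hv, mul_zero])]
    simp

/-- Every smooth periodic function is the periodization of a test function. -/
theorem exists_periodize_eq {ψ : E d → ℝ} (hψ : ContDiff ℝ ∞ ψ)
    (hper : ∀ (v : lattice b) x, ψ (v + x) = ψ x) :
    ∃ η, IsBump Set.univ η ∧ periodize b η = ψ := by
  obtain ⟨r, hr⟩ := (ZSpan.fundamentalDomain_isBounded b).subset_closedBall 0
  let χ : ContDiffBump (0 : E d) := ⟨max r 1, max r 1 + 1, by positivity, by linarith⟩
  have hχ1 : ContDiff ℝ ∞ χ := χ.contDiff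
  have hχ2 : HasCompactSupport χ := χ.hasCompactSupport
  have hfinS : ∀ x, (Function.support fun v : lattice b => χ (v + x)).Finite := by
    intro x
    obtain ⟨F, hF⟩ := exists_finset_forall_eq_zero b hχ2 (Bornology.isBounded_singleton (x := x))
    refine F.finite_toSet.subset fun v hv => ?_
    by_contra hvF
    exact hv (hF x rfl v hvF)
  have hpos : ∀ x, 0 < periodize b χ x := by
    intro x
    have h1 : ((-ZSpan.floor b x : lattice b) : E d) + x = ZSpan.fract b x := by
      rw [ZSpan.fract_apply]; push_cast; abel
    have h2 : χ (((-ZSpan.floor b x : lattice b) : E d) + x) = 1 := by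
      rw [h1]
      refine χ.one_of_mem_closedBall ?_
      exact Metric.closedBall_subset_closedBall (le_max_left _ _)
        (hr (ZSpan.fract_mem_fundamentalDomain b x))
    have h3 : χ (((-ZSpan.floor b x : lattice b) : E d) + x) ≤ periodize b χ x :=
      single_le_finsum (f := fun v : lattice b => χ ((v : E d) + x)) (-ZSpan.floor b x) (hfinS x)
        (fun v => χ.nonneg)
    linarith
  refine ⟨fun x => χ x * (ψ x / periodize b χ x), ⟨?_, ?_, Set.subset_univ _⟩, ?_⟩
  · exact hχ1.mul (hψ.div (contDiff_periodize hχ1 hχ2) fun x => (hpos x).ne')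
  · exact hχ2.mul_right
  · ext x
    have h1 : periodize b (fun x => χ x * (ψ x / periodize b χ x)) x
        = ∑ᶠ v : lattice b, χ (v + x) * (ψ x / periodize b χ x) := by
      refine finsum_congr fun v => ?_
      simp only [hper, periodize_add]
    rw [h1, ← finsum_mul]
    change periodize b χ x * _ = _
    rw [mul_div_cancel₀ _ (hpos x).ne']

lemma fract_add_lattice (v : lattice b) (x : E d) : ZSpan.fract b (v + x) = ZSpan.fract b x :=
  ZSpan.fract_zSpan_add b x v.2

/-- Weak differentiability on the torus, expressed through periodic extensions. -/
theorem forall_periodic_iff_hasWeakDir {y : E d} {u w : E d → ℝ}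
    (hu : IntegrableOn u (ZSpan.fundamentalDomain b))
    (hw : IntegrableOn w (ZSpan.fundamentalDomain b)) :
    (∀ ψ : E d → ℝ, ContDiff ℝ ∞ ψ → (∀ (v : lattice b) x, ψ (v + x) = ψ x) →
      ∫ x in ZSpan.fundamentalDomain b, u x * fderiv ℝ ψ x y
        = - ∫ x in ZSpan.fundamentalDomain b, w x * ψ x) ↔
    HasWeakDir Set.univ y (fun x => u (ZSpan.fract b x)) (fun x => w (ZSpan.fract b x)) := by
  have hDm := ZSpan.fundamentalDomain_measurableSet b
  have hext : ∀ {H : E d → ℝ}, IntegrableOn H (ZSpan.fundamentalDomain b) →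
      IntegrableOn (fun x => H (ZSpan.fract b x)) (ZSpan.fundamentalDomain b) := fun hH =>
    hH.congr_fun (fun x hx => by rw [ZSpan.fract_eq_self.2 hx]) hDm
  have hfold : ∀ {H ζ : E d → ℝ}, IntegrableOn H (ZSpan.fundamentalDomain b) → Continuous ζ →
      HasCompactSupport ζ → ∫ x, H (ZSpan.fract b x) * ζ x
        = ∫ x in ZSpan.fundamentalDomain b, H x * periodize b ζ x := by
    intro H ζ hH hc hζ
    rw [integral_mul_periodize (H := fun x => H (ZSpan.fract b x))
      (fun v x => by rw [fract_add_lattice]) (hext hH) hc hζ]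
    exact setIntegral_congr_fun hDm fun x hx => by rw [ZSpan.fract_eq_self.2 hx]
  have hη : ∀ η : E d → ℝ, IsBump Set.univ η →
      ((∫ x, u (ZSpan.fract b x) * fderiv ℝ η x y = - ∫ x, w (ZSpan.fract b x) * η x) ↔
      ∫ x in ZSpan.fundamentalDomain b, u x * fderiv ℝ (periodize b η) x y
        = - ∫ x in ZSpan.fundamentalDomain b, w x * periodize b η x) := by
    intro η hη
    rw [hfold hu (hη.continuous_fderiv_apply y) (hη.hasCompactSupport_fderiv_apply y),
      hfold hw hη.1.continuous hη.2.1]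
    simp_rw [fderiv_periodize hη.1 hη.2.1]
  constructor
  · intro h η hb
    exact (hη η hb).2 (h _ (contDiff_periodize hb.1 hb.2.1) (periodize_add η))
  · intro h ψ hψ hper
    obtain ⟨η, hb, rfl⟩ := exists_periodize_eq hψ hper
    exact (hη η hb).1 (h η hb)

end VBDF2

namespace VBDF2

variable {d : ℕ}

open Filter Topology

/-- The chain rule for locally integrable functions. -/
theorem HasWeakDir.comp_of_locallyIntegrableOn {U : Set (E d)} (hU : IsOpen U) {y : E d}
    {u w : E d → ℝ} (h : HasWeakDir U y u w) (hu : LocallyIntegrableOn u U)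
    (hw : LocallyIntegrableOn w U) {f : ℝ → ℝ}
    (hf : ContDiff ℝ 1 f) {s : Set ℝ} (hs : Convex ℝ s) (h0 : (0 : ℝ) ∈ s) (hus : ∀ x, u x ∈ s)
    {K : ℝ} (hK : ∀ t ∈ s, |deriv f t| ≤ K) :
    HasWeakDir U y (fun x => f (u x)) (fun x => deriv f (u x) * w x) := by
  intro η hη
  obtain ⟨W, hWo, hKW, hWU, hWc⟩ :=
    exists_open_between_and_isCompact_closure hη.2.1.isCompact hU hη.2.2
  have hηW : IsBump W η := ⟨hη.1, hη.2.1, hKW⟩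
  have hsub : W ⊆ U := subset_closure.trans hWU
  have hzero : ∀ {η' : E d → ℝ}, IsBump W η' → ∀ x, x ∉ W → η' x = 0 ∧ fderiv ℝ η' x y = 0 := by
    intro η' hη' x hx
    refine ⟨image_eq_zero_of_notMem_tsupport fun hc => hx (hη'.2.2 hc), ?_⟩
    have : fderiv ℝ η' x = 0 :=
      image_eq_zero_of_notMem_tsupport fun hc =>
        hx (hη'.2.2 (tsupport_fderiv_subset ℝ hc))
    rw [this]; rfl
  have hcongr : ∀ {F F' : E d → ℝ} {ζ : E d → ℝ}, (∀ x ∈ W, F x = F' x) → (∀ x ∉ W, ζ x = 0) →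
      ∫ x, F x * ζ x = ∫ x, F' x * ζ x := by
    intro F F' ζ h1 h2
    congr 1; ext x
    by_cases hx : x ∈ W
    · rw [h1 x hx]
    · rw [h2 x hx, mul_zero, mul_zero]
  have hui : Integrable (W.indicator u) := by
    rw [integrable_indicator_iff hWo.measurableSet]
    exact (hu.integrableOn_compact_subset hWU hWc).mono_set subset_closure
  have hwi : Integrable (W.indicator w) := by
    rw [integrable_indicator_iff hWo.measurableSet]
    exact (hw.integrableOn_compact_subset hWU hWc).mono_set subset_closure
  have hweak : HasWeakDir W y (W.indicator u) (W.indicator w) := by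
    intro η' hη'
    rw [hcongr (F' := u) (fun x hx => Set.indicator_of_mem hx _) fun x hx => (hzero hη' x hx).2,
      hcongr (F' := w) (fun x hx => Set.indicator_of_mem hx _) fun x hx => (hzero hη' x hx).1]
    exact h η' (hη'.mono hsub)
  have hus' : ∀ x, W.indicator u x ∈ s := by
    intro x
    by_cases hx : x ∈ W
    · rw [Set.indicator_of_mem hx]; exact hus x
    · rw [Set.indicator_of_notMem hx]; exact h0
  have key := hweak.comp hWo hui hwi hf hs hus' hK η hηW
  rw [hcongr (F' := fun x => f (u x)) (fun x hx => by rw [Set.indicator_of_mem hx])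
      fun x hx => (hzero hηW x hx).2,
    hcongr (F' := fun x => deriv f (u x) * w x)
      (fun x hx => by rw [Set.indicator_of_mem hx, Set.indicator_of_mem hx])
      fun x hx => (hzero hηW x hx).1] at key
  exact key

lemma box_ae_eq_fundamentalDomain (L : Fin d → ℝ) (hL : ∀ i, 0 < L i) :
    box L =ᵐ[volume] ZSpan.fundamentalDomain (scaledBasis L fun i => (hL i).ne') := by
  have e1 : ZSpan.fundamentalDomain (scaledBasis L fun i => (hL i).ne')
      = (WithLp.ofLp : E d → Fin d → ℝ) ⁻¹' (Set.pi Set.univ fun i => Set.Ico 0 (L i)) := by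
    ext x
    rw [ZSpan.mem_fundamentalDomain]
    simp only [Set.mem_preimage, Set.mem_univ_pi]
    refine forall_congr' fun i => ?_
    have h1 : (scaledBasis L fun i => (hL i).ne').repr x i = (L i)⁻¹ * x i := by
      simp [scaledBasis, Module.Basis.repr_isUnitSMul, Units.smul_def]
    rw [h1, ← div_eq_inv_mul, Set.mem_Ico, Set.mem_Ico, div_lt_one (hL i), le_div_iff₀ (hL i),
      zero_mul]
  have e2 : box L = (WithLp.ofLp : E d → Fin d → ℝ) ⁻¹' (Set.pi Set.univ fun i => Set.Ioo 0 (L i)) := by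
    ext x; simp [box]
  rw [e1, e2]
  have h3 : (Set.pi Set.univ fun i => Set.Ioo 0 (L i)) =ᵐ[(volume : Measure (Fin d → ℝ))]
      (Set.pi Set.univ fun i => Set.Ico 0 (L i)) :=
    (Measure.univ_pi_Ioo_ae_eq_Icc (f := fun _ => 0) (g := L)).trans
      (Measure.univ_pi_Ico_ae_eq_Icc (f := fun _ => 0) (g := L)).symm
  exact (PiLp.volume_preserving_ofLp (Fin d)).quasiMeasurePreserving.preimage_ae_eq h3

namespace Domain

variable (P : Domain d)

lemma isOpen_carrier : IsOpen P.carrier := by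
  cases P with
  | neumann Ω h => exact h.isOpen
  | periodic L hL => exact isOpen_box L

lemma isBounded_carrier : Bornology.IsBounded P.carrier := by
  cases P with
  | neumann Ω h => exact h.isBounded
  | periodic L hL => exact isBounded_box L

lemma hasInteriorCones : HasInteriorCones P.carrier := by
  cases P with
  | neumann Ω h => exact h.hasInteriorCones
  | periodic L hL => exact hasInteriorCones_box L hL

lemma nonempty_carrier : P.carrier.Nonempty := by
  cases P with
  | neumann Ω h => exact h.isConnected.nonempty
  | periodic L hL =>
    refine ⟨WithLp.toLp 2 fun i => L i / 2, fun i => ?_⟩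
    have := hL i
    exact ⟨by simp [this], by simp [this]⟩

instance : IsFiniteMeasure P.vol := by
  refine ⟨?_⟩
  rw [vol, Measure.restrict_apply_univ]
  exact P.isBounded_carrier.measure_lt_top

lemma vol_univ_pos : 0 < P.vol.real Set.univ := by
  rw [measureReal_def, ENNReal.toReal_pos_iff]
  refine ⟨?_, measure_lt_top _ _⟩
  rw [vol, Measure.restrict_apply_univ]
  exact P.isOpen_carrier.measure_pos _ P.nonempty_carrier

lemma IsTest.contDiff {P : Domain d} {ψ : E d → ℝ} (h : P.IsTest ψ) : ContDiff ℝ ∞ ψ := by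
  cases P with
  | neumann Ω _ => exact h.1
  | periodic L _ => exact h.1

/-- The open set on which the extension of a function is considered. -/
def extDom : Domain d → Set (E d)
  | neumann Ω _ => Ω
  | periodic _ _ => Set.univ

/-- The projection onto the domain: reduction modulo the periods in the periodic case. -/
def proj : Domain d → E d → E d
  | neumann _ _ => id
  | periodic L hL => ZSpan.fract (scaledBasis L fun i => (hL i).ne')

lemma isOpen_extDom : IsOpen P.extDom := by
  cases P with
  | neumann Ω h => exact h.isOpen
  | periodic L hL => exact isOpen_univ

lemma carrier_subset_extDom : P.carrier ⊆ P.extDom := by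
  cases P with
  | neumann Ω h => exact subset_rfl
  | periodic L hL => exact Set.subset_univ _

lemma box_subset_fundamentalDomain (L : Fin d → ℝ) (hL : ∀ i, 0 < L i) :
    box L ⊆ ZSpan.fundamentalDomain (scaledBasis L fun i => (hL i).ne') := by
  intro x hx
  rw [ZSpan.mem_fundamentalDomain]
  intro i
  have h1 : (scaledBasis L fun i => (hL i).ne').repr x i = (L i)⁻¹ * x i := by
    simp [scaledBasis, Module.Basis.repr_isUnitSMul, Units.smul_def]
  have h2 := hx i
  rw [h1, ← div_eq_inv_mul]
  exact ⟨div_nonneg h2.1.le (hL i).le, (div_lt_one (hL i)).2 h2.2⟩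

lemma proj_eq_self {x : E d} (hx : x ∈ P.carrier) : P.proj x = x := by
  cases P with
  | neumann Ω h => rfl
  | periodic L hL => exact ZSpan.fract_eq_self.2 (box_subset_fundamentalDomain L hL hx)

lemma vol_periodic (L : Fin d → ℝ) (hL : ∀ i, 0 < L i) : (periodic L hL).vol
    = volume.restrict (ZSpan.fundamentalDomain (scaledBasis L fun i => (hL i).ne')) :=
  Measure.restrict_congr_set (box_ae_eq_fundamentalDomain L hL)

lemma locallyIntegrableOn_ext {u : E d → ℝ} (hu : Integrable u P.vol) :
    LocallyIntegrableOn (fun x => u (P.proj x)) P.extDom := by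
  cases P with
  | neumann Ω h => exact IntegrableOn.locallyIntegrableOn hu
  | periodic L hL =>
    rw [vol_periodic] at hu
    refine LocallyIntegrable.locallyIntegrableOn ?_ _
    refine locallyIntegrable_of_periodic (b := scaledBasis L fun i => (hL i).ne')
      (fun v x => ?_) ?_
    · simp only [proj]; rw [fract_add_lattice]
    · refine IntegrableOn.congr_fun (f := u) hu (fun x hx => ?_)
        (ZSpan.fundamentalDomain_measurableSet _)
      simp only [proj]; rw [ZSpan.fract_eq_self.2 hx]

lemma periodic_iff_lattice (L : Fin d → ℝ) (hL : ∀ i, 0 < L i) (ψ : E d → ℝ) :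
    (∀ i x, ψ (x + L i • basisVec i) = ψ x) ↔
      ∀ (v : lattice (scaledBasis L fun i => (hL i).ne')) x, ψ (v + x) = ψ x := by
  constructor
  · intro h
    rintro ⟨v, hv⟩
    induction hv using Submodule.span_induction with
    | mem v hv =>
      obtain ⟨i, rfl⟩ := hv
      intro x
      simp only [scaledBasis_apply]
      rw [add_comm, h]
    | zero => simp
    | add v w _ _ h1 h2 =>
      intro x
      simp only at h1 h2 ⊢
      rw [add_assoc, h1, h2]
    | smul k v _ h1 =>
      simp only at h1 ⊢
      induction k using Int.induction_on with
      | zero => simp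
      | succ k ih =>
        intro x
        rw [add_smul, one_smul, add_assoc, ih, h1]
      | pred k ih =>
        intro x
        have := h1 ((-(k : ℤ) - 1) • v + x)
        rw [← this, ← ih x]
        congr 1
        rw [sub_smul, one_smul]; abel
  · intro h i x
    have := h ⟨L i • basisVec i, Submodule.subset_span ⟨i, scaledBasis_apply _ _ i⟩⟩ x
    rw [add_comm]
    exact this

/-- Weak differentiability on the domain, expressed through extensions. -/
theorem forall_isTest_iff_hasWeakDir {i : Fin d} {u w : E d → ℝ} (hu : Integrable u P.vol)
    (hw : Integrable w P.vol) :
    (∀ ψ, P.IsTest ψ → ∫ x, u x * fderiv ℝ ψ x (basisVec i) ∂P.vol = - ∫ x, w x * ψ x ∂P.vol) ↔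
      HasWeakDir P.extDom (basisVec i) (fun x => u (P.proj x)) (fun x => w (P.proj x)) := by
  cases P with
  | neumann Ω h =>
    refine forall_congr' fun ψ => forall_congr' fun hψ => ?_
    have h1 : ∀ x, x ∉ Ω → w x * ψ x = 0 := fun x hx => by
      rw [image_eq_zero_of_notMem_tsupport fun hc => hx (hψ.2.2 hc), mul_zero]
    have h2 : ∀ x, x ∉ Ω → u x * fderiv ℝ ψ x (basisVec i) = 0 := fun x hx => by
      have : fderiv ℝ ψ x = 0 := image_eq_zero_of_notMem_tsupport fun hc =>
        hx (hψ.2.2 (tsupport_fderiv_subset ℝ hc))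
      rw [this]; simp
    simp only [vol, carrier, proj, id]
    rw [setIntegral_eq_integral_of_forall_compl_eq_zero h1,
      setIntegral_eq_integral_of_forall_compl_eq_zero h2]
  | periodic L hL =>
    rw [vol_periodic] at hu hw ⊢
    rw [extDom, proj, ← forall_periodic_iff_hasWeakDir hu hw]
    simp only [IsTest, periodic_iff_lattice L hL, and_imp]

variable {P}

lemma integrable_of_memLp {u : E d → ℝ} (hu : MemLp u 2 P.vol) : Integrable u P.vol :=
  hu.integrable (by norm_num)

lemma hasWeakPartial_iff {i : Fin d} {u v : E d → ℝ} (hu : MemLp u 2 P.vol) :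
    P.HasWeakPartial i u v ↔ MemLp v 2 P.vol ∧
      HasWeakDir P.extDom (basisVec i) (fun x => u (P.proj x)) (fun x => v (P.proj x)) := by
  refine and_congr_right fun hv => ?_
  exact P.forall_isTest_iff_hasWeakDir (integrable_of_memLp hu) (integrable_of_memLp hv)

lemma HasWeakPartial.hasWeakDir {i : Fin d} {u v : E d → ℝ} (h : P.HasWeakPartial i u v)
    (hu : MemLp u 2 P.vol) : HasWeakDir P.carrier (basisVec i) (P.carrier.indicator u)
      (P.carrier.indicator v) := by
  intro η hη
  have key := ((hasWeakPartial_iff hu).1 h).2 η (hη.mono P.carrier_subset_extDom)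
  convert! key using 2
  · ext x
    by_cases hx : x ∈ P.carrier
    · simp only [Set.indicator_of_mem hx, P.proj_eq_self hx]
    · have : fderiv ℝ η x = 0 := image_eq_zero_of_notMem_tsupport fun hc =>
        hx (hη.2.2 (tsupport_fderiv_subset ℝ hc))
      rw [this]; simp
  · congr 1
    ext x
    by_cases hx : x ∈ P.carrier
    · simp only [Set.indicator_of_mem hx, P.proj_eq_self hx]
    · rw [image_eq_zero_of_notMem_tsupport fun hc => hx (hη.2.2 hc)]; simp

lemma integrable_indicator_carrier {u : E d → ℝ} (hu : Integrable u P.vol) :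
    Integrable (P.carrier.indicator u) :=
  (integrable_indicator_iff P.isOpen_carrier.measurableSet).2 hu

lemma HasWeakPartial.ae_eq {i : Fin d} {u v v' : E d → ℝ} (hu : MemLp u 2 P.vol)
    (h : P.HasWeakPartial i u v) (h' : P.HasWeakPartial i u v') : v =ᵐ[P.vol] v' := by
  have hi := integrable_indicator_carrier (integrable_of_memLp h.1)
  have hi' := integrable_indicator_carrier (integrable_of_memLp h'.1)
  have key := P.isOpen_carrier.ae_eq_zero_of_integral_contDiff_smul_eq_zero
    (f := fun x => P.carrier.indicator v x - P.carrier.indicator v' x)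
    ((hi.sub hi').locallyIntegrable.locallyIntegrableOn P.carrier) (fun η h1 h2 h3 => by
      have hη : IsBump P.carrier η := ⟨h1, h2, h3⟩
      have e1 := h.hasWeakDir hu η hη
      have e2 := h'.hasWeakDir hu η hη
      rw [e1, neg_inj] at e2
      obtain ⟨C, hC⟩ := hη.exists_bound
      have i1 : Integrable (fun x => P.carrier.indicator v x * η x) :=
        hi.mul_bdd h1.continuous.aestronglyMeasurable (.of_forall hC)
      have i2 : Integrable (fun x => P.carrier.indicator v' x * η x) :=
        hi'.mul_bdd h1.continuous.aestronglyMeasurable (.of_forall hC)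
      have e3 : ∀ x, η x • (P.carrier.indicator v x - P.carrier.indicator v' x)
          = P.carrier.indicator v x * η x - P.carrier.indicator v' x * η x := fun x => by
        rw [smul_eq_mul]; ring
      simp_rw [e3]
      rw [integral_sub i1 i2, e2, sub_self])
  rw [EventuallyEq, vol, ae_restrict_iff' P.isOpen_carrier.measurableSet]
  filter_upwards [key] with x hx hxc
  have := hx hxc
  rw [Set.indicator_of_mem hxc, Set.indicator_of_mem hxc] at this
  exact sub_eq_zero.1 this

/-- Continuous functions are bounded on the domain. -/
lemma exists_ae_bound_of_continuous {ζ : E d → ℝ} (hζ : Continuous ζ) :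
    ∃ C, ∀ᵐ x ∂P.vol, ‖ζ x‖ ≤ C := by
  obtain ⟨C, hC⟩ := P.isBounded_carrier.isCompact_closure.exists_bound_of_continuousOn
    hζ.continuousOn
  refine ⟨C, ?_⟩
  rw [vol, ae_restrict_iff' P.isOpen_carrier.measurableSet]
  exact .of_forall fun x hx => hC x (subset_closure hx)

lemma integrable_mul_continuous {u ζ : E d → ℝ} (hu : Integrable u P.vol) (hζ : Continuous ζ) :
    Integrable (fun x => u x * ζ x) P.vol := by
  obtain ⟨C, hC⟩ := exists_ae_bound_of_continuous (P := P) hζ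
  exact hu.mul_bdd hζ.aestronglyMeasurable hC

lemma IsTest.continuous_fderiv {ψ : E d → ℝ} (h : P.IsTest ψ) (y : E d) :
    Continuous fun x => fderiv ℝ ψ x y :=
  (h.contDiff.continuous_fderiv (by simp)).clm_apply continuous_const

lemma HasWeakPartial.linear {i : Fin d} {u u' v v' : E d → ℝ} (hu : MemLp u 2 P.vol)
    (hu' : MemLp u' 2 P.vol) (h : P.HasWeakPartial i u v) (h' : P.HasWeakPartial i u' v')
    (a c : ℝ) :
    P.HasWeakPartial i (fun x => a * u x + c * u' x) (fun x => a * v x + c * v' x) := by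
  refine ⟨(h.1.const_mul a).add (h'.1.const_mul c), fun ψ hψ => ?_⟩
  have hc := hψ.contDiff.continuous
  have hc' := hψ.continuous_fderiv (basisVec i)
  have e : ∀ p q r : ℝ, (a * p + c * q) * r = a * (p * r) + c * (q * r) := fun p q r => by ring
  simp_rw [e]
  rw [integral_add, integral_add, integral_const_mul, integral_const_mul, integral_const_mul,
    integral_const_mul, h.2 ψ hψ, h'.2 ψ hψ]
  · ring
  · exact (integrable_mul_continuous (integrable_of_memLp h.1) hc).const_mul _
  · exact (integrable_mul_continuous (integrable_of_memLp h'.1) hc).const_mul _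
  · exact (integrable_mul_continuous (integrable_of_memLp hu) hc').const_mul _
  · exact (integrable_mul_continuous (integrable_of_memLp hu') hc').const_mul _

lemma HasWeakPartial.congr {i : Fin d} {u u' v v' : E d → ℝ} (h : P.HasWeakPartial i u v)
    (hu : u =ᵐ[P.vol] u') (hv : v =ᵐ[P.vol] v') : P.HasWeakPartial i u' v' := by
  refine ⟨(memLp_congr_ae hv).1 h.1, fun ψ hψ => ?_⟩
  have e1 : ∫ x, u' x * fderiv ℝ ψ x (basisVec i) ∂P.vol
      = ∫ x, u x * fderiv ℝ ψ x (basisVec i) ∂P.vol :=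
    integral_congr_ae (by filter_upwards [hu] with x hx; rw [hx])
  have e2 : ∫ x, v' x * ψ x ∂P.vol = ∫ x, v x * ψ x ∂P.vol :=
    integral_congr_ae (by filter_upwards [hv] with x hx; rw [hx])
  rw [e1, e2, h.2 ψ hψ]

lemma hasWeakPartial_const (i : Fin d) (c : ℝ) :
    P.HasWeakPartial i (fun _ => c) (fun _ => 0) := by
  rw [hasWeakPartial_iff (memLp_const c)]
  refine ⟨by simp, fun η hη => ?_⟩
  have h1 : ∫ x, fderiv ℝ η x (basisVec i) = 0 := by
    have i1 : Integrable (fun x => (1 : ℝ) * fderiv ℝ η x (basisVec i)) := by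
      simpa using (hη.continuous_fderiv_apply (basisVec i)).integrable_of_hasCompactSupport
        (μ := volume) (hη.hasCompactSupport_fderiv_apply (basisVec i))
    have i2 : Integrable (fun x => (1 : ℝ) * η x) := by
      simpa using hη.1.continuous.integrable_of_hasCompactSupport (μ := volume) hη.2.1
    have h2 := integral_mul_fderiv_eq_neg_fderiv_mul_of_integrable (μ := (volume : Measure (E d)))
      (f := fun _ => (1 : ℝ)) (g := η) (v := basisVec i) (by simp) i1 i2 (by fun_prop)
      (fun x _ => hη.1.differentiable (by simp) x)
    simpa using h2
  simp only [integral_const_mul, h1, zero_mul, mul_zero, integral_zero, neg_zero]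

lemma MemH1.hasWeakPartial {u : E d → ℝ} (h : P.MemH1 u) (i : Fin d) :
    P.HasWeakPartial i u (P.weakPartial i u) := by
  have := h.2 i
  rw [weakPartial, dif_pos this]
  exact this.choose_spec

lemma MemH1.memLp_weakPartial {u : E d → ℝ} (h : P.MemH1 u) (i : Fin d) :
    MemLp (P.weakPartial i u) 2 P.vol := (h.hasWeakPartial i).1

lemma HasWeakPartial.weakPartial_ae_eq {i : Fin d} {u v : E d → ℝ} (h : P.HasWeakPartial i u v)
    (hu : MemLp u 2 P.vol) : P.weakPartial i u =ᵐ[P.vol] v := by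
  have h1 : ∃ v, P.HasWeakPartial i u v := ⟨v, h⟩
  rw [weakPartial, dif_pos h1]
  exact h1.choose_spec.ae_eq hu h

lemma MemH1.linear {u u' : E d → ℝ} (h : P.MemH1 u) (h' : P.MemH1 u') (a c : ℝ) :
    P.MemH1 (fun x => a * u x + c * u' x) :=
  ⟨(h.1.const_mul a).add (h'.1.const_mul c), fun i =>
    ⟨_, (h.hasWeakPartial i).linear h.1 h'.1 (h'.hasWeakPartial i) a c⟩⟩

lemma weakPartial_linear {u u' : E d → ℝ} (h : P.MemH1 u) (h' : P.MemH1 u') (a c : ℝ)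
    (i : Fin d) : P.weakPartial i (fun x => a * u x + c * u' x)
      =ᵐ[P.vol] fun x => a * P.weakPartial i u x + c * P.weakPartial i u' x :=
  ((h.hasWeakPartial i).linear h.1 h'.1 (h'.hasWeakPartial i) a c).weakPartial_ae_eq
    (h.linear h' a c).1

lemma HasLaplacian.linear {u u' w w' : E d → ℝ} (h : P.HasLaplacian u w)
    (h' : P.HasLaplacian u' w') (a c : ℝ) :
    P.HasLaplacian (fun x => a * u x + c * u' x) (fun x => a * w x + c * w' x) := by
  refine ⟨h.1.linear h'.1 a c, (h.2.1.const_mul a).add (h'.2.1.const_mul c), fun ψ hψ => ?_⟩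
  have e1 : ∀ i, ∫ x, P.weakPartial i (fun x => a * u x + c * u' x) x * P.weakPartial i ψ x ∂P.vol
      = a * ∫ x, P.weakPartial i u x * P.weakPartial i ψ x ∂P.vol
        + c * ∫ x, P.weakPartial i u' x * P.weakPartial i ψ x ∂P.vol := by
    intro i
    have hi : Integrable (fun x => P.weakPartial i u x * P.weakPartial i ψ x) P.vol :=
      (h.1.memLp_weakPartial i).integrable_mul (hψ.memLp_weakPartial i)
    have hi' : Integrable (fun x => P.weakPartial i u' x * P.weakPartial i ψ x) P.vol :=
      (h'.1.memLp_weakPartial i).integrable_mul (hψ.memLp_weakPartial i)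
    rw [← integral_const_mul, ← integral_const_mul,
      ← integral_add (hi.const_mul a) (hi'.const_mul c)]
    refine integral_congr_ae ?_
    filter_upwards [weakPartial_linear h.1 h'.1 a c i] with x hx
    rw [hx]; ring
  simp_rw [e1]
  rw [Finset.sum_add_distrib, ← Finset.mul_sum, ← Finset.mul_sum, h.2.2 ψ hψ, h'.2.2 ψ hψ]
  have hi : Integrable (fun x => w x * ψ x) P.vol := h.2.1.integrable_mul hψ.1
  have hi' : Integrable (fun x => w' x * ψ x) P.vol := h'.2.1.integrable_mul hψ.1
  have e2 : ∫ x, (a * w x + c * w' x) * ψ x ∂P.vol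
      = a * ∫ x, w x * ψ x ∂P.vol + c * ∫ x, w' x * ψ x ∂P.vol := by
    rw [← integral_const_mul, ← integral_const_mul,
      ← integral_add (hi.const_mul a) (hi'.const_mul c)]
    congr 1; ext x; ring
  rw [e2]; ring

lemma hasLaplacian_laplacian {u : E d → ℝ} (h : ∃ w, P.HasLaplacian u w) :
    P.HasLaplacian u (P.laplacian u) := by
  rw [laplacian, dif_pos h]
  exact h.choose_spec

lemma memLp_comp {u : E d → ℝ} (hu : MemLp u 2 P.vol) {f : ℝ → ℝ} (hf : ContDiff ℝ 1 f)
    {s : Set ℝ} (hs : Convex ℝ s) (h0 : (0 : ℝ) ∈ s) (hus : ∀ x, u x ∈ s) {K : ℝ}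
    (hK : ∀ t ∈ s, |deriv f t| ≤ K) : MemLp (fun x => f (u x)) 2 P.vol := by
  have hK0 : 0 ≤ K := (abs_nonneg _).trans (hK 0 h0)
  refine ((memLp_const |f 0|).add (hu.norm.const_mul K)).mono
    (hf.continuous.comp_aestronglyMeasurable hu.1) (.of_forall fun x => ?_)
  have h1 := abs_comp_sub_le hf hs hK h0 (hus x)
  have h2 : |f (u x)| ≤ |f 0| + |f (u x) - f 0| := by
    have := abs_add_le (f 0) (f (u x) - f 0); simpa using this
  rw [sub_zero] at h1
  simp only [Pi.add_apply, Real.norm_eq_abs]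
  rw [abs_of_nonneg (by positivity : 0 ≤ |f 0| + K * |u x|)]
  linarith

/-- The chain rule for weak partial derivatives on the domain. -/
theorem HasWeakPartial.comp {i : Fin d} {u v : E d → ℝ} (h : P.HasWeakPartial i u v)
    (hu : MemLp u 2 P.vol) {f : ℝ → ℝ} (hf : ContDiff ℝ 1 f) {s : Set ℝ} (hs : Convex ℝ s)
    (h0 : (0 : ℝ) ∈ s) (hus : ∀ x, u x ∈ s) {K : ℝ} (hK : ∀ t ∈ s, |deriv f t| ≤ K) :
    P.HasWeakPartial i (fun x => f (u x)) (fun x => deriv f (u x) * v x) := by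
  rw [hasWeakPartial_iff (memLp_comp hu hf hs h0 hus hK)]
  have h1 := (hasWeakPartial_iff hu).1 h
  refine ⟨?_, ?_⟩
  · refine (h.1.const_mul K).mono
      (((hf.continuous_deriv le_rfl).comp_aestronglyMeasurable hu.1).mul h.1.1)
      (.of_forall fun x => ?_)
    have hK0 : 0 ≤ K := (abs_nonneg _).trans (hK 0 h0)
    rw [norm_mul, norm_mul, Real.norm_of_nonneg hK0]
    gcongr
    exact hK _ (hus x)
  · exact h1.2.comp_of_locallyIntegrableOn P.isOpen_extDom
      (P.locallyIntegrableOn_ext (integrable_of_memLp hu))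
      (P.locallyIntegrableOn_ext (integrable_of_memLp h.1)) hf hs h0 (fun x => hus _) hK

end Domain

end VBDF2

namespace VBDF2

variable {d : ℕ}

open Filter Topology
open scoped ENNReal

/-- The Cauchy–Schwarz inequality for integrals. -/
lemma integral_abs_mul_le {α : Type*} [MeasurableSpace α] {μ : Measure α} {f g : α → ℝ}
    (hf : MemLp f 2 μ) (hg : MemLp g 2 μ) :
    ∫ x, |f x| * |g x| ∂μ ≤ √(∫ x, f x ^ 2 ∂μ) * √(∫ x, g x ^ 2 ∂μ) := by
  have h := integral_mul_norm_le_Lp_mul_Lq (μ := μ) (p := 2) (q := 2) (f := f) (g := g)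
    Real.HolderConjugate.two_two (by simpa using hf) (by simpa using hg)
  simp only [Real.norm_eq_abs, Real.rpow_two, sq_abs] at h
  rw [Real.sqrt_eq_rpow, Real.sqrt_eq_rpow]
  exact h

namespace Domain

variable (P : Domain d)

/-- The `W^{1,1}` norm. -/
def normW11 (u : E d → ℝ) : ℝ := ∫ x, |u x| ∂P.vol + ∑ i, ∫ x, |P.weakPartial i u x| ∂P.vol

variable {P}

lemma normSq_nonneg (u : E d → ℝ) : 0 ≤ P.normSq u := integral_nonneg fun _ => sq_nonneg _

lemma gradNormSq_nonneg (u : E d → ℝ) : 0 ≤ P.gradNormSq u :=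
  Finset.sum_nonneg fun _ _ => normSq_nonneg _

lemma normH1_nonneg (u : E d → ℝ) : 0 ≤ P.normH1 u := Real.sqrt_nonneg _

lemma sq_normH1 (u : E d → ℝ) : P.normH1 u ^ 2 = P.normSq u + P.gradNormSq u :=
  Real.sq_sqrt (add_nonneg (normSq_nonneg _) (gradNormSq_nonneg _))

lemma sqrt_normSq_le (u : E d → ℝ) : √(P.normSq u) ≤ P.normH1 u :=
  Real.sqrt_le_sqrt (le_add_of_nonneg_right (gradNormSq_nonneg _))

lemma sqrt_normSq_weakPartial_le (u : E d → ℝ) (i : Fin d) :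
    √(P.normSq (P.weakPartial i u)) ≤ P.normH1 u := by
  refine Real.sqrt_le_sqrt ?_
  have : P.normSq (P.weakPartial i u) ≤ P.gradNormSq u :=
    Finset.single_le_sum (f := fun i => P.normSq (P.weakPartial i u))
      (fun _ _ => normSq_nonneg _) (Finset.mem_univ i)
  linarith [normSq_nonneg (P := P) u]

lemma MemH1.measurable_rep {u : E d → ℝ} (hu : P.MemH1 u) :
    ∃ (u' : E d → ℝ) (w : Fin d → E d → ℝ), Measurable u' ∧ (∀ i, Measurable (w i)) ∧
      Integrable u' ∧ (∀ i, Integrable (w i)) ∧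
      (∀ i, HasWeakDir P.carrier (basisVec i) u' (w i)) ∧ u' =ᵐ[P.vol] u ∧
      ∫⁻ x, mass u' w x = ENNReal.ofReal (P.normW11 u) := by
  have hm := P.isOpen_carrier.measurableSet
  have hU := integrable_indicator_carrier (integrable_of_memLp hu.1)
  have hW := fun i => integrable_indicator_carrier (integrable_of_memLp (hu.memLp_weakPartial i))
  have aU := hU.1.ae_eq_mk
  have aW := fun i => (hW i).1.ae_eq_mk
  have key : ∀ v : E d → ℝ, MemLp v 2 P.vol →
      ∫⁻ x, ‖P.carrier.indicator v x‖ₑ = ENNReal.ofReal (∫ x, |v x| ∂P.vol) := by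
    intro v hv
    have h1 := ofReal_integral_norm_eq_lintegral_enorm (integrable_of_memLp hv)
    simp only [Real.norm_eq_abs] at h1
    rw [h1, vol, ← lintegral_indicator hm]
    refine lintegral_congr fun x => ?_
    by_cases hx : x ∈ P.carrier <;> simp [hx]
  refine ⟨hU.1.mk _, fun i => (hW i).1.mk _, hU.1.stronglyMeasurable_mk.measurable,
    fun i => (hW i).1.stronglyMeasurable_mk.measurable, hU.congr aU, fun i => (hW i).congr (aW i),
    fun i => ((hu.hasWeakPartial i).hasWeakDir hu.1).congr_ae aU (aW i), ?_, ?_⟩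
  · rw [EventuallyEq, vol, ae_restrict_iff' hm]
    filter_upwards [aU] with x hx hxc
    rw [← hx, Set.indicator_of_mem hxc]
  · rw [lintegral_mass fun i => (hW i).1.stronglyMeasurable_mk.measurable, normW11,
      ENNReal.ofReal_add (integral_nonneg fun _ => abs_nonneg _)
        (Finset.sum_nonneg fun _ _ => integral_nonneg fun _ => abs_nonneg _),
      ENNReal.ofReal_sum_of_nonneg fun _ _ => integral_nonneg fun _ => abs_nonneg _]
    rw [← key u hu.1]
    congr 1
    · refine lintegral_congr_ae ?_
      filter_upwards [aU] with x hx
      rw [← hx]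
    · refine Finset.sum_congr rfl fun i _ => ?_
      rw [← key _ (hu.memLp_weakPartial i)]
      refine lintegral_congr_ae ?_
      filter_upwards [aW i] with x hx
      rw [← hx]

/-- The Gagliardo inequality on the domain. -/
theorem exists_lintegral_rpow_le_normW11 {q : ℝ} (hq : Real.HolderConjugate (d : ℝ) q)
    (P : Domain d) : ∃ C : ℝ≥0∞, C ≠ ⊤ ∧ ∀ u, P.MemH1 u →
      ∫⁻ x, ‖u x‖ₑ ^ q ∂P.vol ≤ C * ENNReal.ofReal (P.normW11 u) ^ q := by
  obtain ⟨C, hC, h⟩ := exists_lintegral_rpow_le hq P.isOpen_carrier P.isBounded_carrier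
    P.hasInteriorCones
  refine ⟨C, hC, fun u hu => ?_⟩
  obtain ⟨u', w, a1, a2, a3, a4, a5, a6, a7⟩ := hu.measurable_rep
  have := h u' w a1 a2 a3 a4 a5
  rw [a7] at this
  refine le_trans (le_of_eq ?_) this
  refine lintegral_congr_ae ?_
  filter_upwards [a6] with x hx
  rw [hx]

lemma normW11_nonneg (u : E d → ℝ) : 0 ≤ P.normW11 u :=
  add_nonneg (integral_nonneg fun _ => abs_nonneg _)
    (Finset.sum_nonneg fun _ _ => integral_nonneg fun _ => abs_nonneg _)

lemma memLp_of_bounded {v : E d → ℝ} (hv : AEStronglyMeasurable v P.vol) {B : ℝ}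
    (hB : ∀ x, |v x| ≤ B) : MemLp v 2 P.vol :=
  MemLp.of_bound hv B (.of_forall hB)

lemma MemH1.hasWeakPartial_pow {v : E d → ℝ} (hv : P.MemH1 v) {B : ℝ} (hB : ∀ x, |v x| ≤ B)
    (m : ℕ) (i : Fin d) : P.HasWeakPartial i (fun x => v x ^ m)
      (fun x => (m * v x ^ (m - 1)) * P.weakPartial i v x) := by
  have hB0 : 0 ≤ B := (abs_nonneg _).trans (hB 0)
  have h := (hv.hasWeakPartial i).comp hv.1 (f := fun s => s ^ m) (by fun_prop)
    (s := Set.Icc (-B) B) (convex_Icc _ _) ⟨by linarith, hB0⟩ (fun x => abs_le.1 (hB x))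
    (K := m * B ^ (m - 1)) (fun t ht => by
      simp only [deriv_pow_field]
      rw [abs_mul, abs_pow, Nat.abs_cast]
      gcongr
      exact abs_le.2 ht)
  simpa only [deriv_pow_field] using h

lemma memLp_pow {v : E d → ℝ} (hv : AEStronglyMeasurable v P.vol) {B : ℝ}
    (hB : ∀ x, |v x| ≤ B) (m : ℕ) : MemLp (fun x => v x ^ m) 2 P.vol :=
  memLp_of_bounded (B := B ^ m) (hv.pow m) fun x => by
    rw [abs_pow]; exact pow_le_pow_left₀ (abs_nonneg _) (hB x) m

lemma MemH1.pow {v : E d → ℝ} (hv : P.MemH1 v) {B : ℝ} (hB : ∀ x, |v x| ≤ B) (m : ℕ) :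
    P.MemH1 (fun x => v x ^ m) :=
  ⟨memLp_pow hv.1.1 hB m, fun i => ⟨_, hv.hasWeakPartial_pow hB m i⟩⟩

/-- The `W^{1,1}` norm of a power. -/
lemma MemH1.normW11_pow_le {v : E d → ℝ} (hv : P.MemH1 v) {B : ℝ} (hB : ∀ x, |v x| ≤ B)
    (m : ℕ) : P.normW11 (fun x => v x ^ (m + 1))
      ≤ √(∫ x, v x ^ (2 * m) ∂P.vol) * ((1 + d * (m + 1)) * P.normH1 v) := by
  have hm := memLp_pow hv.1.1 hB m
  have e0 : ∫ x, (v x ^ m) ^ 2 ∂P.vol = ∫ x, v x ^ (2 * m) ∂P.vol := by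
    simp_rw [← pow_mul, mul_comm]
  have h1 : ∫ x, |v x ^ (m + 1)| ∂P.vol ≤ √(∫ x, v x ^ (2 * m) ∂P.vol) * P.normH1 v := by
    have := integral_abs_mul_le hm hv.1
    simp_rw [pow_succ, abs_mul]
    rw [e0] at this
    exact this.trans (mul_le_mul_of_nonneg_left (sqrt_normSq_le v) (Real.sqrt_nonneg _))
  have h2 : ∀ i, ∫ x, |P.weakPartial i (fun x => v x ^ (m + 1)) x| ∂P.vol
      ≤ (m + 1) * (√(∫ x, v x ^ (2 * m) ∂P.vol) * P.normH1 v) := by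
    intro i
    have hp := (hv.hasWeakPartial_pow hB (m + 1) i).weakPartial_ae_eq
      (memLp_pow hv.1.1 hB (m + 1))
    have e1 : ∫ x, |P.weakPartial i (fun x => v x ^ (m + 1)) x| ∂P.vol
        = (m + 1) * ∫ x, |v x ^ m| * |P.weakPartial i v x| ∂P.vol := by
      rw [← integral_const_mul]
      refine integral_congr_ae ?_
      filter_upwards [hp] with x hx
      rw [hx, abs_mul, abs_mul, Nat.abs_cast]
      push_cast
      ring
    rw [e1]
    have := integral_abs_mul_le hm (hv.memLp_weakPartial i)
    rw [e0] at this
    gcongr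
    exact this.trans
      (mul_le_mul_of_nonneg_left (sqrt_normSq_weakPartial_le v i) (Real.sqrt_nonneg _))
  calc P.normW11 (fun x => v x ^ (m + 1))
      ≤ √(∫ x, v x ^ (2 * m) ∂P.vol) * P.normH1 v
        + ∑ _i : Fin d, (m + 1) * (√(∫ x, v x ^ (2 * m) ∂P.vol) * P.normH1 v) :=
        add_le_add h1 (Finset.sum_le_sum fun i _ => h2 i)
    _ = _ := by
      rw [Finset.sum_const, Finset.card_univ, Fintype.card_fin, nsmul_eq_mul]; ring

lemma integrable_pow {v : E d → ℝ} (hv : AEStronglyMeasurable v P.vol) {B : ℝ}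
    (hB : ∀ x, |v x| ≤ B) (m : ℕ) : Integrable (fun x => v x ^ m) P.vol :=
  integrable_of_memLp (memLp_pow hv hB m)

/-- The embedding of `H¹` into `L^{2m}` in dimension two. -/
theorem exists_integral_pow_le_two (P : Domain 2) (m : ℕ) : ∃ C : ℝ, 0 ≤ C ∧ ∀ v, P.MemH1 v →
    (∃ B, ∀ x, |v x| ≤ B) → ∫ x, v x ^ (2 * m) ∂P.vol ≤ C * P.normH1 v ^ (2 * m) := by
  have hq : Real.HolderConjugate ((2 : ℕ) : ℝ) 2 := by
    simpa using Real.HolderConjugate.two_two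
  obtain ⟨C, hCt, hC⟩ := exists_lintegral_rpow_le_normW11 hq P
  induction m with
  | zero =>
    refine ⟨P.vol.real Set.univ, measureReal_nonneg, fun v _ _ => by simp⟩
  | succ m ih =>
    obtain ⟨Cm, hCm0, hCm⟩ := ih
    refine ⟨C.toReal * (Cm * (1 + 2 * (m + 1)) ^ 2), by positivity, fun v hv ⟨B, hB⟩ => ?_⟩
    have h1 := hC _ (hv.pow hB (m + 1))
    have h2 := hv.normW11_pow_le hB m
    have h3 := hCm v hv ⟨B, hB⟩
    have e1 : ∫⁻ x, ‖v x ^ (m + 1)‖ₑ ^ (2 : ℝ) ∂P.vol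
        = ENNReal.ofReal (∫ x, v x ^ (2 * (m + 1)) ∂P.vol) := by
      rw [ofReal_integral_eq_lintegral_ofReal (integrable_pow hv.1.1 hB _)
        (.of_forall fun x => by simp only [pow_mul, Pi.zero_apply]; positivity)]
      refine lintegral_congr fun x => ?_
      rw [ENNReal.rpow_two, ← ofReal_norm, ← ENNReal.ofReal_pow (norm_nonneg _),
        Real.norm_eq_abs, sq_abs, ← pow_mul, mul_comm]
    rw [e1, ENNReal.rpow_two, ← ENNReal.ofReal_pow (normW11_nonneg _),
      ← ENNReal.ofReal_toReal hCt, ← ENNReal.ofReal_mul ENNReal.toReal_nonneg,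
      ENNReal.ofReal_le_ofReal_iff (by positivity)] at h1
    have hI0 : 0 ≤ ∫ x, v x ^ (2 * m) ∂P.vol :=
      integral_nonneg fun x => by rw [pow_mul]; positivity
    have h4 : P.normW11 (fun x => v x ^ (m + 1)) ^ 2
        ≤ (∫ x, v x ^ (2 * m) ∂P.vol) * ((1 + 2 * (m + 1)) * P.normH1 v) ^ 2 := by
      calc _ ≤ (√(∫ x, v x ^ (2 * m) ∂P.vol) * ((1 + (2 : ℕ) * (m + 1)) * P.normH1 v)) ^ 2 :=
            pow_le_pow_left₀ (normW11_nonneg _) h2 2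
        _ = _ := by rw [mul_pow, Real.sq_sqrt hI0]; norm_num
    calc ∫ x, v x ^ (2 * (m + 1)) ∂P.vol ≤ C.toReal * P.normW11 (fun x => v x ^ (m + 1)) ^ 2 := h1
      _ ≤ C.toReal * ((Cm * P.normH1 v ^ (2 * m)) * ((1 + 2 * (m + 1)) * P.normH1 v) ^ 2) := by
          gcongr
          exact h4.trans (by gcongr)
      _ = _ := by ring

/-- The embedding of `H¹` into `L⁶` in dimension three. -/
theorem exists_integral_pow_six_le (P : Domain 3) : ∃ C : ℝ, 0 ≤ C ∧ ∀ v, P.MemH1 v →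
    (∃ B, ∀ x, |v x| ≤ B) → ∫ x, v x ^ 6 ∂P.vol ≤ C * P.normH1 v ^ 6 := by
  have hq : Real.HolderConjugate ((3 : ℕ) : ℝ) (3 / 2) := by
    rw [Real.holderConjugate_iff]; norm_num
  obtain ⟨C, hCt, hC⟩ := exists_lintegral_rpow_le_normW11 hq P
  refine ⟨(C.toReal ^ 2 * 13 ^ 3) ^ 2, by positivity, fun v hv ⟨B, hB⟩ => ?_⟩
  have h1 := hC _ (hv.pow hB 4)
  have h2 := hv.normW11_pow_le hB 3
  norm_num at h2
  set I := ∫ x, v x ^ 6 ∂P.vol with hI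
  set n := P.normH1 v with hn
  have hn0 : 0 ≤ n := normH1_nonneg v
  have hI0 : 0 ≤ I := integral_nonneg fun x => by positivity
  have e1 : ∫⁻ x, ‖v x ^ 4‖ₑ ^ (3 / 2 : ℝ) ∂P.vol = ENNReal.ofReal I := by
    rw [hI, ofReal_integral_eq_lintegral_ofReal (integrable_pow hv.1.1 hB _)
      (.of_forall fun x => by positivity)]
    refine lintegral_congr fun x => ?_
    rw [← ofReal_norm, ENNReal.ofReal_rpow_of_nonneg (norm_nonneg _) (by norm_num)]
    congr 1
    have : ‖v x ^ 4‖ = |v x| ^ (4 : ℝ) := by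
      rw [norm_pow, Real.norm_eq_abs]; norm_cast
    rw [this, ← Real.rpow_mul (abs_nonneg _)]
    norm_num
    have h6 := (show Even 6 by decide).pow_abs (v x)
    rw [← h6]
  rw [e1, ENNReal.ofReal_rpow_of_nonneg (normW11_nonneg _) (by norm_num),
    ← ENNReal.ofReal_toReal hCt, ← ENNReal.ofReal_mul ENNReal.toReal_nonneg,
    ENNReal.ofReal_le_ofReal_iff (by
      have := normW11_nonneg (P := P) (fun x => v x ^ 4)
      positivity)] at h1
  set N := P.normW11 (fun x => v x ^ 4) with hN
  have hN0 : 0 ≤ N := normW11_nonneg _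
  have h3 : I ^ 2 ≤ C.toReal ^ 2 * N ^ 3 := by
    calc I ^ 2 ≤ (C.toReal * N ^ (3 / 2 : ℝ)) ^ 2 := pow_le_pow_left₀ hI0 h1 2
      _ = C.toReal ^ 2 * N ^ 3 := by
        rw [mul_pow, ← Real.rpow_natCast (N ^ (3 / 2 : ℝ)), ← Real.rpow_mul hN0]
        norm_num
  have h4 : N ^ 3 ≤ (√I * (13 * n)) ^ 3 := pow_le_pow_left₀ hN0 h2 3
  have hs : √I ^ 2 = I := Real.sq_sqrt hI0
  have h5 : √I ^ 4 ≤ √I ^ 3 * (C.toReal ^ 2 * 13 ^ 3 * n ^ 3) := by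
    calc √I ^ 4 = (√I ^ 2) ^ 2 := by ring
      _ = I ^ 2 := by rw [hs]
      _ ≤ C.toReal ^ 2 * (√I * (13 * n)) ^ 3 := h3.trans (by gcongr)
      _ = _ := by ring
  have h6 : √I ≤ C.toReal ^ 2 * 13 ^ 3 * n ^ 3 := by
    rcases (Real.sqrt_nonneg I).eq_or_lt with h0 | h0
    · rw [← h0]; positivity
    · have h7 : √I ^ 3 * √I ≤ √I ^ 3 * (C.toReal ^ 2 * 13 ^ 3 * n ^ 3) := by
        rw [← pow_succ]; exact h5
      exact le_of_mul_le_mul_left h7 (by positivity)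
  calc I = √I ^ 2 := hs.symm
    _ ≤ (C.toReal ^ 2 * 13 ^ 3 * n ^ 3) ^ 2 := pow_le_pow_left₀ (Real.sqrt_nonneg _) h6 2
    _ = _ := by ring

/-- The embedding of `H¹` into bounded functions in dimension one. -/
theorem exists_abs_le_one (P : Domain 1) : ∃ C : ℝ, 0 ≤ C ∧ ∀ v, P.MemH1 v →
    ∀ᵐ x ∂P.vol, |v x| ≤ C * P.normH1 v := by
  obtain ⟨C, hCt, h⟩ := exists_enorm_le P.isOpen_carrier P.isBounded_carrier P.hasInteriorCones
  refine ⟨C.toReal * (2 * √(P.vol.real Set.univ)), by positivity, fun v hv => ?_⟩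
  obtain ⟨u', w, a1, a2, a3, a4, a5, a6, a7⟩ := hv.measurable_rep
  have h1 := h u' w a1 a2 a3 a4 a5
  rw [a7] at h1
  have hl : ∀ f : E 1 → ℝ, MemLp f 2 P.vol →
      ∫ x, |f x| ∂P.vol ≤ √(P.normSq f) * √(P.vol.real Set.univ) := by
    intro f hf
    have := integral_abs_mul_le hf (memLp_const (1 : ℝ))
    simpa [normSq] using this
  have h2 : P.normW11 v ≤ 2 * √(P.vol.real Set.univ) * P.normH1 v := by
    have b1 := (hl v hv.1).trans
      (mul_le_mul_of_nonneg_right (sqrt_normSq_le v) (Real.sqrt_nonneg _))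
    have b2 := (hl _ (hv.memLp_weakPartial 0)).trans
      (mul_le_mul_of_nonneg_right (sqrt_normSq_weakPartial_le v 0) (Real.sqrt_nonneg _))
    rw [normW11, Fin.sum_univ_one]
    linarith
  have h3 : ∀ᵐ x ∂P.vol, ‖u' x‖ₑ ≤ C * ENNReal.ofReal (P.normW11 v) := by
    rw [vol, ae_restrict_iff' P.isOpen_carrier.measurableSet]
    exact h1
  filter_upwards [h3, a6] with x hx hx6
  rw [hx6, ← ofReal_norm, ← ENNReal.ofReal_toReal hCt,
    ← ENNReal.ofReal_mul ENNReal.toReal_nonneg, ENNReal.ofReal_le_ofReal_iff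
      (mul_nonneg ENNReal.toReal_nonneg (normW11_nonneg _))] at hx
  calc |v x| ≤ C.toReal * P.normW11 v := hx
    _ ≤ C.toReal * (2 * √(P.vol.real Set.univ) * P.normH1 v) := by gcongr
    _ = _ := by ring

end Domain

end VBDF2

namespace VBDF2

variable {d : ℕ}

open Filter Topology

/-- A smooth bounded truncation that converges to the identity as `a → 0`. -/
def trunc (a s : ℝ) : ℝ := Real.arctan (a * s) / a

lemma hasDerivAt_trunc {a : ℝ} (ha : 0 < a) (s : ℝ) :
    HasDerivAt (trunc a) (1 / (1 + (a * s) ^ 2)) s := by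
  have h1 : HasDerivAt (fun s : ℝ => a * s) a s := by simpa using (hasDerivAt_id s).const_mul a
  have h2 := (h1.arctan).div_const a
  refine h2.congr_deriv ?_
  field_simp

lemma deriv_trunc {a : ℝ} (ha : 0 < a) (s : ℝ) : deriv (trunc a) s = 1 / (1 + (a * s) ^ 2) :=
  (hasDerivAt_trunc ha s).deriv

lemma deriv_trunc_pos {a : ℝ} (ha : 0 < a) (s : ℝ) : 0 < deriv (trunc a) s := by
  rw [deriv_trunc ha]; positivity

lemma deriv_trunc_le_one {a : ℝ} (ha : 0 < a) (s : ℝ) : deriv (trunc a) s ≤ 1 := by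
  rw [deriv_trunc ha, div_le_one (by positivity)]
  nlinarith [sq_nonneg (a * s)]

lemma contDiff_trunc (a : ℝ) : ContDiff ℝ 1 (trunc a) := by
  unfold trunc
  exact (Real.contDiff_arctan.comp (contDiff_const.mul contDiff_id)).div_const a

lemma abs_trunc_le {a : ℝ} (ha : 0 < a) (s : ℝ) : |trunc a s| ≤ |s| := by
  have h := abs_comp_sub_le (contDiff_trunc a) convex_univ (K := 1) (fun t _ => by
    rw [abs_of_pos (deriv_trunc_pos ha t)]; exact deriv_trunc_le_one ha t)
    (Set.mem_univ 0) (Set.mem_univ s)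
  simpa [trunc] using h

lemma abs_trunc_le_bound {a : ℝ} (ha : 0 < a) (s : ℝ) : |trunc a s| ≤ Real.pi / 2 / a := by
  rw [trunc, abs_div, abs_of_pos ha]
  gcongr
  exact abs_le.2 ⟨(Real.neg_pi_div_two_lt_arctan _).le, (Real.arctan_lt_pi_div_two _).le⟩

lemma tendsto_trunc (s : ℝ) {a : ℕ → ℝ} (ha : ∀ n, 0 < a n) (ha0 : Tendsto a atTop (𝓝 0)) :
    Tendsto (fun n => trunc (a n) s) atTop (𝓝 s) := by
  have h1 : HasDerivAt (fun a : ℝ => Real.arctan (a * s)) s 0 := by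
    have h2 : HasDerivAt (fun a : ℝ => a * s) s 0 := by
      simpa using (hasDerivAt_id (0 : ℝ)).mul_const s
    simpa using h2.arctan
  have h3 := h1.tendsto_slope_zero
  have h4 : Tendsto a atTop (𝓝[≠] 0) :=
    tendsto_nhdsWithin_iff.2 ⟨ha0, .of_forall fun n => (ha n).ne'⟩
  refine (h3.comp h4).congr fun n => ?_
  simp [trunc, div_eq_inv_mul]

lemma tendsto_deriv_trunc (s : ℝ) {a : ℕ → ℝ} (ha : ∀ n, 0 < a n)
    (ha0 : Tendsto a atTop (𝓝 0)) : Tendsto (fun n => deriv (trunc (a n)) s) atTop (𝓝 1) := by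
  have h1 : Continuous fun a : ℝ => 1 / (1 + (a * s) ^ 2) :=
    continuous_const.div (by fun_prop) fun a => by positivity
  have h2 := (h1.tendsto 0).comp ha0
  simp only [zero_mul] at h2
  norm_num at h2
  refine h2.congr fun n => ?_
  simp [deriv_trunc (ha n)]

/-- Fatou's lemma for real-valued functions with bounded integrals. -/
lemma integrable_and_integral_le_of_tendsto {α : Type*} [MeasurableSpace α] {μ : Measure α}
    {F : ℕ → α → ℝ} {f : α → ℝ} {K : ℝ} (hF : ∀ n, Integrable (F n) μ)
    (hF0 : ∀ n x, 0 ≤ F n x) (hlim : ∀ᵐ x ∂μ, Tendsto (fun n => F n x) atTop (𝓝 (f x)))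
    (hK : ∀ n, ∫ x, F n x ∂μ ≤ K) : Integrable f μ ∧ ∫ x, f x ∂μ ≤ K := by
  have hfm : AEStronglyMeasurable f μ := aestronglyMeasurable_of_tendsto_ae atTop
    (fun n => (hF n).1) hlim
  have hf0 : 0 ≤ᵐ[μ] f := by
    filter_upwards [hlim] with x hx
    exact ge_of_tendsto' hx fun n => hF0 n x
  have hK0 : 0 ≤ K := (integral_nonneg (hF0 0)).trans (hK 0)
  have h1 : ∫⁻ x, ENNReal.ofReal (f x) ∂μ ≤ ENNReal.ofReal K := by
    calc ∫⁻ x, ENNReal.ofReal (f x) ∂μ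
        = ∫⁻ x, liminf (fun n => ENNReal.ofReal (F n x)) atTop ∂μ := by
          refine lintegral_congr_ae ?_
          filter_upwards [hlim] with x hx
          exact ((ENNReal.continuous_ofReal.tendsto _).comp hx).liminf_eq.symm
      _ ≤ liminf (fun n => ∫⁻ x, ENNReal.ofReal (F n x) ∂μ) atTop :=
          lintegral_liminf_le' fun n => (hF n).1.aemeasurable.ennreal_ofReal
      _ ≤ liminf (fun _ : ℕ => ENNReal.ofReal K) atTop := by
          refine liminf_le_liminf (.of_forall fun n => ?_)
          rw [← ofReal_integral_eq_lintegral_ofReal (hF n) (.of_forall (hF0 n))]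
          exact ENNReal.ofReal_le_ofReal (hK n)
      _ = ENNReal.ofReal K := by simp
  have hi : Integrable f μ := by
    refine ⟨hfm, ?_⟩
    rw [hasFiniteIntegral_iff_ofReal hf0]
    exact h1.trans_lt ENNReal.ofReal_lt_top
  refine ⟨hi, ?_⟩
  rw [← ofReal_integral_eq_lintegral_ofReal hi hf0] at h1
  exact (ENNReal.ofReal_le_ofReal_iff hK0).1 h1

namespace Domain

variable {P : Domain d}

lemma MemH1.hasWeakPartial_trunc {w : E d → ℝ} (hw : P.MemH1 w) {a : ℝ} (ha : 0 < a)
    (i : Fin d) : P.HasWeakPartial i (fun x => trunc a (w x))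
      (fun x => deriv (trunc a) (w x) * P.weakPartial i w x) :=
  (hw.hasWeakPartial i).comp hw.1 (contDiff_trunc a) convex_univ (Set.mem_univ _)
    (fun _ => Set.mem_univ _) (K := 1) fun t _ => by
      rw [abs_of_pos (deriv_trunc_pos ha t)]; exact deriv_trunc_le_one ha t

lemma aestronglyMeasurable_trunc {w : E d → ℝ} (hw : P.MemH1 w) (a : ℝ) :
    AEStronglyMeasurable (fun x => trunc a (w x)) P.vol :=
  (contDiff_trunc a).continuous.comp_aestronglyMeasurable hw.1.1

lemma MemH1.trunc {w : E d → ℝ} (hw : P.MemH1 w) {a : ℝ} (ha : 0 < a) :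
    P.MemH1 (fun x => trunc a (w x)) :=
  ⟨memLp_of_bounded (aestronglyMeasurable_trunc hw a) fun x => abs_trunc_le_bound ha (w x),
    fun i => ⟨_, hw.hasWeakPartial_trunc ha i⟩⟩

lemma MemH1.weakPartial_trunc {w : E d → ℝ} (hw : P.MemH1 w) {a : ℝ} (ha : 0 < a) (i : Fin d) :
    P.weakPartial i (fun x => VBDF2.trunc a (w x))
      =ᵐ[P.vol] fun x => deriv (VBDF2.trunc a) (w x) * P.weakPartial i w x :=
  (hw.hasWeakPartial_trunc ha i).weakPartial_ae_eq (hw.trunc ha).1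

lemma normSq_mono {u v : E d → ℝ} (hv : MemLp v 2 P.vol) (h : ∀ᵐ x ∂P.vol, |u x| ≤ |v x|) :
    P.normSq u ≤ P.normSq v := by
  refine integral_mono_of_nonneg (.of_forall fun x => sq_nonneg _) hv.integrable_sq ?_
  filter_upwards [h] with x hx
  exact sq_le_sq.2 hx

lemma MemH1.normH1_trunc_le {w : E d → ℝ} (hw : P.MemH1 w) {a : ℝ} (ha : 0 < a) :
    P.normH1 (fun x => VBDF2.trunc a (w x)) ≤ P.normH1 w := by
  refine Real.sqrt_le_sqrt (add_le_add ?_ (Finset.sum_le_sum fun i _ => ?_))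
  · exact normSq_mono hw.1 (.of_forall fun x => abs_trunc_le ha _)
  · refine normSq_mono (hw.memLp_weakPartial i) ?_
    filter_upwards [hw.weakPartial_trunc ha i] with x hx
    rw [hx, abs_mul, abs_of_pos (deriv_trunc_pos ha _)]
    exact mul_le_of_le_one_left (abs_nonneg _) (deriv_trunc_le_one ha _)

/-- The weighted Dirichlet integral of the truncation. -/
def truncEnergy (P : Domain d) (k : ℕ) (a : ℝ) (w : E d → ℝ) : ℝ :=
  ∑ i, ∫ x, trunc a (w x) ^ (2 * k) * deriv (trunc a) (w x) * P.weakPartial i w x ^ 2 ∂P.vol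

lemma integrable_truncEnergy {w : E d → ℝ} (hw : P.MemH1 w) {a : ℝ} (ha : 0 < a) (k : ℕ)
    (i : Fin d) : Integrable (fun x => VBDF2.trunc a (w x) ^ (2 * k)
      * deriv (VBDF2.trunc a) (w x) * P.weakPartial i w x ^ 2) P.vol := by
  refine (hw.memLp_weakPartial i).integrable_sq.bdd_mul (c := (Real.pi / 2 / a) ^ (2 * k) * 1)
    ?_ (.of_forall fun x => ?_)
  · exact ((aestronglyMeasurable_trunc hw a).pow _).mul
      (((contDiff_trunc a).continuous_deriv le_rfl).comp_aestronglyMeasurable hw.1.1)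
  · rw [norm_mul, norm_pow, Real.norm_eq_abs, Real.norm_eq_abs, abs_of_pos (deriv_trunc_pos ha _)]
    have := Real.pi_pos
    gcongr
    · exact (deriv_trunc_pos ha _).le
    · exact abs_trunc_le_bound ha _
    · exact deriv_trunc_le_one ha _

/-- Testing the Laplacian with an odd power of the truncation. -/
lemma HasLaplacian.truncEnergy_le {w lw : E d → ℝ} (h : P.HasLaplacian w lw) {a : ℝ} (ha : 0 < a)
    (k : ℕ) : (2 * k + 1) * P.truncEnergy k a w
      ≤ √(P.normSq lw) * √(∫ x, trunc a (w x) ^ (2 * (2 * k + 1)) ∂P.vol) := by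
  have hw := h.1
  have hT := hw.trunc ha
  have hB := fun x => abs_trunc_le_bound ha (w x)
  have hψ := hT.pow hB (2 * k + 1)
  have e1 := h.2.2 _ hψ
  have e2 : ∀ i, ∫ x, P.weakPartial i w x
      * P.weakPartial i (fun x => VBDF2.trunc a (w x) ^ (2 * k + 1)) x ∂P.vol
      = (2 * k + 1) * ∫ x, VBDF2.trunc a (w x) ^ (2 * k) * deriv (VBDF2.trunc a) (w x)
        * P.weakPartial i w x ^ 2 ∂P.vol := by
    intro i
    rw [← integral_const_mul]
    refine integral_congr_ae ?_
    filter_upwards [(hT.hasWeakPartial_pow hB (2 * k + 1) i).weakPartial_ae_eq hψ.1,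
      hw.weakPartial_trunc ha i] with x h1 h2
    rw [h1, h2, Nat.add_sub_cancel]
    push_cast; ring
  simp_rw [e2] at e1
  rw [← Finset.mul_sum] at e1
  rw [truncEnergy, e1]
  have h3 := integral_abs_mul_le h.2.1 hψ.1
  have e3 : ∫ x, (VBDF2.trunc a (w x) ^ (2 * k + 1)) ^ 2 ∂P.vol
      = ∫ x, VBDF2.trunc a (w x) ^ (2 * (2 * k + 1)) ∂P.vol := by
    simp_rw [← pow_mul, mul_comm]
  rw [e3] at h3
  refine le_trans ?_ h3
  rw [← integral_neg]
  refine integral_mono_ae (h.2.1.integrable_mul hψ.1).neg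
    (by simpa only [Pi.mul_apply, abs_mul] using (h.2.1.integrable_mul hψ.1).abs)
    (.of_forall fun x => ?_)
  simp only
  rw [← abs_mul]
  exact neg_le_abs _

/-- The estimate of weighted Dirichlet integrals by the Laplacian, with weight `|w|^{2k}`. -/
def PowBound (P : Domain d) (k : ℕ) : Prop :=
  ∀ M : ℝ, 0 ≤ M → ∃ K : ℝ, 0 ≤ K ∧ ∀ (w lw : E d → ℝ) (a : ℝ), 0 < a → P.HasLaplacian w lw →
    P.normH1 w ≤ M → P.truncEnergy k a w ≤ K * (1 + P.normSq lw ^ 2) ∧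
      ∫ x, trunc a (w x) ^ (2 * (k + 1)) ∂P.vol ≤ K * (1 + P.normSq lw ^ 2)

lemma sqrt_le_one_add_sq (s : ℝ) : √s ≤ 1 + s ^ 2 := by
  rw [Real.sqrt_le_left (by positivity)]
  nlinarith [sq_nonneg (s - 1), sq_nonneg (s ^ 2)]

theorem powBound_two (P : Domain 2) (k : ℕ) : P.PowBound k := by
  intro M hM
  obtain ⟨C, hC0, hC⟩ := exists_integral_pow_le_two P (2 * k + 1)
  obtain ⟨C', hC0', hC'⟩ := exists_integral_pow_le_two P (k + 1)
  refine ⟨√(C * M ^ (2 * (2 * k + 1))) + C' * M ^ (2 * (k + 1)), by positivity,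
    fun w lw a ha h hwM => ?_⟩
  have hT := h.1.trunc ha
  have hB := fun x => abs_trunc_le_bound ha (w x)
  have hn : P.normH1 (fun x => trunc a (w x)) ≤ M := (h.1.normH1_trunc_le ha).trans hwM
  have h1 : ∫ x, trunc a (w x) ^ (2 * (2 * k + 1)) ∂P.vol ≤ C * M ^ (2 * (2 * k + 1)) :=
    (hC _ hT ⟨_, hB⟩).trans (by gcongr; exact normH1_nonneg _)
  have h2 : ∫ x, trunc a (w x) ^ (2 * (k + 1)) ∂P.vol ≤ C' * M ^ (2 * (k + 1)) :=
    (hC' _ hT ⟨_, hB⟩).trans (by gcongr; exact normH1_nonneg _)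
  have h3 := h.truncEnergy_le ha k
  have hE0 : 0 ≤ P.truncEnergy k a w := Finset.sum_nonneg fun i _ =>
    integral_nonneg fun x => mul_nonneg (mul_nonneg (by simp only [pow_mul]; positivity)
      (deriv_trunc_pos ha _).le) (sq_nonneg _)
  have h4 : P.truncEnergy k a w ≤ (2 * k + 1) * P.truncEnergy k a w := by
    have : (0 : ℝ) ≤ k := k.cast_nonneg
    nlinarith
  have h5 := sqrt_le_one_add_sq (P.normSq lw)
  have hp : 0 ≤ C' * M ^ (2 * (k + 1)) := by positivity
  have hp' := Real.sqrt_nonneg (C * M ^ (2 * (2 * k + 1)))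
  constructor
  · calc P.truncEnergy k a w ≤ √(P.normSq lw) * √(∫ x, trunc a (w x) ^ (2 * (2 * k + 1)) ∂P.vol) :=
          h4.trans h3
      _ ≤ (1 + P.normSq lw ^ 2) * √(C * M ^ (2 * (2 * k + 1))) := by gcongr
      _ ≤ _ := by nlinarith [sq_nonneg (P.normSq lw)]
  · nlinarith [sq_nonneg (P.normSq lw), mul_nonneg hp (sq_nonneg (P.normSq lw)),
      mul_nonneg hp' (sq_nonneg (P.normSq lw))]

/-- The elementary inequality behind the interpolation argument in dimension three. -/
lemma interpolation_bound {C M A s X I6 I10 I30 : ℝ} (hM : 0 ≤ M) (hC0 : 0 ≤ C) (hA0 : 0 ≤ A)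
    (s0 : 0 ≤ s) (hX0 : 0 ≤ X) (p10 : 0 ≤ I10) (p30 : 0 ≤ I30)
    (h9X : 9 * X ≤ A * s)
    (h6 : I6 ≤ C * M ^ 6) (h10 : I10 ≤ M * s) (h18 : s ^ 4 ≤ I6 * I30)
    (h30 : I30 ≤ C * (I10 + 25 * X) ^ 3) :
    X ≤ (1 + M) * (C ^ 2 * M ^ 6) * (1000 * (1 + M) ^ 4) * (1 + A ^ 4) ∧
      I10 ≤ (1 + M) * (C ^ 2 * M ^ 6) * (1000 * (1 + M) ^ 4) * (1 + A ^ 4) := by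
  have hsum : I10 + 25 * X ≤ (M + 3 * A) * s := by nlinarith [mul_nonneg hA0 s0]
  have h4 : s ^ 4 ≤ s ^ 3 * ((C ^ 2 * M ^ 6) * (M + 3 * A) ^ 3) := by
    calc s ^ 4 ≤ I6 * I30 := h18
      _ ≤ (C * M ^ 6) * (C * ((M + 3 * A) * s) ^ 3) := by
          gcongr
          exact h30.trans (by gcongr)
      _ = _ := by ring
  have hsle : s ≤ (C ^ 2 * M ^ 6) * (M + 3 * A) ^ 3 := by
    rcases s0.eq_or_lt with h0 | h0
    · rw [← h0]; positivity
    · have h7 : s ^ 3 * s ≤ s ^ 3 * ((C ^ 2 * M ^ 6) * (M + 3 * A) ^ 3) := by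
        rw [← pow_succ]; exact h4
      exact le_of_mul_le_mul_left h7 (by positivity)
  have hpoly : (1 + A) ^ 4 ≤ 8 * (1 + A ^ 4) := by
    nlinarith [sq_nonneg (1 - A), sq_nonneg (A ^ 2 - 1), sq_nonneg (A - A ^ 2),
      sq_nonneg (1 - A ^ 2), mul_nonneg hA0 (sq_nonneg (1 - A))]
  have hMA : M + 3 * A ≤ 3 * (1 + M) * (1 + A) := by nlinarith [mul_nonneg hM hA0]
  have h1A : (1 : ℝ) ≤ 1 + A := by linarith
  have hfin : (1 + A) * (M + 3 * A) ^ 3 ≤ 1000 * (1 + M) ^ 4 * (1 + A ^ 4) := by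
    calc (1 + A) * (M + 3 * A) ^ 3 ≤ (1 + A) * (3 * (1 + M) * (1 + A)) ^ 3 := by gcongr
      _ = 27 * (1 + M) ^ 3 * (1 + A) ^ 4 := by ring
      _ ≤ 27 * (1 + M) ^ 4 * (8 * (1 + A ^ 4)) := by
          have : (1 + M) ^ 3 ≤ (1 + M) ^ 4 := pow_le_pow_right₀ (by linarith) (by norm_num)
          gcongr
      _ ≤ 1000 * (1 + M) ^ 4 * (1 + A ^ 4) := by
          have : 0 ≤ (1 + M) ^ 4 * (1 + A ^ 4) := by positivity
          nlinarith
  have hs1 : (1 + A) * s ≤ (C ^ 2 * M ^ 6) * (1000 * (1 + M) ^ 4 * (1 + A ^ 4)) := by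
    calc (1 + A) * s ≤ (1 + A) * ((C ^ 2 * M ^ 6) * (M + 3 * A) ^ 3) := by gcongr
      _ = (C ^ 2 * M ^ 6) * ((1 + A) * (M + 3 * A) ^ 3) := by ring
      _ ≤ _ := by gcongr
  have hkey : (1 + M) * ((1 + A) * s) ≤ (1 + M) * (C ^ 2 * M ^ 6) * (1000 * (1 + M) ^ 4) * (1 + A ^ 4) := by
    calc (1 + M) * ((1 + A) * s) ≤ (1 + M) * ((C ^ 2 * M ^ 6) * (1000 * (1 + M) ^ 4 * (1 + A ^ 4))) := by gcongr
      _ = _ := by ring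
  constructor
  · refine le_trans ?_ hkey
    nlinarith [mul_nonneg hA0 s0, mul_nonneg hM s0, mul_nonneg hM (mul_nonneg hA0 s0)]
  · refine le_trans ?_ hkey
    have : I10 ≤ M * s := h10
    nlinarith [mul_nonneg hA0 s0, mul_nonneg hM s0, mul_nonneg hM (mul_nonneg hA0 s0)]

theorem powBound_three (P : Domain 3) : P.PowBound 4 := by
  intro M hM
  obtain ⟨C, hC0, hC⟩ := exists_integral_pow_six_le P
  refine ⟨(1 + M) * (C ^ 2 * M ^ 6) * (1000 * (1 + M) ^ 4), by positivity, fun w lw a ha h hwM => ?_⟩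
  have hT := h.1.trunc ha
  have hB := fun x => abs_trunc_le_bound ha (w x)
  have hm := aestronglyMeasurable_trunc h.1 a
  have hn : P.normH1 (fun x => trunc a (w x)) ≤ M := (h.1.normH1_trunc_le ha).trans hwM
  have hn0 := normH1_nonneg (P := P) (fun x => trunc a (w x))
  set X := P.truncEnergy 4 a w with hX
  set A := √(P.normSq lw) with hA
  have hA0 : 0 ≤ A := Real.sqrt_nonneg _
  have hA4 : A ^ 4 = P.normSq lw ^ 2 := by
    have : A ^ 2 = P.normSq lw := Real.sq_sqrt (normSq_nonneg _)
    rw [← this]; ring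
  set I6 := ∫ x, trunc a (w x) ^ 6 ∂P.vol with hI6
  set I10 := ∫ x, trunc a (w x) ^ 10 ∂P.vol with hI10
  set I18 := ∫ x, trunc a (w x) ^ 18 ∂P.vol with hI18
  set I30 := ∫ x, trunc a (w x) ^ 30 ∂P.vol with hI30
  have p6 : 0 ≤ I6 := integral_nonneg fun x => by positivity
  have p10 : 0 ≤ I10 := integral_nonneg fun x => by positivity
  have p18 : 0 ≤ I18 := integral_nonneg fun x => by positivity
  have p30 : 0 ≤ I30 := integral_nonneg fun x => by positivity
  set s := √I18 with hs
  have s0 : 0 ≤ s := Real.sqrt_nonneg _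
  have hs2 : s ^ 2 = I18 := Real.sq_sqrt p18
  have h9X : 9 * X ≤ A * s := by
    have := h.truncEnergy_le ha 4
    norm_num at this
    exact this
  have hX0 : 0 ≤ X := Finset.sum_nonneg fun i _ =>
    integral_nonneg fun x => mul_nonneg (mul_nonneg (by simp only [pow_mul]; positivity)
      (deriv_trunc_pos ha _).le) (sq_nonneg _)
  have h6 : I6 ≤ C * M ^ 6 := (hC _ hT ⟨_, hB⟩).trans (by gcongr)
  have h10 : I10 ≤ M * s := by
    have h1 := integral_abs_mul_le hT.1 (memLp_pow hm hB 9)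
    have e1 : ∫ x, |trunc a (w x)| * |trunc a (w x) ^ 9| ∂P.vol = I10 := by
      refine integral_congr_ae (.of_forall fun x => ?_)
      simp only
      rw [← abs_mul, ← pow_succ']
      exact abs_of_nonneg ((show Even (9 + 1) by decide).pow_nonneg _)
    have e2 : ∫ x, (trunc a (w x) ^ 9) ^ 2 ∂P.vol = I18 := by simp_rw [← pow_mul]; rfl
    rw [e1, e2] at h1
    refine h1.trans ?_
    gcongr
    exact (sqrt_normSq_le _).trans hn
  have h18 : s ^ 4 ≤ I6 * I30 := by
    have h1 := integral_abs_mul_le (memLp_pow hm hB 3) (memLp_pow hm hB 15)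
    have e1 : ∫ x, |trunc a (w x) ^ 3| * |trunc a (w x) ^ 15| ∂P.vol = I18 := by
      refine integral_congr_ae (.of_forall fun x => ?_)
      simp only
      rw [← abs_mul, ← pow_add]
      exact abs_of_nonneg ((show Even (3 + 15) by decide).pow_nonneg _)
    have e2 : ∫ x, (trunc a (w x) ^ 3) ^ 2 ∂P.vol = I6 := by simp_rw [← pow_mul]; rfl
    have e3 : ∫ x, (trunc a (w x) ^ 15) ^ 2 ∂P.vol = I30 := by simp_rw [← pow_mul]; rfl
    rw [e1, e2, e3] at h1
    calc s ^ 4 = I18 ^ 2 := by rw [← hs2]; ring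
      _ ≤ (√I6 * √I30) ^ 2 := pow_le_pow_left₀ p18 h1 2
      _ = I6 * I30 := by rw [mul_pow, Real.sq_sqrt p6, Real.sq_sqrt p30]
  have h30 : I30 ≤ C * (I10 + 25 * X) ^ 3 := by
    have hv := hT.pow hB 5
    have h1 := hC _ hv ⟨(Real.pi / 2 / a) ^ 5, fun x => by
      rw [abs_pow]; exact pow_le_pow_left₀ (abs_nonneg _) (hB x) 5⟩
    have e1 : ∫ x, (trunc a (w x) ^ 5) ^ 6 ∂P.vol = I30 := by simp_rw [← pow_mul]; rfl
    rw [e1] at h1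
    refine h1.trans ?_
    have e2 : P.normH1 (fun x => trunc a (w x) ^ 5) ^ 6
        = (P.normH1 (fun x => trunc a (w x) ^ 5) ^ 2) ^ 3 := by ring
    rw [e2, sq_normH1]
    have e3 : P.normSq (fun x => trunc a (w x) ^ 5) = I10 := by
      unfold normSq; simp_rw [← pow_mul]; rfl
    have e4 : P.gradNormSq (fun x => trunc a (w x) ^ 5) ≤ 25 * X := by
      rw [hX, truncEnergy, Finset.mul_sum]
      refine Finset.sum_le_sum fun i _ => ?_
      rw [← integral_const_mul]
      refine integral_mono_of_nonneg (.of_forall fun x => sq_nonneg _)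
        ((integrable_truncEnergy h.1 ha 4 i).const_mul _) ?_
      filter_upwards [(hT.hasWeakPartial_pow hB 5 i).weakPartial_ae_eq hv.1,
        h.1.weakPartial_trunc ha i] with x h1 h2
      rw [h1, h2]
      have hd0 := (deriv_trunc_pos ha (w x)).le
      have hd1 := deriv_trunc_le_one ha (w x)
      set T := trunc a (w x)
      set D := deriv (trunc a) (w x)
      set p := P.weakPartial i w x
      have h5 : 0 ≤ T ^ 8 * p ^ 2 := by positivity
      have h6 : D * D ≤ D := mul_le_of_le_one_left hd0 hd1
      calc ((5 : ℕ) * T ^ (5 - 1) * (D * p)) ^ 2 = 25 * ((T ^ 8 * p ^ 2) * (D * D)) := by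
            norm_num; ring
        _ ≤ 25 * ((T ^ 8 * p ^ 2) * D) := by gcongr
        _ = 25 * (T ^ (2 * 4) * D * p ^ 2) := by ring
    rw [e3]
    have := gradNormSq_nonneg (P := P) (fun x => trunc a (w x) ^ 5)
    gcongr
  rw [← hA4]
  exact interpolation_bound hM hC0 hA0 s0 hX0 p10 p30 h9X h6 h10 h18 h30

end Domain

end VBDF2

namespace VBDF2

variable {d : ℕ}

open Filter Topology

namespace Domain

variable {P : Domain d}

/-- The chain rule for a `C¹` function under a domination hypothesis. -/
theorem MemH1.hasWeakPartial_comp_of_dominated {w : E d → ℝ} (hw : P.MemH1 w) {f : ℝ → ℝ}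
    (hf : ContDiff ℝ 1 f) {D₀ D₁ : E d → ℝ} (hD₀ : MemLp D₀ 2 P.vol) (hD₁ : MemLp D₁ 2 P.vol)
    (i : Fin d) (h : ∀ᵐ x ∂P.vol, ∀ t, |t| ≤ |w x| → |f t| ≤ D₀ x ∧
      |deriv f t| * |P.weakPartial i w x| ≤ D₁ x) :
    P.HasWeakPartial i (fun x => f (w x)) (fun x => deriv f (w x) * P.weakPartial i w x) := by
  have hf' := hf.continuous_deriv le_rfl
  have hm : AEStronglyMeasurable (fun x => deriv f (w x) * P.weakPartial i w x) P.vol :=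
    (hf'.comp_aestronglyMeasurable hw.1.1).mul (hw.memLp_weakPartial i).1
  refine ⟨hD₁.mono hm ?_, fun ψ hψ => ?_⟩
  · filter_upwards [h] with x hx
    rw [norm_mul]
    exact ((hx _ le_rfl).2).trans (le_abs_self _)
  · set a : ℕ → ℝ := fun n => 1 / ((n : ℝ) + 1) with ha
    have ha0 : ∀ n, 0 < a n := fun n => by simp only [ha]; positivity
    have hlim : Tendsto a atTop (𝓝 0) := tendsto_one_div_add_atTop_nhds_zero_nat
    have hder : ∀ n s, deriv (fun s => f (VBDF2.trunc (a n) s)) s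
        = deriv f (VBDF2.trunc (a n) s) * deriv (VBDF2.trunc (a n)) s := fun n s =>
      deriv_comp s (hf.differentiable one_ne_zero _)
        ((contDiff_trunc (a n)).differentiable one_ne_zero s)
    have key : ∀ n, ∫ x, f (VBDF2.trunc (a n) (w x)) * fderiv ℝ ψ x (basisVec i) ∂P.vol
        = - ∫ x, deriv f (VBDF2.trunc (a n) (w x)) * deriv (VBDF2.trunc (a n)) (w x)
          * P.weakPartial i w x * ψ x ∂P.vol := by
      intro n
      obtain ⟨K, hK⟩ := (isCompact_Icc (a := -(Real.pi / 2 / a n)) (b := Real.pi / 2 / a n)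
        ).exists_bound_of_continuousOn hf'.continuousOn
      have h1 := (hw.hasWeakPartial i).comp hw.1 (f := fun s => f (VBDF2.trunc (a n) s))
        (hf.comp (contDiff_trunc (a n))) convex_univ (Set.mem_univ _) (fun _ => Set.mem_univ _)
        (K := K) (fun t _ => by
          rw [hder, abs_mul, abs_of_pos (deriv_trunc_pos (ha0 n) t)]
          have h2 : |deriv f (VBDF2.trunc (a n) t)| ≤ K :=
            hK _ (abs_le.1 (abs_trunc_le_bound (ha0 n) t))
          exact (mul_le_of_le_one_right (abs_nonneg _) (deriv_trunc_le_one (ha0 n) t)).trans h2)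
      have h2 := h1.2 ψ hψ
      simp_rw [hder] at h2
      exact h2
    obtain ⟨C, hC⟩ := exists_ae_bound_of_continuous (P := P) hψ.contDiff.continuous
    obtain ⟨C', hC'⟩ := exists_ae_bound_of_continuous (P := P)
      (hψ.continuous_fderiv (basisVec i))
    have lim1 : Tendsto (fun n => ∫ x, f (VBDF2.trunc (a n) (w x)) * fderiv ℝ ψ x (basisVec i) ∂P.vol)
        atTop (𝓝 (∫ x, f (w x) * fderiv ℝ ψ x (basisVec i) ∂P.vol)) := by
      refine tendsto_integral_of_dominated_convergence (fun x => D₀ x * C') (fun n => ?_)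
        ((integrable_of_memLp hD₀).mul_const _) (fun n => ?_) (.of_forall fun x => ?_)
      · exact (hf.continuous.comp_aestronglyMeasurable (aestronglyMeasurable_trunc hw _)).mul
          (hψ.continuous_fderiv _).aestronglyMeasurable
      · filter_upwards [h, hC'] with x hx hx'
        rw [norm_mul]
        have h1 := (hx _ (abs_trunc_le (ha0 n) (w x))).1
        exact mul_le_mul h1 hx' (norm_nonneg _) ((abs_nonneg _).trans h1)
      · exact ((hf.continuous.tendsto _).comp (tendsto_trunc (w x) ha0 hlim)).mul_const _
    have lim2 : Tendsto (fun n => ∫ x, deriv f (VBDF2.trunc (a n) (w x)) * deriv (VBDF2.trunc (a n)) (w x)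
          * P.weakPartial i w x * ψ x ∂P.vol)
        atTop (𝓝 (∫ x, deriv f (w x) * P.weakPartial i w x * ψ x ∂P.vol)) := by
      refine tendsto_integral_of_dominated_convergence (fun x => D₁ x * C) (fun n => ?_)
        ((integrable_of_memLp hD₁).mul_const _) (fun n => ?_) (.of_forall fun x => ?_)
      · exact (((hf'.comp_aestronglyMeasurable (aestronglyMeasurable_trunc hw _)).mul
          (((contDiff_trunc (a n)).continuous_deriv le_rfl).comp_aestronglyMeasurable hw.1.1)).mul
            (hw.memLp_weakPartial i).1).mul hψ.contDiff.continuous.aestronglyMeasurable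
      · filter_upwards [h, hC] with x hx hx'
        rw [norm_mul, norm_mul, norm_mul]
        have h1 := (hx _ (abs_trunc_le (ha0 n) (w x))).2
        have h2 : ‖deriv f (VBDF2.trunc (a n) (w x))‖ * ‖deriv (VBDF2.trunc (a n)) (w x)‖
            * ‖P.weakPartial i w x‖ ≤ D₁ x := by
          refine le_trans ?_ h1
          simp only [Real.norm_eq_abs]
          rw [abs_of_pos (deriv_trunc_pos (ha0 n) (w x))]
          gcongr
          exact mul_le_of_le_one_right (abs_nonneg _) (deriv_trunc_le_one (ha0 n) _)
        exact mul_le_mul h2 hx' (norm_nonneg _) (le_trans (by positivity) h2)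
      · refine Tendsto.mul_const _ (Tendsto.mul_const _ ?_)
        have h1 := ((hf'.tendsto _).comp (tendsto_trunc (w x) ha0 hlim)).mul
          (tendsto_deriv_trunc (w x) ha0 hlim)
        simpa using h1
    simp_rw [key] at lim1
    exact tendsto_nhds_unique lim1 lim2.neg

/-- Passing to the limit in the truncated estimates. -/
lemma PowBound.limit {k : ℕ} (hk : P.PowBound k) {M : ℝ} (hM : 0 ≤ M) :
    ∃ K : ℝ, 0 ≤ K ∧ ∀ (w lw : E d → ℝ), P.HasLaplacian w lw → P.normH1 w ≤ M →
      MemLp (fun x => w x ^ (k + 1)) 2 P.vol ∧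
      (∀ i, MemLp (fun x => w x ^ k * P.weakPartial i w x) 2 P.vol) ∧
      ∑ i, ∫ x, (w x ^ k * P.weakPartial i w x) ^ 2 ∂P.vol ≤ K * (1 + P.normSq lw ^ 2) := by
  obtain ⟨K, hK0, hK⟩ := hk M hM
  refine ⟨K, hK0, fun w lw h hwM => ?_⟩
  have hw := h.1
  set a : ℕ → ℝ := fun n => 1 / ((n : ℝ) + 1) with ha
  have ha0 : ∀ n, 0 < a n := fun n => by simp only [ha]; positivity
  have hlim : Tendsto a atTop (𝓝 0) := tendsto_one_div_add_atTop_nhds_zero_nat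
  have f1 := integrable_and_integral_le_of_tendsto (μ := P.vol)
    (F := fun n x => trunc (a n) (w x) ^ (2 * (k + 1))) (f := fun x => w x ^ (2 * (k + 1)))
    (fun n => integrable_pow (aestronglyMeasurable_trunc hw _)
      (fun x => abs_trunc_le_bound (ha0 n) (w x)) _)
    (fun n x => by rw [pow_mul]; positivity)
    (.of_forall fun x => (tendsto_trunc (w x) ha0 hlim).pow _)
    (fun n => (hK w lw (a n) (ha0 n) h hwM).2)
  have f2 := integrable_and_integral_le_of_tendsto (μ := P.vol)
    (F := fun n x => ∑ i, trunc (a n) (w x) ^ (2 * k) * deriv (trunc (a n)) (w x)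
      * P.weakPartial i w x ^ 2) (f := fun x => ∑ i, (w x ^ k * P.weakPartial i w x) ^ 2)
    (K := K * (1 + P.normSq lw ^ 2))
    (fun n => integrable_finsetSum _ fun i _ => integrable_truncEnergy hw (ha0 n) k i)
    (fun n x => Finset.sum_nonneg fun i _ => mul_nonneg (mul_nonneg
      (by rw [pow_mul]; positivity) (deriv_trunc_pos (ha0 n) _).le) (sq_nonneg _))
    (.of_forall fun x => by
      refine tendsto_finsetSum _ fun i _ => ?_
      have h1 := (((tendsto_trunc (w x) ha0 hlim).pow (2 * k)).mul
        (tendsto_deriv_trunc (w x) ha0 hlim)).mul_const (P.weakPartial i w x ^ 2)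
      convert! h1 using 2
      rw [mul_one, mul_pow, ← pow_mul, mul_comm k])
    (fun n => by
      rw [integral_finsetSum _ fun i _ => integrable_truncEnergy hw (ha0 n) k i]
      exact (hK w lw (a n) (ha0 n) h hwM).1)
  have hmi : ∀ i, AEStronglyMeasurable (fun x => w x ^ k * P.weakPartial i w x) P.vol :=
    fun i => (hw.1.1.pow k).mul (hw.memLp_weakPartial i).1
  have hii : ∀ i, Integrable (fun x => (w x ^ k * P.weakPartial i w x) ^ 2) P.vol := by
    intro i
    refine f2.1.mono ((hmi i).pow 2) (.of_forall fun x => ?_)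
    rw [Real.norm_of_nonneg (sq_nonneg _),
      Real.norm_of_nonneg (Finset.sum_nonneg fun _ _ => sq_nonneg _)]
    exact Finset.single_le_sum (f := fun i => (w x ^ k * P.weakPartial i w x) ^ 2)
      (fun _ _ => sq_nonneg _) (Finset.mem_univ i)
  refine ⟨?_, fun i => (memLp_two_iff_integrable_sq (hmi i)).2 (hii i), ?_⟩
  · have hm : AEStronglyMeasurable (fun x => w x ^ (k + 1)) P.vol := hw.1.1.pow _
    refine (memLp_two_iff_integrable_sq hm).2 ?_
    simpa only [← pow_mul, mul_comm (k + 1)] using f1.1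
  · rw [← integral_finsetSum _ fun i _ => hii i]
    exact f2.2

end Domain

lemma abs_le_of_deriv_le {f : ℝ → ℝ} (hf : ContDiff ℝ 1 f) {t K : ℝ}
    (hK : ∀ s, |s| ≤ |t| → |deriv f s| ≤ K) : |f t| ≤ |f 0| + K * |t| := by
  have h := abs_comp_sub_le hf (convex_Icc (-|t|) |t|) (K := K) (fun s hs => hK s (abs_le.2 hs))
    (a := 0) (b := t) ⟨by simp, by simp⟩ (abs_le.1 le_rfl)
  have h2 : |f t| ≤ |f 0| + |f t - f 0| := by
    have := abs_add_le (f 0) (f t - f 0); simpa using this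
  rw [sub_zero] at h
  linarith

/-- A subcritical power is small relative to the critical one. -/
lemma exists_rpow_le {p : ℝ} {k : ℕ} (hp : 0 < p) (hpk : p < k) {η : ℝ} (hη : 0 < η) :
    ∃ C : ℝ, 0 ≤ C ∧ ∀ s : ℝ, |s| ^ p ≤ η * |s| ^ k + C := by
  have h1 : Tendsto (fun R : ℝ => R ^ (-((k : ℝ) - p))) atTop (𝓝 0) :=
    tendsto_rpow_neg_atTop (by linarith)
  obtain ⟨R, hR, hR1⟩ := ((h1.eventually_lt_const hη).and (eventually_ge_atTop 1)).exists
  have hR0 : (0 : ℝ) < R := by linarith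
  refine ⟨R ^ p, by positivity, fun s => ?_⟩
  rcases le_or_gt |s| R with h | h
  · have h2 : |s| ^ p ≤ R ^ p := Real.rpow_le_rpow (abs_nonneg _) h hp.le
    have : 0 ≤ η * |s| ^ k := by positivity
    linarith
  · have hs0 : 0 < |s| := hR0.trans h
    have h3 : |s| ^ p = |s| ^ k * |s| ^ (-((k : ℝ) - p)) := by
      rw [← Real.rpow_natCast, ← Real.rpow_add hs0]; ring_nf
    have h4 : |s| ^ (-((k : ℝ) - p)) ≤ R ^ (-((k : ℝ) - p)) :=
      Real.rpow_le_rpow_of_nonpos hR0 h.le (by linarith)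
    have h5 : 0 ≤ |s| ^ k := by positivity
    have h6 : 0 ≤ R ^ p := by positivity
    rw [h3]
    nlinarith

namespace Domain

/-- The conclusions about the nonlinearity that the scheme needs. -/
structure NonlinearBound (P : Domain d) (g : ℝ → ℝ) (η C : ℝ) (w lw : E d → ℝ) : Prop where
  integrable : Integrable (fun x => g (w x)) P.vol
  memLp : MemLp (fun x => deriv g (w x)) 2 P.vol
  hasWeakPartial : ∀ i, P.HasWeakPartial i (fun x => deriv g (w x))
    (fun x => deriv (deriv g) (w x) * P.weakPartial i w x)
  bound : ∑ i, ∫ x, (deriv (deriv g) (w x) * P.weakPartial i w x) ^ 2 ∂P.vol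
    ≤ η * P.normSq lw ^ 2 + C

variable {P : Domain d}

lemma integral_sq_le_of_abs_le {f D : E d → ℝ} (hD : MemLp D 2 P.vol)
    (h : ∀ᵐ x ∂P.vol, |f x| ≤ D x) : ∫ x, f x ^ 2 ∂P.vol ≤ ∫ x, D x ^ 2 ∂P.vol := by
  refine integral_mono_of_nonneg (.of_forall fun x => sq_nonneg _) hD.integrable_sq ?_
  filter_upwards [h] with x hx
  exact sq_le_sq' (abs_le.1 hx).1 (abs_le.1 hx).2

lemma gradNormSq_le (w : E d → ℝ) : P.gradNormSq w ≤ P.normH1 w ^ 2 := by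
  rw [sq_normH1]; linarith [normSq_nonneg (P := P) w]

lemma memLp_abs_add_abs {u v : E d → ℝ} (hu : MemLp u 2 P.vol) (hv : MemLp v 2 P.vol)
    (a b : ℝ) : MemLp (fun x => a * |u x| + b * |v x|) 2 P.vol :=
  (hu.norm.const_mul a).add (hv.norm.const_mul b)

/-- The nonlinear estimate when the second derivative is dominated by a power. -/
theorem PowBound.nonlinearBound {k : ℕ} (hk : P.PowBound k) {g : ℝ → ℝ} (hg : ContDiff ℝ 2 g)
    (hgrowth : ∀ η : ℝ, 0 < η → ∃ C : ℝ, 0 ≤ C ∧ ∀ s, |deriv (deriv g) s| ≤ η * |s| ^ k + C)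
    {M η : ℝ} (hM : 0 ≤ M) (hη : 0 < η) : ∃ C : ℝ, 0 ≤ C ∧ ∀ w lw, P.HasLaplacian w lw →
      P.normH1 w ≤ M → P.NonlinearBound g η C w lw := by
  obtain ⟨K, hK0, hK⟩ := hk.limit hM
  set η' : ℝ := √(η / (2 * (K + 1))) with hη'
  have hη'0 : 0 < η' := Real.sqrt_pos.2 (by positivity)
  have hη'2 : η' ^ 2 = η / (2 * (K + 1)) := Real.sq_sqrt (by positivity)
  obtain ⟨C, hC0, hC⟩ := hgrowth η' hη'0
  have hg1 : ContDiff ℝ 1 (deriv g) := hg.deriv' (n := 1)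
  have hg2 := hg1.continuous_deriv le_rfl
  refine ⟨η + 2 * C ^ 2 * M ^ 2, by positivity, fun w lw h hwM => ?_⟩
  obtain ⟨h1, h2, h3⟩ := hK w lw h hwM
  have hw := h.1
  have hdg : ∀ t, |deriv g t| ≤ |deriv g 0| + (η' * |t| ^ k + C) * |t| := fun t =>
    abs_le_of_deriv_le hg1 fun s hs => (hC s).trans (by gcongr)
  have hgb : ∀ t, |g t| ≤ |g 0| + (|deriv g 0| + (η' * |t| ^ k + C) * |t|) * |t| := fun t =>
    abs_le_of_deriv_le (hg.of_le (by norm_num)) fun s hs => (hdg s).trans (by gcongr)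
  obtain ⟨D₀, hD₀⟩ : ∃ D : E d → ℝ,
      D = fun x => |deriv g 0| + (η' * |w x ^ (k + 1)| + C * |w x|) := ⟨_, rfl⟩
  have hD₀m : MemLp D₀ 2 P.vol := by
    rw [hD₀]
    have hc : MemLp (fun _ : E d => |deriv g 0|) 2 P.vol := memLp_const _
    exact hc.add (memLp_abs_add_abs h1 hw.1 η' C)
  have hD₀e : ∀ x, |deriv g 0| + (η' * |w x| ^ k + C) * |w x| = D₀ x := fun x => by
    simp only [hD₀, abs_pow]; ring
  obtain ⟨D₁, hD₁⟩ : ∃ D : Fin d → E d → ℝ, D = fun i x =>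
    η' * |w x ^ k * P.weakPartial i w x| + C * |P.weakPartial i w x| := ⟨_, rfl⟩
  have hD₁m : ∀ i, MemLp (D₁ i) 2 P.vol := fun i => hD₁ ▸
    memLp_abs_add_abs (h2 i) (hw.memLp_weakPartial i) η' C
  have hD₁e : ∀ i x, (η' * |w x| ^ k + C) * |P.weakPartial i w x| = D₁ i x := fun i x => by
    simp only [hD₁, abs_mul, abs_pow]; ring
  have hpart : ∀ i, P.HasWeakPartial i (fun x => deriv g (w x))
      (fun x => deriv (deriv g) (w x) * P.weakPartial i w x) := fun i =>
    hw.hasWeakPartial_comp_of_dominated hg1 hD₀m (hD₁m i) i (.of_forall fun x t ht => by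
      constructor
      · rw [← hD₀e]
        exact (hdg t).trans (by gcongr)
      · rw [← hD₁e]
        gcongr
        exact (hC t).trans (by gcongr))
  refine ⟨?_, ?_, hpart, ?_⟩
  · have hi : Integrable (fun x => |g 0| + |D₀ x * w x|) P.vol :=
      (integrable_const _).add (hD₀m.integrable_mul hw.1).abs
    refine hi.mono (hg.continuous.comp_aestronglyMeasurable hw.1.1) (.of_forall fun x => ?_)
    have h4 := hgb (w x)
    rw [hD₀e] at h4
    have hD0 : 0 ≤ D₀ x := by simp only [hD₀]; positivity
    have h5 : |D₀ x * w x| = D₀ x * |w x| := by rw [abs_mul, abs_of_nonneg hD0]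
    rw [Real.norm_eq_abs, Real.norm_eq_abs, h5]
    exact h4.trans (le_abs_self _)
  · refine hD₀m.mono (hg1.continuous.comp_aestronglyMeasurable hw.1.1) (.of_forall fun x => ?_)
    have h4 := hdg (w x)
    rw [hD₀e] at h4
    exact h4.trans (le_abs_self _)
  · have h5 : ∀ i, ∫ x, (deriv (deriv g) (w x) * P.weakPartial i w x) ^ 2 ∂P.vol
        ≤ 2 * η' ^ 2 * ∫ x, (w x ^ k * P.weakPartial i w x) ^ 2 ∂P.vol
          + 2 * C ^ 2 * P.normSq (P.weakPartial i w) := by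
      intro i
      have h6 : ∫ x, (deriv (deriv g) (w x) * P.weakPartial i w x) ^ 2 ∂P.vol
          ≤ ∫ x, D₁ i x ^ 2 ∂P.vol := by
        refine integral_sq_le_of_abs_le (hD₁m i) (.of_forall fun x => ?_)
        rw [← hD₁e, abs_mul]
        gcongr
        exact hC _
      refine h6.trans ?_
      rw [normSq, ← integral_const_mul, ← integral_const_mul, ← integral_add
        ((h2 i).integrable_sq.const_mul _) ((hw.memLp_weakPartial i).integrable_sq.const_mul _)]
      refine integral_mono (hD₁m i).integrable_sq
        (((h2 i).integrable_sq.const_mul _).add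
          ((hw.memLp_weakPartial i).integrable_sq.const_mul _)) fun x => ?_
      simp only [hD₁]
      have e1 := sq_abs (w x ^ k * P.weakPartial i w x)
      have e2 := sq_abs (P.weakPartial i w x)
      rw [← e1, ← e2]
      nlinarith [sq_nonneg (η' * |w x ^ k * P.weakPartial i w x| - C * |P.weakPartial i w x|)]
    calc ∑ i, ∫ x, (deriv (deriv g) (w x) * P.weakPartial i w x) ^ 2 ∂P.vol
        ≤ ∑ i, (2 * η' ^ 2 * ∫ x, (w x ^ k * P.weakPartial i w x) ^ 2 ∂P.vol
          + 2 * C ^ 2 * P.normSq (P.weakPartial i w)) := Finset.sum_le_sum fun i _ => h5 i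
      _ = 2 * η' ^ 2 * ∑ i, ∫ x, (w x ^ k * P.weakPartial i w x) ^ 2 ∂P.vol
          + 2 * C ^ 2 * P.gradNormSq w := by
          rw [Finset.sum_add_distrib, ← Finset.mul_sum, ← Finset.mul_sum, gradNormSq]
      _ ≤ 2 * η' ^ 2 * (K * (1 + P.normSq lw ^ 2)) + 2 * C ^ 2 * M ^ 2 := by
          have h7 : P.gradNormSq w ≤ M ^ 2 :=
            (gradNormSq_le w).trans (pow_le_pow_left₀ (normH1_nonneg _) hwM 2)
          gcongr
      _ ≤ η * (1 + P.normSq lw ^ 2) + 2 * C ^ 2 * M ^ 2 := by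
          rw [hη'2]
          have h8 : 2 * (η / (2 * (K + 1))) * (K * (1 + P.normSq lw ^ 2))
              = η * (1 + P.normSq lw ^ 2) * (K / (K + 1)) := by field_simp
          have h9 : K / (K + 1) ≤ 1 := by rw [div_le_one (by positivity)]; linarith
          have h10 : η * (1 + P.normSq lw ^ 2) * (K / (K + 1)) ≤ η * (1 + P.normSq lw ^ 2) :=
            mul_le_of_le_one_right (by positivity) h9
          linarith
      _ = η * P.normSq lw ^ 2 + (η + 2 * C ^ 2 * M ^ 2) := by ring

/-- The nonlinear estimate in dimension one. -/
theorem nonlinearBound_one (P : Domain 1) {g : ℝ → ℝ} (hg : ContDiff ℝ 2 g) {M η : ℝ}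
    (hM : 0 ≤ M) (hη : 0 < η) : ∃ C : ℝ, 0 ≤ C ∧ ∀ w lw, P.HasLaplacian w lw →
      P.normH1 w ≤ M → P.NonlinearBound g η C w lw := by
  obtain ⟨S, hS0, hS⟩ := exists_abs_le_one P
  have hg1 : ContDiff ℝ 1 (deriv g) := hg.deriv' (n := 1)
  have hg2 := hg1.continuous_deriv le_rfl
  have hcpt : IsCompact (Set.Icc (-(S * M)) (S * M)) := isCompact_Icc
  obtain ⟨B₀, hB₀⟩ := hcpt.exists_bound_of_continuousOn hg.continuous.continuousOn
  obtain ⟨B₁, hB₁⟩ := hcpt.exists_bound_of_continuousOn hg1.continuous.continuousOn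
  obtain ⟨B₂, hB₂⟩ := hcpt.exists_bound_of_continuousOn hg2.continuousOn
  have hB₂0 : 0 ≤ B₂ := (norm_nonneg _).trans (hB₂ 0 ⟨by simp; positivity, by positivity⟩)
  refine ⟨B₂ ^ 2 * M ^ 2, by positivity, fun w lw h hwM => ?_⟩
  have hw := h.1
  have hb : ∀ᵐ x ∂P.vol, |w x| ≤ S * M := by
    filter_upwards [hS w hw] with x hx
    exact hx.trans (by gcongr)
  have hmem : ∀ {x t}, |w x| ≤ S * M → |t| ≤ |w x| → t ∈ Set.Icc (-(S * M)) (S * M) :=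
    fun h1 h2 => abs_le.1 (h2.trans h1)
  have hab : ∀ i, MemLp (fun x => B₂ * |P.weakPartial i w x|) 2 P.vol := fun i =>
    (hw.memLp_weakPartial i).norm.const_mul B₂
  refine ⟨?_, ?_, fun i => ?_, ?_⟩
  · refine (integrable_const B₀).mono' (hg.continuous.comp_aestronglyMeasurable hw.1.1) ?_
    filter_upwards [hb] with x hx
    exact hB₀ _ (hmem hx le_rfl)
  · refine MemLp.of_bound (hg1.continuous.comp_aestronglyMeasurable hw.1.1) B₁ ?_
    filter_upwards [hb] with x hx
    exact hB₁ _ (hmem hx le_rfl)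
  · refine hw.hasWeakPartial_comp_of_dominated hg1 (memLp_const B₁)
      (hab i) i ?_
    filter_upwards [hb] with x hx t ht
    refine ⟨hB₁ _ (hmem hx ht), ?_⟩
    gcongr
    exact hB₂ _ (hmem hx ht)
  · calc ∑ i, ∫ x, (deriv (deriv g) (w x) * P.weakPartial i w x) ^ 2 ∂P.vol
        ≤ ∑ i, B₂ ^ 2 * P.normSq (P.weakPartial i w) := by
          refine Finset.sum_le_sum fun i _ => ?_
          have h6 := integral_sq_le_of_abs_le (P := P)
            (f := fun x => deriv (deriv g) (w x) * P.weakPartial i w x)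
            (hab i) (by
              filter_upwards [hb] with x hx
              rw [abs_mul]
              gcongr
              exact hB₂ _ (hmem hx le_rfl))
          refine h6.trans (le_of_eq ?_)
          rw [normSq, ← integral_const_mul]
          simp_rw [mul_pow, sq_abs]
      _ = B₂ ^ 2 * P.gradNormSq w := by rw [← Finset.mul_sum, gradNormSq]
      _ ≤ B₂ ^ 2 * M ^ 2 := by
          gcongr
          exact (gradNormSq_le w).trans (pow_le_pow_left₀ (normH1_nonneg _) hwM 2)
      _ ≤ η * P.normSq lw ^ 2 + B₂ ^ 2 * M ^ 2 := by
          have : 0 ≤ η * P.normSq lw ^ 2 := by positivity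
          linarith

/-- The nonlinear estimate in dimensions one to three. -/
theorem exists_nonlinearBound (hd1 : 1 ≤ d) (hd3 : d ≤ 3) (P : Domain d) {g : ℝ → ℝ}
    (hg : ContDiff ℝ 2 g) (hgrowth : 2 ≤ d → ∃ p K : ℝ, 0 < p ∧ (d = 3 → p < 4) ∧
      ∀ s, |deriv (deriv g) s| ≤ K * (|s| ^ p + 1)) {M η : ℝ} (hM : 0 ≤ M) (hη : 0 < η) :
    ∃ C : ℝ, 0 ≤ C ∧ ∀ w lw, P.HasLaplacian w lw →
      P.normH1 w ≤ M → P.NonlinearBound g η C w lw := by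
  have growth : ∀ {p K : ℝ} {k : ℕ}, 0 < p → p < k →
      (∀ s, |deriv (deriv g) s| ≤ K * (|s| ^ p + 1)) →
      ∀ η : ℝ, 0 < η → ∃ C : ℝ, 0 ≤ C ∧ ∀ s, |deriv (deriv g) s| ≤ η * |s| ^ k + C := by
    intro p K k hp hpk hb η hη
    obtain ⟨C, hC0, hC⟩ := exists_rpow_le hp hpk (η := η / (|K| + 1)) (by positivity)
    refine ⟨|K| * (C + 1), by positivity, fun s => ?_⟩
    calc |deriv (deriv g) s| ≤ K * (|s| ^ p + 1) := hb s
      _ ≤ |K| * (|s| ^ p + 1) := by gcongr; exact le_abs_self K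
      _ ≤ |K| * (η / (|K| + 1) * |s| ^ k + C + 1) := by gcongr; exact hC s
      _ = |K| / (|K| + 1) * (η * |s| ^ k) + |K| * (C + 1) := by field_simp; ring
      _ ≤ 1 * (η * |s| ^ k) + |K| * (C + 1) := by
          gcongr
          rw [div_le_one (by positivity)]; linarith
      _ = _ := by ring
  interval_cases d
  · exact P.nonlinearBound_one hg hM hη
  · obtain ⟨p, K, hp, -, hb⟩ := hgrowth le_rfl
    obtain ⟨k, hk⟩ := exists_nat_gt p
    exact (powBound_two P k).nonlinearBound hg (growth hp hk hb) hM hη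
  · obtain ⟨p, K, hp, hp4, hb⟩ := hgrowth (by norm_num)
    exact (powBound_three P).nonlinearBound hg (growth (k := 4) hp (by exact_mod_cast hp4 rfl) hb)
      hM hη

/-- On bounded sets, the potential energy is bounded away from zero. -/
theorem exists_E1_lower_bound (P : Domain d) {g : ℝ → ℝ} (hg : Continuous g) {C₀ : ℝ}
    (hpos : ∀ s : ℝ, 0 < P.E1 g C₀ fun _ => s) (M : ℝ) :
    ∃ e : ℝ, 0 < e ∧ ∀ w, MemLp w 2 P.vol → P.normSq w ≤ M ^ 2 →
      Integrable (fun x => g (w x)) P.vol → e ≤ P.E1 g C₀ w := by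
  set v := P.vol.real Set.univ with hv
  have hv0 : 0 < v := P.vol_univ_pos
  have hpos' : ∀ s, 0 < v * g s + C₀ := fun s => by
    have := hpos s
    simpa [E1, hv] using this
  have hbdd : BddBelow (Set.range g) := by
    refine ⟨-C₀ / v, ?_⟩
    rintro _ ⟨s, rfl⟩
    rw [div_le_iff₀ hv0]
    linarith [hpos' s]
  set m := ⨅ s, g s with hm
  have hmg : ∀ s, m ≤ g s := fun s => ciInf_le hbdd s
  have hmv : 0 ≤ v * m + C₀ := by
    have h1 : -C₀ / v ≤ m := le_ciInf fun s => by
      rw [div_le_iff₀ hv0]; linarith [hpos' s]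
    rw [div_le_iff₀ hv0] at h1
    linarith
  set R : ℝ := √(2 * M ^ 2 / v + 1) with hR
  have hR0 : 0 ≤ R := Real.sqrt_nonneg _
  have hR2 : R ^ 2 = 2 * M ^ 2 / v + 1 := Real.sq_sqrt (by positivity)
  obtain ⟨s₁, _, hs₁⟩ := (isCompact_Icc (a := -R) (b := R)).exists_isMinOn
    ⟨0, by simpa using hR0⟩ hg.continuousOn
  have hs₁' : ∀ s, |s| ≤ R → g s₁ ≤ g s := fun s hs => hs₁ (abs_le.1 hs)
  refine ⟨v / 2 * (g s₁ - m) + (v * m + C₀), ?_, fun w hw hwM hgw => ?_⟩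
  · rcases (hmg s₁).eq_or_lt with h | h
    · rw [← h]
      have := hpos' s₁
      rw [← h] at this
      linarith
    · have : 0 < v / 2 * (g s₁ - m) := by
        have := sub_pos.2 h
        positivity
      linarith
  · -- on the set where `|w| ≤ R` use the minimum over `[-R, R]`, elsewhere the infimum
    have hR2pos : 0 < R ^ 2 := by rw [hR2]; positivity
    have hδ : 0 ≤ g s₁ - m := sub_nonneg.2 (hmg s₁)
    have hpt : ∀ x, g s₁ - (g s₁ - m) / R ^ 2 * w x ^ 2 ≤ g (w x) := by
      intro x
      rcases le_or_gt |w x| R with h | h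
      · have : 0 ≤ (g s₁ - m) / R ^ 2 * w x ^ 2 := by positivity
        linarith [hs₁' _ h]
      · have h1 : R ^ 2 ≤ w x ^ 2 := by
          rw [← sq_abs (w x)]
          exact pow_le_pow_left₀ hR0 h.le 2
        have h2 : g s₁ - m ≤ (g s₁ - m) / R ^ 2 * w x ^ 2 := by
          rw [div_mul_eq_mul_div, le_div_iff₀ hR2pos]
          gcongr
        linarith [hmg (w x)]
    have hi : Integrable (fun x => g s₁ - (g s₁ - m) / R ^ 2 * w x ^ 2) P.vol :=
      (integrable_const (g s₁)).sub (hw.integrable_sq.const_mul ((g s₁ - m) / R ^ 2))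
    have hInt := integral_mono hi hgw hpt
    rw [integral_sub (integrable_const _) (hw.integrable_sq.const_mul _), integral_const_mul,
      integral_const, smul_eq_mul] at hInt
    have h3 : (g s₁ - m) / R ^ 2 * ∫ x, w x ^ 2 ∂P.vol ≤ (g s₁ - m) * (v / 2) := by
      have h4 : ∫ x, w x ^ 2 ∂P.vol ≤ R ^ 2 * (v / 2) := by
        refine le_trans hwM ?_
        rw [hR2]
        have : (2 * M ^ 2 / v + 1) * (v / 2) = M ^ 2 + v / 2 := by field_simp
        rw [this]; linarith
      calc (g s₁ - m) / R ^ 2 * ∫ x, w x ^ 2 ∂P.vol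
          ≤ (g s₁ - m) / R ^ 2 * (R ^ 2 * (v / 2)) := by gcongr
        _ = (g s₁ - m) * (v / 2) := by rw [← mul_assoc, div_mul_cancel₀ _ hR2pos.ne']
    rw [E1]
    linarith

lemma memH2BC_const (P : Domain d) (c : ℝ) : P.MemH2BC fun _ => c := by
  have hc : P.MemH1 fun _ => c := ⟨memLp_const c, fun i => ⟨_, hasWeakPartial_const i c⟩⟩
  have hp : ∀ i, P.weakPartial i (fun _ => c) =ᵐ[P.vol] fun _ => 0 := fun i =>
    (hasWeakPartial_const i c).weakPartial_ae_eq hc.1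
  refine ⟨⟨hc, fun i => ⟨hc.memLp_weakPartial i, fun j => ⟨fun _ => 0, ?_⟩⟩⟩, fun _ => 0, hc,
    by simp, fun ψ _ => ?_⟩
  · exact (hasWeakPartial_const (P := P) j 0).congr (hp i).symm EventuallyEq.rfl
  · simp only [zero_mul, integral_zero, neg_zero]
    refine Finset.sum_eq_zero fun i _ => ?_
    rw [integral_congr_ae (g := fun _ => (0 : ℝ)), integral_zero]
    filter_upwards [hp i] with x hx
    rw [hx, zero_mul]

end Domain

end VBDF2

namespace VBDF2

variable {d : ℕ}

open Filter Topology

/-- The weight `z^{3/2} / (1 + z)` of the discrete energy. -/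
def weight (z : ℝ) : ℝ := z ^ (3 / 2 : ℝ) / (1 + z)

lemma rpow_three_halves {z : ℝ} (hz : 0 ≤ z) : z ^ (3 / 2 : ℝ) = z * √z := by
  rw [Real.sqrt_eq_rpow, ← Real.rpow_one_add' hz (by norm_num)]
  norm_num

lemma weight_nonneg {z : ℝ} (hz : 0 ≤ z) : 0 ≤ weight z := by
  unfold weight; positivity

lemma weight_le_weight {s z : ℝ} (hs : 0 ≤ s) (hsz : s ≤ z) : weight s ≤ weight z := by
  have hz := hs.trans hsz
  rw [weight, weight, rpow_three_halves hs, rpow_three_halves hz,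
    div_le_div_iff₀ (by linarith) (by linarith)]
  have h := Real.sqrt_le_sqrt hsz
  have h1 : s * √s ≤ z * √z := mul_le_mul hsz h (Real.sqrt_nonneg _) hz
  have h2 : s * z * √s ≤ s * z * √z := mul_le_mul_of_nonneg_left h (mul_nonneg hs hz)
  nlinarith

lemma weight_lt_weight {s z : ℝ} (hs : 0 < s) (hsz : s < z) : weight s < weight z := by
  have hz := hs.trans hsz
  rw [weight, weight, rpow_three_halves hs.le, rpow_three_halves hz.le,
    div_lt_div_iff₀ (by linarith) (by linarith)]
  have h := Real.sqrt_lt_sqrt hs.le hsz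
  have h1 : s * √s < z * √z := mul_lt_mul'' hsz h hs.le (Real.sqrt_nonneg _)
  have h2 : s * z * √s < s * z * √z := mul_lt_mul_of_pos_left h (mul_pos hs hz)
  nlinarith

lemma mul_sqrt_of_G_eq_zero {a : ℝ} (ha : 0 < a) (h : G a a = 0) : a * √a = 1 + 2 * a := by
  rw [G, rpow_three_halves ha.le, ← sub_div, div_eq_zero_iff] at h
  rcases h with h | h <;> linarith

/-- The coercivity margin `G(s, z) ≥ weight a - weight b` for step ratios `s, z ≤ b`. -/
lemma weight_gap {a b s z : ℝ} (ha : 0 < a) (h : G a a = 0) (hba : b ≤ a) (hs : 0 ≤ s)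
    (hsb : s ≤ b) (hz : 0 ≤ z) (hzb : z ≤ b) :
    weight a - weight b + weight z ≤ 2 * ((1 + 2 * s) / (1 + s)) - weight s := by
  have e := mul_sqrt_of_G_eq_zero ha h
  have h1 := weight_le_weight hz hzb
  have h2 : weight a ≤ 2 * ((1 + 2 * s) / (1 + s)) - weight s := by
    have h3 : 2 * ((1 + 2 * s) / (1 + s)) - weight s = (2 + 4 * s - s * √s) / (1 + s) := by
      rw [weight, rpow_three_halves hs]
      field_simp
      ring
    rw [h3, weight, rpow_three_halves ha.le, e, div_le_div_iff₀ (by linarith) (by linarith)]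
    have h4 : s * √s ≤ s * √a :=
      mul_le_mul_of_nonneg_left (Real.sqrt_le_sqrt (hsb.trans hba)) hs
    have h5 : a * (s * √a) = s * (1 + 2 * a) := by rw [← e]; ring
    have h6 : (1 + 2 * a) * (1 + s) ≤ (2 + 4 * s - s * √a) * (1 + a) := by
      refine le_of_mul_le_mul_left ?_ ha
      nlinarith [hsb.trans hba]
    nlinarith
  linarith

section Discrete

open scoped RealInnerProductSpace

variable {H K : Type*} [NormedAddCommGroup H] [NormedAddCommGroup K]

/-- The dissipation term `‖x n - x (n-1)‖² / τ n`. -/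
def dissip (τ : ℕ → ℝ) (x : ℕ → H) (n : ℕ) : ℝ := ‖x n - x (n - 1)‖ ^ 2 / τ n

lemma dissip_zero (τ : ℕ → ℝ) (x : ℕ → H) : dissip τ x 0 = 0 := by simp [dissip]

variable {γs T : ℝ} {N : ℕ} {τ : ℕ → ℝ}

lemma IsMesh.nonneg (h : IsMesh γs T N τ) (h0 : τ 0 = 0) {n : ℕ} (hn : n ≤ N) : 0 ≤ τ n := by
  rcases n.eq_zero_or_pos with rfl | hp
  · exact h0.ge
  · exact (h.pos n hp (by omega)).le

lemma dissip_nonneg (h : IsMesh γs T N τ) (h0 : τ 0 = 0) (x : ℕ → H) {n : ℕ} (hn : n ≤ N) :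
    0 ≤ dissip τ x n := div_nonneg (sq_nonneg _) (h.nonneg h0 hn)

lemma IsMesh.ratio_nonneg (h : IsMesh γs T N τ) (h0 : τ 0 = 0) {n : ℕ} (hn : n ≤ N) :
    0 ≤ ratio τ (n + 1) :=
  div_nonneg (h.pos _ (by omega) (by omega)).le (h.nonneg h0 (by simpa using hn))

lemma IsMesh.ratio_le' (h : IsMesh γs T N τ) (h0 : τ 0 = 0) (hγ : 0 ≤ γs) {n : ℕ} (hn : n ≤ N) :
    ratio τ (n + 1) ≤ γs := by
  rcases n.eq_zero_or_pos with rfl | hp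
  · simpa [ratio, h0] using hγ
  · exact h.ratio_le _ (by omega) (by omega)

/-- The ratio over the current step is the inverse of the previous step (also at the start). -/
lemma IsMesh.ratio_div (h : IsMesh γs T N τ) {n : ℕ} (hn : n ≤ N) :
    ratio τ (n + 1) / τ (n + 1) = (τ n)⁻¹ := by
  have := (h.pos (n + 1) (by omega) (by omega)).ne'
  rw [ratio, Nat.add_sub_cancel, div_div, div_eq_inv_mul, mul_inv, mul_assoc, inv_mul_cancel₀ this,
    mul_one]

lemma IsMesh.sum_le (h : IsMesh γs T N τ) {m : ℕ} (hm : m ≤ N) :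
    ∑ n ∈ Finset.Icc 1 m, τ n ≤ T := by
  rw [← h.sum_eq]
  refine Finset.sum_le_sum_of_subset_of_nonneg (Finset.Icc_subset_Icc_right hm) fun n hn _ => ?_
  rw [Finset.mem_Icc] at hn
  exact (h.pos n hn.1 (by omega)).le

lemma IsMesh.time_nonneg (h : IsMesh γs T N τ) : 0 ≤ T := by
  simpa using h.sum_le (m := 0) (by omega)

/-- The total displacement is controlled by the total dissipation. -/
lemma IsMesh.norm_sub_sq_le (h : IsMesh γs T N τ) (x : ℕ → H) {m : ℕ} (hm : m ≤ N) :
    ‖x m - x 0‖ ^ 2 ≤ T * ∑ n ∈ Finset.Icc 1 m, dissip τ x n := by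
  have hpos : ∀ n ∈ Finset.Icc 1 m, 0 < τ n := fun n hn => by
    rw [Finset.mem_Icc] at hn
    exact h.pos n hn.1 (by omega)
  have h1 : ‖x m - x 0‖ ≤ ∑ n ∈ Finset.Icc 1 m, ‖x n - x (n - 1)‖ := by
    clear hpos hm
    induction m with
    | zero => simp
    | succ m ih =>
      rw [Finset.sum_Icc_succ_top (by omega), Nat.add_sub_cancel]
      have := norm_add_le (x m - x 0) (x (m + 1) - x m)
      rw [show x m - x 0 + (x (m + 1) - x m) = x (m + 1) - x 0 by abel] at this
      linarith
  have hD : 0 ≤ ∑ n ∈ Finset.Icc 1 m, dissip τ x n :=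
    Finset.sum_nonneg fun n hn => div_nonneg (sq_nonneg _) (hpos n hn).le
  calc ‖x m - x 0‖ ^ 2 ≤ (∑ n ∈ Finset.Icc 1 m, ‖x n - x (n - 1)‖) ^ 2 := by gcongr
    _ ≤ (∑ n ∈ Finset.Icc 1 m, τ n) * ∑ n ∈ Finset.Icc 1 m, dissip τ x n :=
        Finset.sum_sq_le_sum_mul_sum_of_sq_le_mul _ (fun n hn => (hpos n hn).le)
          (fun n hn => div_nonneg (sq_nonneg _) (hpos n hn).le) (fun n hn => by
            rw [dissip, mul_div_cancel₀ _ (hpos n hn).ne'])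
    _ ≤ T * ∑ n ∈ Finset.Icc 1 m, dissip τ x n := by gcongr; exact h.sum_le hm

variable [InnerProductSpace ℝ H] [InnerProductSpace ℝ K]

/-- The difference quotient of the scheme in increment form. If `τ 0 = 0` the value at `0` is the
first order quotient. -/
def quot (τ : ℕ → ℝ) (x : ℕ → H) (n : ℕ) : H :=
  (τ (n + 1))⁻¹ • (((1 + 2 * ratio τ (n + 1)) / (1 + ratio τ (n + 1))) • (x (n + 1) - x n)
    - (ratio τ (n + 1) ^ 2 / (1 + ratio τ (n + 1))) • (x n - x (n - 1)))

/-- Coercivity of the variable step difference quotient. -/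
theorem IsMesh.le_inner_quot (h : IsMesh γs T N τ) (h0 : τ 0 = 0) (hγ : 0 ≤ γs) {a : ℝ}
    (ha : 0 < a) (hroot : G a a = 0) (hγa : γs ≤ a) (x : ℕ → H) {n : ℕ} (hn : n < N) :
    (weight a - weight γs) / 2 * dissip τ x (n + 1)
      + weight (ratio τ (n + 2)) / 2 * dissip τ x (n + 1) - weight (ratio τ (n + 1)) / 2 * dissip τ x n
      ≤ ⟪quot τ x n, x (n + 1) - x n⟫ := by
  have hs := h.ratio_nonneg h0 hn.le
  have hsb := h.ratio_le' h0 hγ hn.le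
  have hz := h.ratio_nonneg h0 (n := n + 1) hn
  have hzb := h.ratio_le' h0 hγ (n := n + 1) hn
  have hgap := weight_gap ha hroot hγa hs hsb hz hzb
  have hdiv := h.ratio_div hn.le
  have hτ := h.pos (n + 1) (by omega) (by omega)
  simp only [show n + 1 + 1 = n + 2 from rfl] at hz hzb hgap
  set s := ratio τ (n + 1)
  set z := ratio τ (n + 2)
  set u := x (n + 1) - x n with hu
  set v := x n - x (n - 1) with hv
  have e1 : dissip τ x (n + 1) = ‖u‖ ^ 2 / τ (n + 1) := by simp [dissip, hu]
  have e2 : dissip τ x n = s * ‖v‖ ^ 2 / τ (n + 1) := by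
    rw [dissip, ← hv, mul_comm, mul_div_assoc, hdiv, div_eq_mul_inv]
  have e3 : ⟪quot τ x n, u⟫ = ((1 + 2 * s) / (1 + s) * ‖u‖ ^ 2 - s ^ 2 / (1 + s) * ⟪v, u⟫)
      / τ (n + 1) := by
    rw [quot, real_inner_smul_left, inner_sub_left, real_inner_smul_left, real_inner_smul_left,
      real_inner_self_eq_norm_sq]
    ring
  have hcross : s ^ 2 / (1 + s) * ⟪v, u⟫ ≤ weight s / 2 * (‖u‖ ^ 2 + s * ‖v‖ ^ 2) := by
    have h1 : ⟪v, u⟫ ≤ ‖v‖ * ‖u‖ := real_inner_le_norm _ _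
    have h2 : s ^ 2 / (1 + s) = weight s * √s := by
      rw [weight, rpow_three_halves hs, div_mul_eq_mul_div, mul_assoc, Real.mul_self_sqrt hs, sq]
    have h3 : √s * (‖v‖ * ‖u‖) ≤ (‖u‖ ^ 2 + s * ‖v‖ ^ 2) / 2 := by
      nlinarith [sq_nonneg (‖u‖ - √s * ‖v‖), Real.sq_sqrt hs]
    calc s ^ 2 / (1 + s) * ⟪v, u⟫ ≤ s ^ 2 / (1 + s) * (‖v‖ * ‖u‖) := by gcongr
      _ = weight s * (√s * (‖v‖ * ‖u‖)) := by rw [h2]; ring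
      _ ≤ weight s * ((‖u‖ ^ 2 + s * ‖v‖ ^ 2) / 2) :=
          mul_le_mul_of_nonneg_left h3 (weight_nonneg hs)
      _ = _ := by ring
  rw [e1, e2, e3]
  have e4 : (weight a - weight γs) / 2 * (‖u‖ ^ 2 / τ (n + 1))
      + weight z / 2 * (‖u‖ ^ 2 / τ (n + 1)) - weight s / 2 * (s * ‖v‖ ^ 2 / τ (n + 1))
      = ((weight a - weight γs + weight z) * (‖u‖ ^ 2 / 2) - weight s / 2 * (s * ‖v‖ ^ 2))
        / τ (n + 1) := by ring
  rw [e4, div_le_div_iff_of_pos_right hτ]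
  have h5 := mul_le_mul_of_nonneg_right hgap (by positivity : 0 ≤ ‖u‖ ^ 2 / 2)
  linarith

lemma half_sq_sub_le (x y : H) : ‖x‖ ^ 2 / 2 - ‖y‖ ^ 2 / 2 ≤ ⟪x, x - y⟫ := by
  rw [inner_sub_right, real_inner_self_eq_norm_sq]
  nlinarith [real_inner_le_norm x y, sq_nonneg (‖x‖ - ‖y‖)]

lemma sum_Icc_succ_le {f g : ℕ → ℝ} {e : ℕ → ℝ} {m : ℕ}
    (h : ∀ n < m, e (n + 1) + f (n + 1) ≤ e n + g (n + 1)) :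
    e m + ∑ n ∈ Finset.Icc 1 m, f n ≤ e 0 + ∑ n ∈ Finset.Icc 1 m, g n := by
  induction m with
  | zero => simp
  | succ m ih =>
    rw [Finset.sum_Icc_succ_top (by omega), Finset.sum_Icc_succ_top (by omega)]
    have := ih fun n hn => h n (by omega)
    linarith [h m (by omega)]

/-- The discrete energy law. -/
theorem IsMesh.energy_le (h : IsMesh γs T N τ) (h0 : τ 0 = 0) (hγ : 0 ≤ γs) {c : ℝ}
    (hc : 0 < c) (hroot : G c c = 0) (hγc : γs ≤ c) {ε lam : ℝ} (hlam : 0 ≤ lam)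
    {a l z : ℕ → H} {b : ℕ → K} {r : ℕ → ℝ}
    (heq : ∀ n < N, quot τ a n = ε ^ 2 • l (n + 1) - lam • a (n + 1) - z (n + 1))
    (hl : ∀ i ≤ N, ∀ j ≤ N, ⟪a i, l j⟫ = - ⟪b i, b j⟫)
    (hr : ∀ n < N, ⟪z (n + 1), a (n + 1) - a n⟫ = 2 * r (n + 1) * (r (n + 1) - r n))
    {m : ℕ} (hm : m ≤ N) :
    ε ^ 2 / 2 * ‖b m‖ ^ 2 + lam / 2 * ‖a m‖ ^ 2 + r m ^ 2
      + (weight c - weight γs) / 2 * ∑ n ∈ Finset.Icc 1 m, dissip τ a n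
      ≤ ε ^ 2 / 2 * ‖b 0‖ ^ 2 + lam / 2 * ‖a 0‖ ^ 2 + r 0 ^ 2 := by
  have key := sum_Icc_succ_le (m := m) (g := fun _ => 0)
    (f := fun n => (weight c - weight γs) / 2 * dissip τ a n)
    (e := fun n => ε ^ 2 / 2 * ‖b n‖ ^ 2 + lam / 2 * ‖a n‖ ^ 2 + r n ^ 2
      + weight (ratio τ (n + 1)) / 2 * dissip τ a n) (by
    intro n hn
    have hnN : n < N := by omega
    have h1 := h.le_inner_quot h0 hγ hc hroot hγc a hnN
    rw [heq n hnN, inner_sub_left, inner_sub_left, real_inner_smul_left, real_inner_smul_left,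
      hr n hnN] at h1
    have h2 : ⟪l (n + 1), a (n + 1) - a n⟫ = - ⟪b (n + 1), b (n + 1) - b n⟫ := by
      rw [inner_sub_right, inner_sub_right, real_inner_comm, hl _ (by omega) _ (by omega),
        real_inner_comm _ (l (n + 1)), hl _ (by omega) _ (by omega),
        real_inner_comm (b (n + 1)) (b n)]
      ring
    rw [h2] at h1
    have h3 := mul_le_mul_of_nonneg_left (half_sq_sub_le (b (n + 1)) (b n)) (sq_nonneg ε)
    have h4 := mul_le_mul_of_nonneg_left (half_sq_sub_le (a (n + 1)) (a n)) hlam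
    have h5 := sq_nonneg (r (n + 1) - r n)
    show _ + weight (ratio τ (n + 2)) / 2 * _ + _ ≤ _
    linarith)
  simp only [dissip_zero, mul_zero, add_zero, Finset.sum_const_zero] at key
  have h6 : 0 ≤ weight (ratio τ (m + 1)) / 2 * dissip τ a m :=
    mul_nonneg (div_nonneg (weight_nonneg (h.ratio_nonneg h0 hm)) two_pos.le)
      (dissip_nonneg h h0 a hm)
  rw [Finset.mul_sum]
  linarith

end Discrete

end VBDF2

namespace VBDF2

variable {d : ℕ}

open Filter Topology

section Discrete

variable {H K : Type*} [NormedAddCommGroup H] [NormedAddCommGroup K]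

open scoped RealInnerProductSpace

variable {γs T : ℝ} {N : ℕ} {τ : ℕ → ℝ}

lemma sum_Icc_pred_le {f : ℕ → ℝ} (h0 : f 0 = 0) {m : ℕ} (hf : ∀ n ≤ m, 0 ≤ f n) :
    ∑ n ∈ Finset.Icc 1 m, f (n - 1) ≤ ∑ n ∈ Finset.Icc 1 m, f n := by
  have key : ∑ n ∈ Finset.Icc 1 m, f (n - 1) + f m = ∑ n ∈ Finset.Icc 1 m, f n + f 0 := by
    clear hf
    induction m with
    | zero => simp
    | succ m ih =>
      rw [Finset.sum_Icc_succ_top (by omega), Finset.sum_Icc_succ_top (by omega),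
        Nat.add_sub_cancel]
      linarith
  linarith [hf m le_rfl]

/-- The forcing is controlled by the Laplacians of the two previous steps. -/
lemma IsMesh.mul_norm_forcing_sq_le (h : IsMesh γs T N τ) (h0 : τ 0 = 0) (hγ : 1 ≤ γs)
    {η C : ℝ} (hη : 0 ≤ η) {ζ : K} {l : ℕ → H} {n : ℕ} (hn : n < N)
    (hζ : ‖ζ‖ ^ 2 ≤ η * ((if n = 0 then 0 else ‖l n‖ ^ 4)
      + if n - 1 = 0 then 0 else ‖l (n - 1)‖ ^ 4) + C) :
    τ (n + 1) * ‖ζ‖ ^ 2 ≤ η * γs ^ 2 * (τ n * ‖l n‖ ^ 4 + τ (n - 1) * ‖l (n - 1)‖ ^ 4)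
      + C * τ (n + 1) := by
  have hγ0 : 0 ≤ γs := by linarith
  have hτ := h.pos (n + 1) (by omega) (by omega)
  have step : ∀ k, 1 ≤ k → k ≤ n → τ (k + 1) ≤ γs * τ k := fun k hk hk' => by
    have := h.ratio_le (k + 1) (by omega) (by omega)
    rwa [ratio, Nat.add_sub_cancel, div_le_iff₀ (h.pos k hk (by omega))] at this
  have hn0 := h.nonneg h0 hn.le
  have h1 : τ (n + 1) * (if n = 0 then 0 else ‖l n‖ ^ 4) ≤ γs ^ 2 * (τ n * ‖l n‖ ^ 4) := by
    split_ifs with hn'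
    · simp only [hn', h0]; simp
    · have h2 : τ (n + 1) ≤ γs ^ 2 * τ n :=
        (step n (by omega) le_rfl).trans (by gcongr; nlinarith)
      rw [← mul_assoc]
      gcongr
  have h2 : τ (n + 1) * (if n - 1 = 0 then 0 else ‖l (n - 1)‖ ^ 4)
      ≤ γs ^ 2 * (τ (n - 1) * ‖l (n - 1)‖ ^ 4) := by
    split_ifs with hn'
    · simp only [hn', h0]; simp
    · have h3 : τ (n + 1) ≤ γs ^ 2 * τ (n - 1) := by
        have h4 := step (n - 1) (by omega) (by omega)
        rw [Nat.sub_add_cancel (by omega)] at h4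
        have h5 := mul_le_mul_of_nonneg_left h4 hγ0
        linarith [step n (by omega) le_rfl]
      rw [← mul_assoc]
      gcongr
  have h3 := mul_le_mul_of_nonneg_left hζ hτ.le
  have h4 := mul_le_mul_of_nonneg_left (add_le_add h1 h2) hη
  linarith

variable [InnerProductSpace ℝ H] [InnerProductSpace ℝ K]

lemma inner_quot_left {a : ℕ → H} {b : ℕ → K} {l : H} {b' : K} {n : ℕ}
    (h : ∀ i ≤ n + 1, ⟪a i, l⟫ = - ⟪b i, b'⟫) : ⟪quot τ a n, l⟫ = - ⟪quot τ b n, b'⟫ := by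
  simp only [quot, real_inner_smul_left, inner_sub_left, h (n + 1) le_rfl, h n (by omega),
    h (n - 1) (by omega)]
  ring

lemma IsMesh.mul_norm_quot_sq_le (h : IsMesh γs T N τ) (h0 : τ 0 = 0) (hγ : 0 ≤ γs)
    (x : ℕ → H) {n : ℕ} (hn : n < N) :
    τ (n + 1) * ‖quot τ x n‖ ^ 2 ≤ 8 * dissip τ x (n + 1) + 2 * γs * dissip τ x n := by
  have hs := h.ratio_nonneg h0 hn.le
  have hsb := h.ratio_le' h0 hγ hn.le
  have hdiv := h.ratio_div hn.le
  have hτ := h.pos (n + 1) (by omega) (by omega)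
  have hq := dissip_nonneg h h0 x hn.le
  have e1 : dissip τ x (n + 1) = ‖x (n + 1) - x n‖ ^ 2 / τ (n + 1) := by simp [dissip]
  have e2 : dissip τ x n = ratio τ (n + 1) * ‖x n - x (n - 1)‖ ^ 2 / τ (n + 1) := by
    rw [dissip, mul_comm, mul_div_assoc, hdiv, div_eq_mul_inv]
  set s := ratio τ (n + 1)
  set u := x (n + 1) - x n
  set v := x n - x (n - 1)
  have h1 : ‖quot τ x n‖ ≤ (τ (n + 1))⁻¹ * (2 * ‖u‖ + s * ‖v‖) := by
    rw [quot, norm_smul, Real.norm_of_nonneg (inv_nonneg.2 hτ.le)]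
    refine mul_le_mul_of_nonneg_left ((norm_sub_le _ _).trans ?_) (inv_nonneg.2 hτ.le)
    rw [norm_smul, norm_smul, Real.norm_of_nonneg (by positivity),
      Real.norm_of_nonneg (by positivity)]
    have c1 : (1 + 2 * s) / (1 + s) ≤ 2 := by rw [div_le_iff₀ (by positivity)]; linarith
    have c2 : s ^ 2 / (1 + s) ≤ s := by rw [div_le_iff₀ (by positivity)]; nlinarith
    gcongr
  have h2 : τ (n + 1) * ‖quot τ x n‖ ^ 2
      ≤ τ (n + 1) * ((τ (n + 1))⁻¹ * (2 * ‖u‖ + s * ‖v‖)) ^ 2 := by gcongr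
  have h3 : τ (n + 1) * ((τ (n + 1))⁻¹ * (2 * ‖u‖ + s * ‖v‖)) ^ 2
      = (2 * ‖u‖ + s * ‖v‖) ^ 2 / τ (n + 1) := by field_simp
  have h4 : (2 * ‖u‖ + s * ‖v‖) ^ 2 / τ (n + 1)
      ≤ (8 * ‖u‖ ^ 2 + 2 * s * (s * ‖v‖ ^ 2)) / τ (n + 1) := by
    gcongr
    nlinarith [sq_nonneg (2 * ‖u‖ - s * ‖v‖)]
  have h5 : (8 * ‖u‖ ^ 2 + 2 * s * (s * ‖v‖ ^ 2)) / τ (n + 1)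
      = 8 * dissip τ x (n + 1) + 2 * s * dissip τ x n := by rw [e1, e2]; ring
  have h6 : 2 * s * dissip τ x n ≤ 2 * γs * dissip τ x n := by gcongr
  linarith

/-- The constant relating the fourth power of the Laplacian to the dissipation. -/
def fourthConst (ε lam γs M : ℝ) : ℝ := 3 * M ^ 2 / ε ^ 4 * (9 + 2 * γs + lam ^ 2 * M ^ 2)

lemma fourthConst_nonneg {ε lam γs M : ℝ} (hγ : 0 ≤ γs) : 0 ≤ fourthConst ε lam γs M := by
  unfold fourthConst; positivity

lemma IsMesh.mul_norm_pow_four_le (h : IsMesh γs T N τ) (h0 : τ 0 = 0) (hγ : 0 ≤ γs)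
    {ε lam M : ℝ} (hε : 0 < ε) {n : ℕ} (hn : n < N) {a : ℕ → H} {b : ℕ → K} {l z : H} {ζ : K}
    (heq : quot τ a n = ε ^ 2 • l - lam • a (n + 1) - z)
    (hl : ∀ i ≤ n + 1, ⟪a i, l⟫ = - ⟪b i, b (n + 1)⟫) (hz : ⟪z, l⟫ = - ⟪ζ, b (n + 1)⟫)
    (hb : ‖b (n + 1)‖ ≤ M) :
    τ (n + 1) * ‖l‖ ^ 4 ≤ fourthConst ε lam γs M * (dissip τ b (n + 1) + dissip τ b n
      + τ (n + 1) * ‖ζ‖ ^ 2 + τ (n + 1)) := by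
  have hM : 0 ≤ M := (norm_nonneg _).trans hb
  have hτ := h.pos (n + 1) (by omega) (by omega)
  have hq0 := dissip_nonneg h h0 b hn.le
  have hq1 := dissip_nonneg h h0 b (n := n + 1) hn
  have e1 : ε ^ 2 * ‖l‖ ^ 2 = - ⟪quot τ b n + lam • b (n + 1) + ζ, b (n + 1)⟫ := by
    have e2 : ε ^ 2 • l = quot τ a n + lam • a (n + 1) + z := by rw [heq]; abel
    rw [← real_inner_self_eq_norm_sq, ← real_inner_smul_left, e2, inner_add_left, inner_add_left,
      inner_add_left, inner_add_left, real_inner_smul_left, real_inner_smul_left,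
      inner_quot_left hl, hl _ le_rfl, hz]
    ring
  have e3 : ε ^ 2 * ‖l‖ ^ 2 ≤ (‖quot τ b n‖ + |lam| * M + ‖ζ‖) * M := by
    rw [e1, ← inner_neg_left]
    refine (real_inner_le_norm _ _).trans ?_
    rw [norm_neg]
    refine mul_le_mul (norm_add₃_le.trans ?_) hb (norm_nonneg _) (by positivity)
    rw [norm_smul, Real.norm_eq_abs]
    gcongr
  have e4 : (ε ^ 2 * ‖l‖ ^ 2) ^ 2
      ≤ 3 * M ^ 2 * (‖quot τ b n‖ ^ 2 + lam ^ 2 * M ^ 2 + ‖ζ‖ ^ 2) := by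
    refine (pow_le_pow_left₀ (by positivity) e3 2).trans ?_
    rw [← sq_abs lam, mul_pow]
    have : (‖quot τ b n‖ + |lam| * M + ‖ζ‖) ^ 2
        ≤ 3 * (‖quot τ b n‖ ^ 2 + |lam| ^ 2 * M ^ 2 + ‖ζ‖ ^ 2) := by
      nlinarith [sq_nonneg (‖quot τ b n‖ - |lam| * M), sq_nonneg (‖quot τ b n‖ - ‖ζ‖),
        sq_nonneg (|lam| * M - ‖ζ‖)]
    nlinarith [sq_nonneg M]
  have e5 : τ (n + 1) * ‖l‖ ^ 4 ≤ 3 * M ^ 2 / ε ^ 4 * (τ (n + 1) * ‖quot τ b n‖ ^ 2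
      + lam ^ 2 * M ^ 2 * τ (n + 1) + τ (n + 1) * ‖ζ‖ ^ 2) := by
    rw [div_mul_eq_mul_div, le_div_iff₀ (by positivity)]
    have := mul_le_mul_of_nonneg_left e4 hτ.le
    nlinarith
  refine e5.trans ?_
  rw [fourthConst, mul_assoc (3 * M ^ 2 / ε ^ 4)]
  refine mul_le_mul_of_nonneg_left ?_ (by positivity)
  have e6 := h.mul_norm_quot_sq_le h0 hγ b hn
  have p1 : 0 ≤ lam ^ 2 * M ^ 2 := by positivity
  have p2 : 0 ≤ τ (n + 1) * ‖ζ‖ ^ 2 := by positivity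
  nlinarith [mul_nonneg hγ hq1, mul_nonneg p1 hq0, mul_nonneg p1 hq1, mul_nonneg p1 p2,
    mul_nonneg hγ p2, mul_nonneg hγ hτ.le]

/-- The discrete second energy estimate. -/
theorem IsMesh.second_energy_le (h : IsMesh γs T N τ) (h0 : τ 0 = 0) (hγ : 1 ≤ γs) {c : ℝ}
    (hc : 0 < c) (hroot : G c c = 0) (hγc : γs < c) {ε lam M η C : ℝ} (hε : 0 < ε)
    (hlam : 0 ≤ lam) (hη : 0 ≤ η) (hC : 0 ≤ C)
    (hη1 : 4 * (η * γs ^ 2 * fourthConst ε lam γs M) ≤ 1)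
    (hη2 : 32 * (η * γs ^ 2 * fourthConst ε lam γs M) ≤ (weight c - weight γs) ^ 2)
    {a l z : ℕ → H} {b ζ : ℕ → K}
    (heq : ∀ n < N, quot τ a n = ε ^ 2 • l (n + 1) - lam • a (n + 1) - z (n + 1))
    (hl : ∀ i ≤ N, ∀ j ≤ N, ⟪a i, l j⟫ = - ⟪b i, b j⟫)
    (hz : ∀ n < N, ∀ j ≤ N, ⟪z (n + 1), l j⟫ = - ⟪ζ (n + 1), b j⟫)
    (hb : ∀ n ≤ N, ‖b n‖ ≤ M)
    (hζ : ∀ n < N, ‖ζ (n + 1)‖ ^ 2 ≤ η * ((if n = 0 then 0 else ‖l n‖ ^ 4)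
      + if n - 1 = 0 then 0 else ‖l (n - 1)‖ ^ 4) + C) {m : ℕ} (hm : m ≤ N) :
    weight (ratio τ (m + 1)) / 2 * dissip τ b m + ε ^ 2 / 2 * ‖l m‖ ^ 2 + lam / 2 * ‖b m‖ ^ 2
      ≤ ε ^ 2 / 2 * ‖l 0‖ ^ 2 + lam / 2 * ‖b 0‖ ^ 2
        + (1 + 2 * C) / (weight c - weight γs) * T := by
  have hγ0 : 0 ≤ γs := by linarith
  set δ := weight c - weight γs with hδ
  have hδ0 : 0 < δ := sub_pos.2 (weight_lt_weight (by linarith) hγc)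
  set K₀ := fourthConst ε lam γs M
  have hK₀ : 0 ≤ K₀ := fourthConst_nonneg hγ0
  set q := dissip τ b
  have hq : ∀ n ≤ N, 0 ≤ q n := fun n hn => dissip_nonneg h h0 b hn
  have hq0 : q 0 = 0 := dissip_zero _ _
  set S : ℕ → ℝ := fun n => τ n * ‖ζ n‖ ^ 2 with hS
  set R : ℕ → ℝ := fun n => τ n * ‖l n‖ ^ 4 with hR
  have hR0 : R 0 = 0 := by simp [hR, h0]
  have hRn : ∀ n ≤ N, 0 ≤ R n := fun n hn =>
    mul_nonneg (h.nonneg h0 hn) (by positivity)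
  have step : ∀ n < N, (weight (ratio τ (n + 2)) / 2 * q (n + 1) + ε ^ 2 / 2 * ‖l (n + 1)‖ ^ 2
      + lam / 2 * ‖b (n + 1)‖ ^ 2) + δ / 4 * q (n + 1)
      ≤ (weight (ratio τ (n + 1)) / 2 * q n + ε ^ 2 / 2 * ‖l n‖ ^ 2 + lam / 2 * ‖b n‖ ^ 2)
        + 1 / δ * S (n + 1) := by
    intro n hn
    have hτ := h.pos (n + 1) (by omega) (by omega)
    have s1 := h.le_inner_quot h0 hγ0 hc hroot hγc.le b hn
    have s2 : ⟪quot τ b n, b (n + 1) - b n⟫ = - (ε ^ 2 * ⟪l (n + 1), l (n + 1) - l n⟫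
        + lam * ⟪b (n + 1), b (n + 1) - b n⟫ + ⟪ζ (n + 1), b (n + 1) - b n⟫) := by
      have t1 : ∀ j ≤ N, ⟪quot τ b n, b j⟫ = - ⟪quot τ a n, l j⟫ := fun j hj => by
        rw [inner_quot_left (b := b) (b' := b j) fun i hi => hl i (by omega) j hj, neg_neg]
      have t2 : ∀ j ≤ N, ⟪quot τ a n, l j⟫ = ε ^ 2 * ⟪l (n + 1), l j⟫ + lam * ⟪b (n + 1), b j⟫
          + ⟪ζ (n + 1), b j⟫ := fun j hj => by
        rw [heq n hn, inner_sub_left, inner_sub_left, real_inner_smul_left, real_inner_smul_left,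
          hl _ (by omega) j hj, hz n hn j hj]
        ring
      simp only [inner_sub_right]
      rw [t1 _ (by omega), t1 _ (by omega), t2 _ (by omega), t2 _ (by omega)]
      ring
    rw [s2] at s1
    have s3 := mul_le_mul_of_nonneg_left (half_sq_sub_le (l (n + 1)) (l n)) (sq_nonneg ε)
    have s4 := mul_le_mul_of_nonneg_left (half_sq_sub_le (b (n + 1)) (b n)) hlam
    have s5 : - ⟪ζ (n + 1), b (n + 1) - b n⟫ ≤ δ / 4 * q (n + 1) + 1 / δ * S (n + 1) := by
      have e1 : q (n + 1) = ‖b (n + 1) - b n‖ ^ 2 / τ (n + 1) := by simp [q, dissip]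
      rw [e1, ← inner_neg_left]
      refine (real_inner_le_norm _ _).trans ?_
      rw [norm_neg]
      simp only [hS]
      set X := ‖ζ (n + 1)‖
      set Y := ‖b (n + 1) - b n‖
      have e2 : δ / 4 * (Y ^ 2 / τ (n + 1)) + 1 / δ * (τ (n + 1) * X ^ 2) - X * Y
          = (δ * Y / 2 - τ (n + 1) * X) ^ 2 / (δ * τ (n + 1)) := by
        field_simp
        ring
      have e3 : 0 ≤ (δ * Y / 2 - τ (n + 1) * X) ^ 2 / (δ * τ (n + 1)) := by positivity
      linarith
    linarith
  have hsum := sum_Icc_succ_le (m := m) (f := fun n => δ / 4 * q n) (g := fun n => 1 / δ * S n)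
    (e := fun n => weight (ratio τ (n + 1)) / 2 * q n + ε ^ 2 / 2 * ‖l n‖ ^ 2
      + lam / 2 * ‖b n‖ ^ 2) fun n hn => step n (by omega)
  simp only [hq0, mul_zero, zero_add, ← Finset.mul_sum] at hsum
  have hSR : ∑ n ∈ Finset.Icc 1 m, S n
      ≤ 2 * (η * γs ^ 2) * ∑ n ∈ Finset.Icc 1 m, R n + C * ∑ n ∈ Finset.Icc 1 m, τ n := by
    have t1 : ∑ n ∈ Finset.Icc 1 m, S n ≤ ∑ n ∈ Finset.Icc 1 m,
        (η * γs ^ 2 * (R (n - 1) + R (n - 1 - 1)) + C * τ n) := by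
      refine Finset.sum_le_sum fun n hn => ?_
      rw [Finset.mem_Icc] at hn
      obtain ⟨k, rfl⟩ : ∃ k, n = k + 1 := ⟨n - 1, by omega⟩
      exact h.mul_norm_forcing_sq_le h0 hγ hη (by omega) (hζ k (by omega))
    rw [Finset.sum_add_distrib, ← Finset.mul_sum, ← Finset.mul_sum, Finset.sum_add_distrib] at t1
    have t2 := sum_Icc_pred_le (f := R) hR0 (m := m) fun n hn => hRn n (by omega)
    have t3 := sum_Icc_pred_le (f := fun n => R (n - 1)) hR0 (m := m)
      fun n hn => hRn _ (by omega)
    have t4 := mul_le_mul_of_nonneg_left (add_le_add t2 (t3.trans t2))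
      (by positivity : 0 ≤ η * γs ^ 2)
    linarith
  have hRS : ∑ n ∈ Finset.Icc 1 m, R n ≤ K₀ * (2 * ∑ n ∈ Finset.Icc 1 m, q n
      + ∑ n ∈ Finset.Icc 1 m, S n + ∑ n ∈ Finset.Icc 1 m, τ n) := by
    have t1 : ∑ n ∈ Finset.Icc 1 m, R n
        ≤ ∑ n ∈ Finset.Icc 1 m, K₀ * (q n + q (n - 1) + S n + τ n) := by
      refine Finset.sum_le_sum fun n hn => ?_
      rw [Finset.mem_Icc] at hn
      obtain ⟨k, rfl⟩ : ∃ k, n = k + 1 := ⟨n - 1, by omega⟩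
      exact h.mul_norm_pow_four_le h0 hγ0 hε (by omega) (heq k (by omega))
        (fun i hi => hl i (by omega) _ (by omega)) (hz k (by omega) _ (by omega))
        (hb _ (by omega))
    rw [← Finset.mul_sum, Finset.sum_add_distrib, Finset.sum_add_distrib,
      Finset.sum_add_distrib] at t1
    have t2 := sum_Icc_pred_le (f := q) hq0 (m := m) fun n hn => hq n (by omega)
    refine t1.trans (mul_le_mul_of_nonneg_left ?_ hK₀)
    linarith
  have hT := h.sum_le hm
  have hqs : 0 ≤ ∑ n ∈ Finset.Icc 1 m, q n := Finset.sum_nonneg fun n hn => hq n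
    ((Finset.mem_Icc.1 hn).2.trans hm)
  have hSs : 0 ≤ ∑ n ∈ Finset.Icc 1 m, S n := Finset.sum_nonneg fun n hn =>
    mul_nonneg (h.nonneg h0 ((Finset.mem_Icc.1 hn).2.trans hm)) (sq_nonneg _)
  have hTs : 0 ≤ ∑ n ∈ Finset.Icc 1 m, τ n := Finset.sum_nonneg fun n hn =>
    h.nonneg h0 ((Finset.mem_Icc.1 hn).2.trans hm)
  set sq := ∑ n ∈ Finset.Icc 1 m, q n
  set sS := ∑ n ∈ Finset.Icc 1 m, S n
  set sT := ∑ n ∈ Finset.Icc 1 m, τ n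
  have hfin : sS ≤ δ ^ 2 / 4 * sq + (1 + 2 * C) * T := by
    have t1 := mul_le_mul_of_nonneg_left hRS (by positivity : 0 ≤ 2 * (η * γs ^ 2))
    have t2 := mul_le_mul_of_nonneg_right hη1 (add_nonneg hSs hTs)
    have t3 := mul_le_mul_of_nonneg_right hη2 hqs
    have t4 := mul_le_mul_of_nonneg_left hT hC
    nlinarith
  have hfin' : 1 / δ * sS ≤ δ / 4 * sq + (1 + 2 * C) / δ * T := by
    have t1 := mul_le_mul_of_nonneg_left hfin (by positivity : 0 ≤ 1 / δ)
    have t2 : 1 / δ * (δ ^ 2 / 4 * sq + (1 + 2 * C) * T)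
        = δ / 4 * sq + (1 + 2 * C) / δ * T := by field_simp
    linarith
  linarith

end Discrete

end VBDF2

namespace VBDF2

variable {d : ℕ}

open Filter Topology

namespace Domain

open scoped RealInnerProductSpace

variable {P : Domain d}

open Classical in
/-- The class in `L²` of a square integrable function (`0` otherwise). -/
def toL2 (P : Domain d) (u : E d → ℝ) : Lp ℝ 2 P.vol :=
  if h : MemLp u 2 P.vol then h.toLp u else 0

/-- The weak gradient as an element of a Hilbert space. -/
def grad (P : Domain d) (u : E d → ℝ) : PiLp 2 fun _ : Fin d => Lp ℝ 2 P.vol :=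
  WithLp.toLp 2 fun i => P.toL2 (P.weakPartial i u)

lemma toL2_of_memLp {u : E d → ℝ} (h : MemLp u 2 P.vol) : P.toL2 u = h.toLp u := dif_pos h

lemma coeFn_toL2 {u : E d → ℝ} (h : MemLp u 2 P.vol) : P.toL2 u =ᵐ[P.vol] u := by
  rw [toL2_of_memLp h]; exact h.coeFn_toLp

lemma toL2_congr {u v : E d → ℝ} (hu : MemLp u 2 P.vol) (h : u =ᵐ[P.vol] v) :
    P.toL2 u = P.toL2 v := by
  have hv := (memLp_congr_ae h).1 hu
  rw [toL2_of_memLp hu, toL2_of_memLp hv, MemLp.toLp_eq_toLp_iff]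
  exact h

lemma toL2_linear {u v : E d → ℝ} (hu : MemLp u 2 P.vol) (hv : MemLp v 2 P.vol) (a c : ℝ) :
    P.toL2 (fun x => a * u x + c * v x) = a • P.toL2 u + c • P.toL2 v := by
  rw [toL2_of_memLp hu, toL2_of_memLp hv, ← MemLp.toLp_const_smul, ← MemLp.toLp_const_smul,
    ← MemLp.toLp_add]
  exact toL2_of_memLp _

lemma toL2_sub {u v : E d → ℝ} (hu : MemLp u 2 P.vol) (hv : MemLp v 2 P.vol) :
    P.toL2 (fun x => u x - v x) = P.toL2 u - P.toL2 v := by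
  have h := toL2_linear hu hv 1 (-1)
  simp only [one_mul, neg_mul, one_smul, neg_smul, ← sub_eq_add_neg] at h
  exact h

lemma inner_toL2 {u v : E d → ℝ} (hu : MemLp u 2 P.vol) (hv : MemLp v 2 P.vol) :
    ⟪P.toL2 u, P.toL2 v⟫ = ∫ x, u x * v x ∂P.vol := by
  rw [L2.inner_def]
  refine integral_congr_ae ?_
  filter_upwards [coeFn_toL2 hu, coeFn_toL2 hv] with x h1 h2
  rw [h1, h2, real_inner_comm]
  rfl

lemma norm_toL2_sq {u : E d → ℝ} (hu : MemLp u 2 P.vol) : ‖P.toL2 u‖ ^ 2 = P.normSq u := by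
  rw [← real_inner_self_eq_norm_sq, inner_toL2 hu hu, normSq]
  simp_rw [sq]

lemma inner_grad {u v : E d → ℝ} (hu : P.MemH1 u) (hv : P.MemH1 v) :
    ⟪P.grad u, P.grad v⟫ = ∑ i, ∫ x, P.weakPartial i u x * P.weakPartial i v x ∂P.vol := by
  rw [PiLp.inner_apply]
  exact Finset.sum_congr rfl fun i _ => inner_toL2 (hu.memLp_weakPartial i) (hv.memLp_weakPartial i)

lemma norm_grad_sq {u : E d → ℝ} (hu : P.MemH1 u) : ‖P.grad u‖ ^ 2 = P.gradNormSq u := by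
  rw [← real_inner_self_eq_norm_sq, inner_grad hu hu, gradNormSq]
  simp_rw [normSq, sq]

lemma grad_linear {u v : E d → ℝ} (hu : P.MemH1 u) (hv : P.MemH1 v) (a c : ℝ) :
    P.grad (fun x => a * u x + c * v x) = a • P.grad u + c • P.grad v := by
  ext1 i
  have h := (toL2_congr ((hu.linear hv a c).memLp_weakPartial i) (weakPartial_linear hu hv a c i))
  rw [toL2_linear (hu.memLp_weakPartial i) (hv.memLp_weakPartial i)] at h
  exact h

lemma grad_sub {u v : E d → ℝ} (hu : P.MemH1 u) (hv : P.MemH1 v) :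
    P.MemH1 (fun x => u x - v x) ∧ P.grad (fun x => u x - v x) = P.grad u - P.grad v := by
  have h := grad_linear hu hv 1 (-1)
  have h' := hu.linear hv 1 (-1)
  simp only [one_mul, neg_mul, one_smul, neg_smul, ← sub_eq_add_neg] at h h'
  exact ⟨h', h⟩

lemma normH1_eq {u : E d → ℝ} (hu : P.MemH1 u) :
    P.normH1 u = √(‖P.toL2 u‖ ^ 2 + ‖P.grad u‖ ^ 2) := by
  rw [norm_toL2_sq hu.1, norm_grad_sq hu, normH1]

lemma normH1_le {u : E d → ℝ} (hu : P.MemH1 u) : P.normH1 u ≤ ‖P.toL2 u‖ + ‖P.grad u‖ := by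
  rw [normH1_eq hu, Real.sqrt_le_left (by positivity)]
  nlinarith [norm_nonneg (P.toL2 u), norm_nonneg (P.grad u)]

lemma norm_toL2_le {u : E d → ℝ} (hu : P.MemH1 u) : ‖P.toL2 u‖ ≤ P.normH1 u := by
  rw [normH1_eq hu]
  exact Real.le_sqrt_of_sq_le (by nlinarith [sq_nonneg ‖P.grad u‖])

lemma norm_grad_le {u : E d → ℝ} (hu : P.MemH1 u) : ‖P.grad u‖ ≤ P.normH1 u := by
  rw [normH1_eq hu]
  exact Real.le_sqrt_of_sq_le (by nlinarith [sq_nonneg ‖P.toL2 u‖])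

lemma HasLaplacian.inner_eq {u w ψ : E d → ℝ} (h : P.HasLaplacian u w) (hψ : P.MemH1 ψ) :
    ⟪P.toL2 ψ, P.toL2 w⟫ = - ⟪P.grad ψ, P.grad u⟫ := by
  rw [real_inner_comm, real_inner_comm (P.grad u), inner_toL2 h.2.1 hψ.1, inner_grad h.1 hψ,
    h.2.2 ψ hψ, neg_neg]

end Domain

/-- The scalar factor in front of `g'` in the chemical potential. -/
def coeff (P : Domain d) (g V : ℝ → ℝ) (C₀ : ℝ) (φ : ℕ → E d → ℝ) (r : ℕ → ℝ) (n : ℕ) : ℝ :=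
  r (n + 1) / √(P.E1 g C₀ (φ n)) * (if n = 0 then 1 else V (xi P g C₀ φ r n))

/-- The scheme with the first step included, for `τ 0 = 0`. -/
structure IsFlow (P : Domain d) (ε lam : ℝ) (g : ℝ → ℝ) (N : ℕ) (τ : ℕ → ℝ)
    (φ : ℕ → E d → ℝ) (r c : ℕ → ℝ) : Prop where
  zero : τ 0 = 0
  regular : ∀ n ≤ N, P.HasLaplacian (φ n) (P.laplacian (φ n))
  step_phi : ∀ n < N, ∀ᵐ x ∂P.vol, c n * deriv g (extrap τ φ n x)
    = ε ^ 2 * P.laplacian (φ (n + 1)) x - lam * φ (n + 1) x - F2 τ φ n x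
  step_r : ∀ n < N, ∫ x, c n * deriv g (extrap τ φ n x) * (φ (n + 1) x - φ n x) ∂P.vol
    = 2 * r (n + 1) * (r (n + 1) - r n)

variable {P : Domain d} {ε lam γs T C₀ : ℝ} {g V : ℝ → ℝ} {N : ℕ} {τ : ℕ → ℝ}
  {φ : ℕ → E d → ℝ} {φ0 : E d → ℝ} {r c : ℕ → ℝ}

lemma ratio_update (τ : ℕ → ℝ) (t : ℝ) (n : ℕ) :
    ratio (Function.update τ 0 t) (n + 2) = ratio τ (n + 2) := by
  simp [ratio]

lemma IsMesh.update (h : IsMesh γs T N τ) (t : ℝ) : IsMesh γs T N (Function.update τ 0 t) := by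
  refine ⟨fun n h1 h2 => ?_, fun n h1 h2 => ?_, ?_⟩
  · rw [Function.update_of_ne (by omega)]; exact h.pos n h1 h2
  · obtain ⟨k, rfl⟩ : ∃ k, n = k + 2 := ⟨n - 2, by omega⟩
    rw [ratio_update]; exact h.ratio_le _ h1 h2
  · rw [← h.sum_eq]
    refine Finset.sum_congr rfl fun n hn => ?_
    rw [Finset.mem_Icc] at hn
    rw [Function.update_of_ne (by omega)]

lemma AuxEq.integral_eq {n : ℕ} {φs : E d → ℝ} (hτ : τ (n + 1) ≠ 0)
    (h : AuxEq P g V C₀ τ φ r n φs) :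
    ∫ x, r (n + 1) / √(P.E1 g C₀ (φ n)) * V (xi P g C₀ φ r n) * deriv g (φs x)
      * (φ (n + 1) x - φ n x) ∂P.vol = 2 * r (n + 1) * (r (n + 1) - r n) := by
  have e1 : ∫ x, deriv g (φs x) * ((φ (n + 1) x - φ n x) / τ (n + 1)) ∂P.vol
      = (∫ x, deriv g (φs x) * (φ (n + 1) x - φ n x) ∂P.vol) / τ (n + 1) := by
    rw [← integral_div]
    exact integral_congr_ae (.of_forall fun x => by ring)
  rw [AuxEq, e1, ← mul_div_assoc, div_left_inj' hτ] at h
  rw [h]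
  simp_rw [mul_assoc, integral_const_mul]
  ring

theorem IsSolution.isFlow (h : IsSolution P ε lam g V C₀ φ0 N τ φ r) (hm : IsMesh γs T N τ)
    (hφ0 : P.MemH2BC φ0) :
    IsFlow P ε lam g N (Function.update τ 0 0) φ r (coeff P g V C₀ φ r) := by
  set σ := Function.update τ 0 0 with hσ
  have hσ1 : ∀ n, σ (n + 1) = τ (n + 1) := fun n => Function.update_of_ne (by omega) _ _
  have hr0 : ratio σ (0 + 1) = 0 := by simp [ratio, hσ]
  have hrn : ∀ n, n ≠ 0 → ratio σ (n + 1) = ratio τ (n + 1) := fun n hn => by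
    obtain ⟨k, rfl⟩ : ∃ k, n = k + 1 := ⟨n - 1, by omega⟩
    exact ratio_update τ 0 k
  have hext0 : extrap σ φ 0 = φ 0 := by
    ext x; simp only [extrap, hr0]; ring
  have hextn : ∀ n, n ≠ 0 → extrap σ φ n = extrap τ φ n := fun n hn => by
    ext x; simp only [extrap, hrn n hn]
  refine ⟨by simp [hσ], fun n hn => ?_, fun n hn => ?_, fun n hn => ?_⟩
  · rcases n.eq_zero_or_pos with rfl | hp
    · rw [h.init_phi]; exact Domain.hasLaplacian_laplacian hφ0.2
    · exact Domain.hasLaplacian_laplacian (h.regular n hp hn)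
  · by_cases hn0 : n = 0
    · subst hn0
      filter_upwards [h.first_phi (by omega)] with x hx
      rw [mu] at hx
      rw [hext0, coeff, if_pos rfl, F2, hr0, hσ1]
      simp only [zero_add] at hx ⊢
      have e1 : 1 / τ 1 * ((1 + 2 * 0) / (1 + 0) * φ 1 x - (1 + 0) * φ 0 x
          + 0 ^ 2 / (1 + 0) * φ (0 - 1) x) = (φ 1 x - φ 0 x) / τ 1 := by ring
      rw [e1, hx]
      ring
    · filter_upwards [h.step_phi n (by omega) hn] with x hx
      rw [mu] at hx
      rw [hextn n hn0, coeff, if_neg hn0]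
      have e1 : F2 σ φ n x = F2 τ φ n x := by rw [F2, F2, hrn n hn0, hσ1]
      rw [e1, hx]
      ring
  · have hτ : τ (n + 1) ≠ 0 := (hm.pos _ (by omega) (by omega)).ne'
    by_cases hn0 : n = 0
    · subst hn0
      rw [hext0, coeff, if_pos rfl]
      exact (h.first_r (by omega)).integral_eq hτ
    · rw [hextn n hn0, coeff, if_neg hn0]
      exact (h.step_r n (by omega) hn).integral_eq hτ

namespace IsFlow

open scoped RealInnerProductSpace

lemma toL2_F2 (h : IsFlow P ε lam g N τ φ r c) {n : ℕ} (hm : IsMesh γs T N τ) (hn : n < N) :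
    MemLp (F2 τ φ n) 2 P.vol ∧
    P.toL2 (F2 τ φ n) = quot τ (fun k => P.toL2 (φ k)) n := by
  have h1 : ∀ k ≤ N, MemLp (φ k) 2 P.vol := fun k hk => (h.regular k hk).1.1
  have hs := hm.ratio_nonneg h.zero hn.le
  set A := (1 + 2 * ratio τ (n + 1)) / (1 + ratio τ (n + 1)) with hA
  set B := ratio τ (n + 1) ^ 2 / (1 + ratio τ (n + 1)) with hB
  have hAB : 1 + ratio τ (n + 1) = A + B := by
    rw [hA, hB]; field_simp; ring
  have e : F2 τ φ n = fun x => 1 * (((τ (n + 1))⁻¹ * A) * φ (n + 1) x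
      + (-((τ (n + 1))⁻¹ * (A + B))) * φ n x) + ((τ (n + 1))⁻¹ * B) * φ (n - 1) x := by
    ext x
    rw [F2, ← hA, ← hB, hAB]
    ring
  have h2 : MemLp (fun x => ((τ (n + 1))⁻¹ * A) * φ (n + 1) x
      + (-((τ (n + 1))⁻¹ * (A + B))) * φ n x) 2 P.vol :=
    ((h1 _ hn).const_mul _).add ((h1 _ hn.le).const_mul _)
  have h3 := h1 (n - 1) (by omega)
  rw [e]
  refine ⟨(h2.const_mul 1).add (h3.const_mul _), ?_⟩
  rw [Domain.toL2_linear h2 h3, Domain.toL2_linear (h1 _ hn) (h1 _ hn.le), quot, ← hA, ← hB]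
  module

lemma toL2_forcing (h : IsFlow P ε lam g N τ φ r c) {n : ℕ} (hm : IsMesh γs T N τ) (hn : n < N) :
    MemLp (fun x => c n * deriv g (extrap τ φ n x)) 2 P.vol ∧
    quot τ (fun k => P.toL2 (φ k)) n = ε ^ 2 • P.toL2 (P.laplacian (φ (n + 1)))
      - lam • P.toL2 (φ (n + 1)) - P.toL2 (fun x => c n * deriv g (extrap τ φ n x)) := by
  obtain ⟨h1, h2⟩ := h.toL2_F2 hm hn
  have h3 := (h.regular _ hn).2.1
  have h4 := (h.regular _ hn).1.1
  have h5 : MemLp (fun x => ε ^ 2 * P.laplacian (φ (n + 1)) x + (-lam) * φ (n + 1) x) 2 P.vol :=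
    (h3.const_mul _).add (h4.const_mul _)
  have h6 : (fun x => (ε ^ 2 * P.laplacian (φ (n + 1)) x + (-lam) * φ (n + 1) x) - F2 τ φ n x)
      =ᵐ[P.vol] fun x => c n * deriv g (extrap τ φ n x) := by
    filter_upwards [h.step_phi n hn] with x hx
    rw [hx]; ring
  have h7 : MemLp (fun x => (ε ^ 2 * P.laplacian (φ (n + 1)) x + (-lam) * φ (n + 1) x)
      - F2 τ φ n x) 2 P.vol := h5.sub h1
  refine ⟨(memLp_congr_ae h6).1 h7, ?_⟩
  rw [← Domain.toL2_congr h7 h6, Domain.toL2_sub h5 h1, Domain.toL2_linear h3 h4, h2]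
  module

lemma inner_laplacian (h : IsFlow P ε lam g N τ φ r c) :
    ∀ i ≤ N, ∀ j ≤ N, ⟪P.toL2 (φ i), P.toL2 (P.laplacian (φ j))⟫
    = - ⟪P.grad (φ i), P.grad (φ j)⟫ := fun i hi j hj =>
  (h.regular j hj).inner_eq (h.regular i hi).1

/-- The energy law for the scheme. -/
theorem energy_le (h : IsFlow P ε lam g N τ φ r c) (hm : IsMesh γs T N τ) (hγ : 0 ≤ γs)
    {a : ℝ} (ha : 0 < a) (hroot : G a a = 0)
    (hγa : γs ≤ a) (hlam : 0 ≤ lam) {m : ℕ} (hmN : m ≤ N) :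
    ε ^ 2 / 2 * ‖P.grad (φ m)‖ ^ 2 + lam / 2 * ‖P.toL2 (φ m)‖ ^ 2 + r m ^ 2
      + (weight a - weight γs) / 2
        * ∑ n ∈ Finset.Icc 1 m, dissip τ (fun k => P.toL2 (φ k)) n
      ≤ ε ^ 2 / 2 * ‖P.grad (φ 0)‖ ^ 2 + lam / 2 * ‖P.toL2 (φ 0)‖ ^ 2 + r 0 ^ 2 :=
  hm.energy_le h.zero hγ ha hroot hγa hlam (a := fun k => P.toL2 (φ k))
    (l := fun k => P.toL2 (P.laplacian (φ k)))
    (z := fun k => P.toL2 (fun x => c (k - 1) * deriv g (extrap τ φ (k - 1) x)))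
    (b := fun k => P.grad (φ k)) (fun n hn => (h.toL2_forcing hm hn).2) h.inner_laplacian
    (fun n hn => by
      have h1 : MemLp (φ (n + 1)) 2 P.vol := (h.regular _ hn).1.1
      have h2 := (h.regular _ hn.le).1.1
      have h3 : MemLp (fun x => φ (n + 1) x - φ n x) 2 P.vol := h1.sub h2
      simp only [Nat.add_sub_cancel]
      rw [← Domain.toL2_sub h1 h2, Domain.inner_toL2 (h.toL2_forcing hm hn).1 h3]
      exact h.step_r n hn) hmN

end IsFlow

end VBDF2

namespace VBDF2

variable {d : ℕ}

open Filter Topology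

variable {P : Domain d} {ε lam γs T C₀ : ℝ} {g V : ℝ → ℝ} {N : ℕ} {τ : ℕ → ℝ}
  {φ : ℕ → E d → ℝ} {φ0 : E d → ℝ} {r c : ℕ → ℝ}

lemma Domain.HasWeakPartial.const_mul {i : Fin d} {u v : E d → ℝ} (h : P.HasWeakPartial i u v)
    (hu : MemLp u 2 P.vol) (k : ℝ) :
    P.HasWeakPartial i (fun x => k * u x) (fun x => k * v x) := by
  have := h.linear hu hu h k 0
  simpa only [zero_mul, add_zero] using this

namespace IsFlow

open scoped RealInnerProductSpace

/-- The gradient of the forcing term. -/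
def forcingGrad (P : Domain d) (g : ℝ → ℝ) (k : ℝ) (w : E d → ℝ) :
    PiLp 2 fun _ : Fin d => Lp ℝ 2 P.vol :=
  WithLp.toLp 2 fun i => P.toL2 fun x => k * (deriv (deriv g) (w x) * P.weakPartial i w x)

lemma inner_forcing {η C k : ℝ} {w lw u lu : E d → ℝ} (hw : P.NonlinearBound g η C w lw)
    (hu : P.HasLaplacian u lu) :
    ⟪P.toL2 (fun x => k * deriv g (w x)), P.toL2 lu⟫ = - ⟪forcingGrad P g k w, P.grad u⟫ := by
  have h1 : ∀ i, P.HasWeakPartial i (fun x => k * deriv g (w x))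
      (fun x => k * (deriv (deriv g) (w x) * P.weakPartial i w x)) := fun i =>
    (hw.hasWeakPartial i).const_mul hw.memLp k
  have h2 : P.MemH1 (fun x => k * deriv g (w x)) := ⟨hw.memLp.const_mul k, fun i => ⟨_, h1 i⟩⟩
  have h3 : P.grad (fun x => k * deriv g (w x)) = forcingGrad P g k w := by
    ext1 i
    exact Domain.toL2_congr (h2.memLp_weakPartial i) ((h1 i).weakPartial_ae_eq h2.1)
  rw [hu.inner_eq h2, h3]

lemma norm_forcingGrad_sq_le {η C k B : ℝ} {w lw : E d → ℝ} (hw : P.NonlinearBound g η C w lw)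
    (hk : |k| ≤ B) (hlw : MemLp lw 2 P.vol) :
    ‖forcingGrad P g k w‖ ^ 2 ≤ B ^ 2 * (η * ‖P.toL2 lw‖ ^ 4 + C) := by
  have h1 : ‖forcingGrad P g k w‖ ^ 2
      = k ^ 2 * ∑ i, ∫ x, (deriv (deriv g) (w x) * P.weakPartial i w x) ^ 2 ∂P.vol := by
    rw [PiLp.norm_sq_eq_of_L2, Finset.mul_sum]
    refine Finset.sum_congr rfl fun i _ => ?_
    have h2 := ((hw.hasWeakPartial i).const_mul hw.memLp k).1
    refine (Domain.norm_toL2_sq h2).trans ?_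
    rw [Domain.normSq, ← integral_const_mul]
    simp_rw [mul_pow]
  have h2 : ‖P.toL2 lw‖ ^ 4 = P.normSq lw ^ 2 := by
    rw [← Domain.norm_toL2_sq hlw]; ring
  rw [h1, h2]
  have h3 : k ^ 2 ≤ B ^ 2 := by rw [← sq_abs]; gcongr
  exact mul_le_mul h3 hw.bound
    (Finset.sum_nonneg fun i _ => integral_nonneg fun x => sq_nonneg _) (sq_nonneg _)

lemma pow_four_add_le (x y : ℝ) : (x + y) ^ 4 ≤ 8 * (x ^ 4 + y ^ 4) := by
  have h1 : (x + y) ^ 2 ≤ 2 * (x ^ 2 + y ^ 2) := by nlinarith [sq_nonneg (x - y)]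
  have h2 : ((x + y) ^ 2) ^ 2 ≤ (2 * (x ^ 2 + y ^ 2)) ^ 2 := by gcongr
  nlinarith [sq_nonneg (x ^ 2 - y ^ 2)]

/-- The extrapolated value has a Laplacian, with the corresponding bounds. -/
lemma extrap_bounds (h : IsFlow P ε lam g N τ φ r c) (hm : IsMesh γs T N τ) (hγ : 0 ≤ γs) {M : ℝ}
    (hM : ∀ n ≤ N, P.normH1 (φ n) ≤ M) {n : ℕ} (hn : n < N) :
    ∃ lw, P.HasLaplacian (extrap τ φ n) lw ∧ P.normH1 (extrap τ φ n) ≤ 2 * (1 + 2 * γs) * M ∧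
      ‖P.toL2 lw‖ ^ 4 ≤ 8 * (1 + γs) ^ 4 * (‖P.toL2 (P.laplacian (φ n))‖ ^ 4
        + ‖P.toL2 (P.laplacian (φ (n - 1)))‖ ^ 4) := by
  have hs := hm.ratio_nonneg h.zero hn.le
  have hsb := hm.ratio_le' h.zero hγ hn.le
  set s := ratio τ (n + 1)
  have r1 := h.regular n hn.le
  have r2 := h.regular (n - 1) (by omega)
  have e : extrap τ φ n = fun x => (1 + s) * φ n x + (-s) * φ (n - 1) x := by
    ext x; simp only [extrap]; ring
  have bound : ∀ {X : Type _} [NormedAddCommGroup X] [InnerProductSpace ℝ X] (x y : X),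
      ‖(1 + s) • x + (-s) • y‖ ≤ (1 + γs) * ‖x‖ + γs * ‖y‖ := by
    intro X _ _ x y
    refine (norm_add_le _ _).trans ?_
    rw [norm_smul, norm_smul, norm_neg, Real.norm_of_nonneg hs,
      Real.norm_of_nonneg (by positivity)]
    gcongr
  refine ⟨_, e ▸ r1.linear r2 (1 + s) (-s), ?_, ?_⟩
  · rw [e]
    refine (Domain.normH1_le (r1.1.linear r2.1 _ _)).trans ?_
    rw [Domain.toL2_linear r1.1.1 r2.1.1, Domain.grad_linear r1.1 r2.1]
    have b1 := bound (P.toL2 (φ n)) (P.toL2 (φ (n - 1)))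
    have b2 := bound (P.grad (φ n)) (P.grad (φ (n - 1)))
    have m1 := (Domain.norm_toL2_le r1.1).trans (hM n hn.le)
    have m2 := (Domain.norm_toL2_le r2.1).trans (hM (n - 1) (by omega))
    have m3 := (Domain.norm_grad_le r1.1).trans (hM n hn.le)
    have m4 := (Domain.norm_grad_le r2.1).trans (hM (n - 1) (by omega))
    have p1 := mul_le_mul_of_nonneg_left m1 (by positivity : 0 ≤ 1 + γs)
    have p2 := mul_le_mul_of_nonneg_left m2 hγ
    have p3 := mul_le_mul_of_nonneg_left m3 (by positivity : 0 ≤ 1 + γs)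
    have p4 := mul_le_mul_of_nonneg_left m4 hγ
    linarith
  · rw [Domain.toL2_linear r1.2.1 r2.2.1]
    have b1 := bound (P.toL2 (P.laplacian (φ n))) (P.toL2 (P.laplacian (φ (n - 1))))
    set X := ‖P.toL2 (P.laplacian (φ n))‖
    set Y := ‖P.toL2 (P.laplacian (φ (n - 1)))‖
    have hX : 0 ≤ X := norm_nonneg _
    have hY : 0 ≤ Y := norm_nonneg _
    have b2 : (1 + γs) * X + γs * Y ≤ (1 + γs) * (X + Y) := by linarith
    calc _ ≤ ((1 + γs) * (X + Y)) ^ 4 := pow_le_pow_left₀ (norm_nonneg _) (b1.trans b2) 4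
      _ = (1 + γs) ^ 4 * (X + Y) ^ 4 := by ring
      _ ≤ (1 + γs) ^ 4 * (8 * (X ^ 4 + Y ^ 4)) := by gcongr; exact pow_four_add_le X Y
      _ = _ := by ring

/-- The second energy estimate for the scheme. -/
theorem exists_second_energy_le (hd1 : 1 ≤ d) (hd3 : d ≤ 3) (P : Domain d) (hε : 0 < ε)
    (hlam : 0 ≤ lam) (hg : ContDiff ℝ 2 g)
    (hgrowth : 2 ≤ d → ∃ p K : ℝ, 0 < p ∧ (d = 3 → p < 4) ∧
      ∀ s, |deriv (deriv g) s| ≤ K * (|s| ^ p + 1)) (hγ : 1 ≤ γs) {a : ℝ} (ha : 0 < a)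
    (hroot : G a a = 0) (hγa : γs < a) {M : ℝ} (hM : 0 ≤ M) (B L : ℝ) :
    ∃ C, 0 ≤ C ∧ ∀ (T : ℝ) (N : ℕ) (τ : ℕ → ℝ) (φ : ℕ → E d → ℝ) (r c : ℕ → ℝ),
      IsFlow P ε lam g N τ φ r c → IsMesh γs T N τ → (∀ n ≤ N, P.normH1 (φ n) ≤ M) →
      (∀ n < N, |c n| ≤ B) → ‖P.toL2 (P.laplacian (φ 0))‖ ≤ L → ∀ m ≤ N,
      weight (ratio τ (m + 1)) / 2 * dissip τ (fun k => P.grad (φ k)) m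
        + ε ^ 2 / 2 * ‖P.toL2 (P.laplacian (φ m))‖ ^ 2 + lam / 2 * ‖P.grad (φ m)‖ ^ 2
      ≤ ε ^ 2 / 2 * ‖P.toL2 (P.laplacian (φ 0))‖ ^ 2 + C * (1 + T) := by
  have hγ0 : 0 ≤ γs := by linarith
  have hδ0 : 0 < weight a - weight γs := sub_pos.2 (weight_lt_weight (by linarith) hγa)
  set δ := weight a - weight γs
  set X := γs ^ 2 * fourthConst ε lam γs M with hX
  have hX0 : 0 ≤ X := mul_nonneg (sq_nonneg _) (fourthConst_nonneg hγ0)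
  obtain ⟨η, hη0, hη1, hη2⟩ : ∃ η : ℝ, 0 < η ∧ 4 * (η * X) ≤ 1 ∧ 32 * (η * X) ≤ δ ^ 2 := by
    refine ⟨min (1 / (4 * (X + 1))) (δ ^ 2 / (32 * (X + 1))), by positivity, ?_, ?_⟩
    · have : min (1 / (4 * (X + 1))) (δ ^ 2 / (32 * (X + 1))) * X ≤ 1 / (4 * (X + 1)) * (X + 1) :=
        mul_le_mul (min_le_left _ _) (by linarith) hX0 (by positivity)
      have e : 1 / (4 * (X + 1)) * (X + 1) = 1 / 4 := by field_simp
      linarith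
    · have : min (1 / (4 * (X + 1))) (δ ^ 2 / (32 * (X + 1))) * X
          ≤ δ ^ 2 / (32 * (X + 1)) * (X + 1) :=
        mul_le_mul (min_le_right _ _) (by linarith) hX0 (by positivity)
      have e : δ ^ 2 / (32 * (X + 1)) * (X + 1) = δ ^ 2 / 32 := by field_simp
      linarith
  set W := 8 * (1 + γs) ^ 4 with hW
  have hW0 : 0 < W := by positivity
  set η₀ := η / (W * (B ^ 2 + 1)) with hη₀
  have hη₀0 : 0 < η₀ := by positivity
  have hη₀' : B ^ 2 * η₀ * W ≤ η := by
    rw [hη₀]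
    have : B ^ 2 * (η / (W * (B ^ 2 + 1))) * W = η * (B ^ 2 / (B ^ 2 + 1)) := by field_simp
    rw [this]
    refine mul_le_of_le_one_right hη0.le ?_
    rw [div_le_one (by positivity)]
    linarith
  obtain ⟨C₁, hC₁, hnl⟩ := Domain.exists_nonlinearBound hd1 hd3 P hg hgrowth
    (M := 2 * (1 + 2 * γs) * M) (by positivity) hη₀0
  set C₂ := 2 * η * L ^ 4 + B ^ 2 * C₁ with hC₂
  have hC₂0 : 0 ≤ C₂ := by positivity
  refine ⟨lam / 2 * M ^ 2 + (1 + 2 * C₂) / δ, by positivity, ?_⟩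
  intro T N τ φ r c h hm hφM hcB hl0 m hmN
  choose! lw hlw1 hlw2 hlw3 using fun n (hn : n < N) => h.extrap_bounds hm hγ0 hφM hn
  have hnl' : ∀ n < N, P.NonlinearBound g η₀ C₁ (extrap τ φ n) (lw n) := fun n hn =>
    hnl _ _ (hlw1 n hn) (hlw2 n hn)
  have hb : ∀ n ≤ N, ‖P.grad (φ n)‖ ≤ M := fun n hn =>
    (Domain.norm_grad_le (h.regular n hn).1).trans (hφM n hn)
  have key := hm.second_energy_le h.zero hγ ha hroot hγa hε hlam hη0.le hC₂0
    (by rw [mul_assoc η, ← hX]; exact hη1) (by rw [mul_assoc η, ← hX]; exact hη2)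
    (a := fun k => P.toL2 (φ k))
    (l := fun k => P.toL2 (P.laplacian (φ k)))
    (z := fun k => P.toL2 (fun x => c (k - 1) * deriv g (extrap τ φ (k - 1) x)))
    (b := fun k => P.grad (φ k))
    (ζ := fun k => forcingGrad P g (c (k - 1)) (extrap τ φ (k - 1)))
    (fun n hn => (h.toL2_forcing hm hn).2) h.inner_laplacian
    (fun n hn j hj => inner_forcing (hnl' n hn) (h.regular j hj)) hb
    (fun n hn => by
      simp only [Nat.add_sub_cancel]
      have k1 := norm_forcingGrad_sq_le (hnl' n hn) (hcB n hn) (hlw1 n hn).2.1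
      have k2 := hlw3 n hn
      have k3 : ∀ i, ‖P.toL2 (P.laplacian (φ i))‖ ^ 4
          ≤ (if i = 0 then 0 else ‖P.toL2 (P.laplacian (φ i))‖ ^ 4) + L ^ 4 := by
        intro i
        split_ifs with hi
        · rw [hi, zero_add]; gcongr
        · have : 0 ≤ L ^ 4 := by positivity
          linarith
      have k4 := k3 n
      have k5 := k3 (n - 1)
      have k6 : B ^ 2 * (η₀ * ‖P.toL2 (lw n)‖ ^ 4) ≤ η * (‖P.toL2 (P.laplacian (φ n))‖ ^ 4
          + ‖P.toL2 (P.laplacian (φ (n - 1)))‖ ^ 4) := by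
        calc B ^ 2 * (η₀ * ‖P.toL2 (lw n)‖ ^ 4)
            ≤ B ^ 2 * (η₀ * (W * (‖P.toL2 (P.laplacian (φ n))‖ ^ 4
              + ‖P.toL2 (P.laplacian (φ (n - 1)))‖ ^ 4))) := by gcongr
          _ = B ^ 2 * η₀ * W * (‖P.toL2 (P.laplacian (φ n))‖ ^ 4
              + ‖P.toL2 (P.laplacian (φ (n - 1)))‖ ^ 4) := by ring
          _ ≤ _ := by gcongr
      have k7 := mul_le_mul_of_nonneg_left (add_le_add k4 k5) hη0.le
      rw [hC₂]
      linarith) hmN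
  refine key.trans ?_
  have hT := hm.time_nonneg
  have f1 : lam / 2 * ‖P.grad (φ 0)‖ ^ 2 ≤ lam / 2 * M ^ 2 := by
    gcongr; exact hb 0 (Nat.zero_le _)
  have f2 : 0 ≤ lam / 2 * M ^ 2 * T := by positivity
  have f3 : 0 ≤ (1 + 2 * C₂) / δ := by positivity
  show _ + lam / 2 * ‖P.grad (φ 0)‖ ^ 2 + (1 + 2 * C₂) / δ * T ≤ _
  linarith

end IsFlow

/-- Uniform bound for the scalar factor of the scheme. -/
lemma exists_coeff_le (P : Domain d) (hpos : ∀ s : ℝ, 0 < P.E1 g C₀ fun _ => s)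
    (hg : Continuous g) (hV : Continuous V) {M : ℝ} (hM : 0 ≤ M) :
    ∃ B, ∀ (N : ℕ) (φ : ℕ → E d → ℝ) (r : ℕ → ℝ), (∀ n ≤ N, P.MemH1 (φ n)) →
      (∀ n ≤ N, P.normH1 (φ n) ≤ M) → (∀ n ≤ N, |r n| ≤ M) →
      (∀ n ≤ N, Integrable (fun x => g (φ n x)) P.vol) →
      ∀ n < N, |coeff P g V C₀ φ r n| ≤ B := by
  obtain ⟨e, he, hE⟩ := P.exists_E1_lower_bound hg hpos M
  have hse : 0 < √e := Real.sqrt_pos.2 he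
  obtain ⟨B₁, hB₁⟩ := (isCompact_Icc (a := -(M / √e)) (b := M / √e)).exists_bound_of_continuousOn
    hV.continuousOn
  refine ⟨M / √e * max 1 B₁, fun N φ r h1 h2 h3 h4 n hn => ?_⟩
  have hEn : e ≤ P.E1 g C₀ (φ n) := by
    refine hE _ (h1 n hn.le).1 ?_ (h4 n hn.le)
    rw [← Domain.norm_toL2_sq (h1 n hn.le).1]
    gcongr
    exact (Domain.norm_toL2_le (h1 n hn.le)).trans (h2 n hn.le)
  have hx : |r (n + 1) / √(P.E1 g C₀ (φ n))| ≤ M / √e := by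
    rw [abs_div, abs_of_nonneg (Real.sqrt_nonneg _)]
    exact div_le_div₀ hM (h3 _ hn) hse (Real.sqrt_le_sqrt hEn)
  rw [coeff, abs_mul]
  refine mul_le_mul hx ?_ (abs_nonneg _) (by positivity)
  split_ifs
  · simp
  · exact (hB₁ _ (abs_le.1 hx)).trans (le_max_right _ _)

end VBDF2

namespace VBDF2

variable {d : ℕ}

variable {P : Domain d} {ε lam γs T C₀ : ℝ} {g V : ℝ → ℝ} {N : ℕ} {τ : ℕ → ℝ}
  {φ : ℕ → E d → ℝ} {φ0 : E d → ℝ} {r : ℕ → ℝ}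

/-- The `H¹` bound when the energy controls the `L²` norm. -/
theorem exists_normH1_le_of_pos (P : Domain d) (hε : 0 < ε) (hlam : 0 < lam) (hγ : 0 ≤ γs) {a : ℝ}
    (ha : 0 < a) (hroot : G a a = 0) (hγa : γs ≤ a) (hφ0 : P.MemH2BC φ0) :
    ∃ M : ℝ, ∀ (T : ℝ) (N : ℕ) (τ : ℕ → ℝ) (φ : ℕ → E d → ℝ) (r : ℕ → ℝ),
      IsMesh γs T N τ → IsSolution P ε lam g V C₀ φ0 N τ φ r →
      ∀ n ≤ N, P.normH1 (φ n) + |r n| ≤ M := by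
  set E₀ := ε ^ 2 / 2 * ‖P.grad φ0‖ ^ 2 + lam / 2 * ‖P.toL2 φ0‖ ^ 2 + √(P.E1 g C₀ φ0) ^ 2
  refine ⟨√(2 * E₀ / lam) + √(2 * E₀ / ε ^ 2) + √E₀, fun T N τ φ r hm hs n hn => ?_⟩
  have hf := hs.isFlow hm hφ0
  have key := hf.energy_le (hm.update 0) hγ ha hroot hγa hlam.le hn
  rw [hs.init_phi, hs.init_r] at key
  change _ ≤ E₀ at key
  have hgap : 0 ≤ (weight a - weight γs) / 2
      * ∑ k ∈ Finset.Icc 1 n, dissip (Function.update τ 0 0) (fun k => P.toL2 (φ k)) k := by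
    refine mul_nonneg (div_nonneg (sub_nonneg.2 (weight_le_weight hγ hγa)) two_pos.le)
      (Finset.sum_nonneg fun k hk => dissip_nonneg (hm.update 0) hf.zero _ ?_)
    exact (Finset.mem_Icc.1 hk).2.trans hn
  have p1 : 0 ≤ ε ^ 2 / 2 * ‖P.grad (φ n)‖ ^ 2 := by positivity
  have p2 : 0 ≤ lam / 2 * ‖P.toL2 (φ n)‖ ^ 2 := by positivity
  have p3 := sq_nonneg (r n)
  have b1 : ‖P.toL2 (φ n)‖ ≤ √(2 * E₀ / lam) := by
    refine Real.le_sqrt_of_sq_le ?_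
    rw [le_div_iff₀ hlam]
    linarith
  have b2 : ‖P.grad (φ n)‖ ≤ √(2 * E₀ / ε ^ 2) := by
    refine Real.le_sqrt_of_sq_le ?_
    rw [le_div_iff₀ (by positivity)]
    linarith
  have b3 : |r n| ≤ √E₀ := Real.abs_le_sqrt (by linarith)
  linarith [Domain.normH1_le (hf.regular n hn).1]

/-- The `H¹` bound on a bounded time interval. -/
theorem exists_normH1_le (P : Domain d) (hε : 0 < ε) (hlam : 0 ≤ lam) (hγ : 0 < γs) {a : ℝ}
    (ha : 0 < a) (hroot : G a a = 0) (hγa : γs < a) (hφ0 : P.MemH2BC φ0) (T : ℝ) :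
    ∃ M : ℝ, ∀ (N : ℕ) (τ : ℕ → ℝ) (φ : ℕ → E d → ℝ) (r : ℕ → ℝ),
      IsMesh γs T N τ → IsSolution P ε lam g V C₀ φ0 N τ φ r →
      ∀ n ≤ N, P.normH1 (φ n) + |r n| ≤ M := by
  set E₀ := ε ^ 2 / 2 * ‖P.grad φ0‖ ^ 2 + lam / 2 * ‖P.toL2 φ0‖ ^ 2 + √(P.E1 g C₀ φ0) ^ 2
  have hδ : 0 < weight a - weight γs := sub_pos.2 (weight_lt_weight hγ hγa)
  set δ := weight a - weight γs
  refine ⟨(‖P.toL2 φ0‖ + √(T * (2 * E₀ / δ))) + √(2 * E₀ / ε ^ 2) + √E₀,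
    fun N τ φ r hm hs n hn => ?_⟩
  have hf := hs.isFlow hm hφ0
  have hm' := hm.update 0
  have key := hf.energy_le hm' hγ.le ha hroot hγa.le hlam hn
  have disp := hm'.norm_sub_sq_le (fun k => P.toL2 (φ k)) hn
  simp only [hs.init_phi] at disp
  rw [hs.init_phi, hs.init_r] at key
  change _ ≤ E₀ at key
  set D := ∑ k ∈ Finset.Icc 1 n, dissip (Function.update τ 0 0) (fun k => P.toL2 (φ k)) k
  have hD : 0 ≤ D := Finset.sum_nonneg fun k hk => dissip_nonneg hm' hf.zero _
    ((Finset.mem_Icc.1 hk).2.trans hn)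
  have p0 : 0 ≤ δ / 2 * D := by positivity
  have p1 : 0 ≤ ε ^ 2 / 2 * ‖P.grad (φ n)‖ ^ 2 := by positivity
  have p2 : 0 ≤ lam / 2 * ‖P.toL2 (φ n)‖ ^ 2 := by positivity
  have p3 := sq_nonneg (r n)
  have b1 : ‖P.toL2 (φ n)‖ ≤ ‖P.toL2 φ0‖ + √(T * (2 * E₀ / δ)) := by
    have h1 : D ≤ 2 * E₀ / δ := by
      rw [le_div_iff₀ hδ]
      linarith
    have h2 : ‖P.toL2 (φ n) - P.toL2 φ0‖ ≤ √(T * (2 * E₀ / δ)) :=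
      Real.le_sqrt_of_sq_le (disp.trans (mul_le_mul_of_nonneg_left h1 hm.time_nonneg))
    linarith [norm_le_norm_add_norm_sub' (P.toL2 (φ n)) (P.toL2 φ0)]
  have b2 : ‖P.grad (φ n)‖ ≤ √(2 * E₀ / ε ^ 2) := by
    refine Real.le_sqrt_of_sq_le ?_
    rw [le_div_iff₀ (by positivity)]
    linarith
  have b3 : |r n| ≤ √E₀ := Real.abs_le_sqrt (by linarith)
  linarith [Domain.normH1_le (hf.regular n hn).1]

end VBDF2

end

theorem theorem3p2 {d : ℕ} (hd1 : 1 ≤ d) (hd3 : d ≤ 3) (P : VBDF2.Domain d)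
    (ε lam C₀ : ℝ) (hε : 0 < ε) (hlam : 0 ≤ lam)
    (g : ℝ → ℝ) (hg : ContDiff ℝ 2 g)
    (hgrowth : 2 ≤ d → ∃ p K : ℝ, 0 < p ∧ (d = 3 → p < 4) ∧
      ∀ s, |deriv (deriv g) s| ≤ K * (|s| ^ p + 1))
    (hE1 : ∀ φ, P.MemH2BC φ → 0 < P.E1 g C₀ φ)
    (V : ℝ → ℝ) (hV : ContDiff ℝ 2 V) (hV1 : V 1 = 1) (hV1' : deriv V 1 = -1)
    (γss γs : ℝ) (hγss : 0 < γss) (hroot : VBDF2.G γss γss = 0) (hγ4 : 4 ≤ γs) (hγs : γs < γss)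
    (φ0 : VBDF2.E d → ℝ) (hφ0 : P.MemH2BC φ0) :
    (0 < lam → ∃ M : ℝ, ∀ (T : ℝ) (N : ℕ) (τ : ℕ → ℝ) (φ : ℕ → VBDF2.E d → ℝ) (r : ℕ → ℝ),
      VBDF2.IsMesh γs T N τ → VBDF2.IsSolution P ε lam g V C₀ φ0 N τ φ r →
      ∀ n ≤ N, P.normH1 (φ n) + |r n| ≤ M) ∧
    (∀ T : ℝ, ∃ M : ℝ, ∀ (N : ℕ) (τ : ℕ → ℝ) (φ : ℕ → VBDF2.E d → ℝ) (r : ℕ → ℝ),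
      VBDF2.IsMesh γs T N τ → VBDF2.IsSolution P ε lam g V C₀ φ0 N τ φ r →
      ∀ n ≤ N, P.normH1 (φ n) + |r n| ≤ M) ∧
    (∀ M : ℝ, ∃ C : ℝ, 0 < C ∧
      ∀ (T : ℝ) (N : ℕ) (τ : ℕ → ℝ) (φ : ℕ → VBDF2.E d → ℝ) (r : ℕ → ℝ),
      VBDF2.IsMesh γs T N τ → VBDF2.IsSolution P ε lam g V C₀ φ0 N τ φ r →
      (∀ n ≤ N, P.normH1 (φ n) + |r n| ≤ M) →
      ∀ n < N,
        VBDF2.ratio τ (n + 2) ^ (3 / 2 : ℝ) / (1 + VBDF2.ratio τ (n + 2))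
            * (P.gradNormSq (fun x => φ (n + 1) x - φ n x) / (2 * τ (n + 1)))
          + ε ^ 2 / 2 * P.normSq (P.laplacian (φ (n + 1)))
          + lam / 2 * P.gradNormSq (φ (n + 1))
        ≤ C * (1 + T)
          + max (γs ^ (3 / 2 : ℝ) / (1 + γs)) 1 * (ε ^ 2 / 2 * P.normSq (P.laplacian φ0))) := by
  have hγ0 : 0 < γs := by linarith
  refine ⟨fun hl => VBDF2.exists_normH1_le_of_pos P hε hl hγ0.le hγss hroot hγs.le hφ0,
    fun T => VBDF2.exists_normH1_le P hε hlam hγ0 hγss hroot hγs hφ0 T, fun M => ?_⟩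
  have hM : 0 ≤ |M| := abs_nonneg M
  obtain ⟨B, hB⟩ := VBDF2.exists_coeff_le (V := V) P
    (fun s => hE1 _ (VBDF2.Domain.memH2BC_const P s)) hg.continuous hV.continuous hM
  obtain ⟨C, hC0, hC⟩ := VBDF2.IsFlow.exists_second_energy_le hd1 hd3 P hε hlam hg hgrowth
    (by linarith : 1 ≤ γs) hγss hroot hγs hM B ‖P.toL2 (P.laplacian φ0)‖
  obtain ⟨C₁, -, hC₁⟩ := VBDF2.Domain.exists_nonlinearBound hd1 hd3 P hg hgrowth hM one_pos
  refine ⟨C + 1, by linarith, fun T N τ φ r hm hs hb n hn => ?_⟩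
  have hf := hs.isFlow hm hφ0
  have hφM : ∀ k ≤ N, P.normH1 (φ k) ≤ |M| := fun k hk => by
    linarith [hb k hk, abs_nonneg (r k), le_abs_self M]
  have hrM : ∀ k ≤ N, |r k| ≤ |M| := fun k hk => by
    linarith [hb k hk, VBDF2.Domain.normH1_nonneg (P := P) (φ k), le_abs_self M]
  have hc := hB N φ r (fun k hk => (hf.regular k hk).1) hφM hrM
    fun k hk => (hC₁ _ _ (hf.regular k hk) (hφM k hk)).integrable
  have key := hC T N _ φ r _ hf (hm.update 0) hφM hc (by rw [hs.init_phi]) (n + 1) hn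
  have hgrad := VBDF2.Domain.grad_sub (hf.regular (n + 1) hn).1 (hf.regular n hn.le).1
  rw [VBDF2.dissip, Nat.add_sub_cancel, ← hgrad.2, VBDF2.Domain.norm_grad_sq hgrad.1,
    VBDF2.Domain.norm_toL2_sq (hf.regular (n + 1) hn).2.1,
    VBDF2.Domain.norm_grad_sq (hf.regular (n + 1) hn).1,
    VBDF2.Domain.norm_toL2_sq (hf.regular 0 (Nat.zero_le _)).2.1, hs.init_phi,
    VBDF2.ratio_update, Function.update_of_ne (Nat.succ_ne_zero n), VBDF2.weight] at key
  have hmax : ε ^ 2 / 2 * P.normSq (P.laplacian φ0)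
      ≤ max (γs ^ (3 / 2 : ℝ) / (1 + γs)) 1 * (ε ^ 2 / 2 * P.normSq (P.laplacian φ0)) :=
    le_mul_of_one_le_left (mul_nonneg (by positivity) (VBDF2.Domain.normSq_nonneg _))
      (le_max_right _ _)
  have hhalf : ∀ x y t : ℝ, x * (y / (2 * t)) = x / 2 * (y / t) := fun x y t => by ring
  rw [hhalf]
  linarith [hm.time_nonneg]
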